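/- **Setting.** Let $\mathcal M$ be an episodic Markov decision process with state space $\mathcal X$, action space $\mathcal A$, horizon $H$, transition kernels $P^h(\cdot\mid x,a)$, rewards $r^h(x,a,x')\in[0,1]$ and an initial distribution. Rewards are sparse: from every state and level, under any policy, the rewards collected until the end of the episode sum to at most $1$ almost surely. Write $z=(x,a)$, $f(x)=\max_a f(x,a)$, and, for $V:\mathcal X\to\mathbb R$, $$\mathcal T V(z^h)=\mathbb E[r^h+V(x^{h+1})\mid z^h],\qquad \mathcal T_2V(z^h)=\mathbb E[(r^h+V(x^{h+1}))^2\mid z^h].$$ Let $\mathcal F^h$ ($h\in[H]$) be finite classes of functions $\mathcal X\times\mathcal A\to[0,L]$, $L\ge1$, that are $\epsilon$-complete, $\epsilon\in[0,1]$: for every $V:\mathcal X\to[0,2]$ some $f\in\mathcal F^h$ satisfies $\|f-\mathcal TV\|_\infty\le\epsilon$, and for every $V:\mathcal X\to[0,1]$ some $f\in\mathcal F^h$ satisfies $\|f-\mathcal T_2V\|_\infty\le\epsilon$. Let $\mathcal W$ be a finite class of bonus functions, $\mathcal N=\max_h|\mathcal F^h|$, $\mathcal N_b=|\mathcal W|$,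 and let $T\in\mathbb N$, $0<\alpha\le1$, $\lambda>0$, $\delta>0$, $\epsilon_b\ge0$ and thresholds $u_t\in\mathbb R$ be given. Put $$D_{\mathcal F}(z;z_{[n]},\sigma_{[n]})^2=\sup_{f_1,f_2\in\mathcal F}\frac{(f_1(z)-f_2(z))^2}{\sum_{s\le n}\sigma_s^{-2}(f_1(z_s)-f_2(z_s))^2+\lambda}.$$ **Parameters.** Let $\delta'=\frac{\delta}{(T+1)(H+1)}$, $\Lambda=\bigl(2\log\frac{4LT}{\alpha}+2\bigr)\bigl(\log\frac{8L}{\alpha^2}+2\bigr)$, $\upsilon=\sqrt{\log(\mathcal N^2\Lambda/\delta')}$, $\iota=3\sqrt{\log(\mathcal N\mathcal N_b\Lambda/\delta')}$, $\dot\iota^2=2\log\frac{\mathcal N\mathcal N_b(2\log(18LT)+2)(\log(18L)+2)}{\delta'}$, $\iota'^2=2\log\frac{\mathcal N\mathcal N_b(2\log(32LT)+2)(\log(32L)+2)}{\delta'}$, and $$\beta_{t,1}=\sqrt{6\sqrt\lambda+156}\;\upsilon+\sqrt{8tL\epsilon/\alpha^2},\quad \beta_{t,2}^2=2(24L+21)\dot\iota^2+20tL\epsilon,\quad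 \bar\beta_t^2=8(11L+9)\iota'^2+32tL\epsilon .$$ **Bonus oracle.** $\mathcal B$ is a consistent bonus oracle for the radii $\beta_{t,1}$ and for the radii $\beta_{t,2}$. That is, for $\beta_t=\beta_{t,1}$ and for $\beta_t=\beta_{t,2}$, each $h\in[H]$, $t\in[T]$, weights $\sigma_{[t-1]}\ge\alpha$, data $\{(z_s,r_s,x'_s)\}_{s\in[t-1]}$ and $\hat f\in\mathcal F^h$, the output $b=\mathcal B(\sigma_{[t-1]},\text{data},\mathcal F^h,\hat f,\beta_t)$ lies in $\mathcal W$, is nonnegative, satisfies $b\ge|f-\hat f|$ pointwise for each $f\in\mathcal F^h$ with $\sum_{s<t}\sigma_s^{-2}(f(z_s)-\hat f(z_s))^2\le\beta_t^2$, and satisfies $b(z)\le C\bigl(D_{\mathcal F^h}(z;z_{[t-1]},\sigma_{[t-1]})\sqrt{\beta_t^2+\lambda}+\epsilon_b\beta_t\bigr)$ with a constant $0<C<\infty$. Consistent: for $t\le t'\le T$, if the weights and data at $t'$ extend those at $t$ and $\hat f_t,\hat f_{t'}\in\mathcal F^h$ are least-squares solutions for the respective weights and data, i.e. minimize $\sum_s\sigma_s^{-2}(f(z_s)-r_s-V(x'_s))^2$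 over $f\in\mathcal F^h$ for some (possibly different) target functions $V$, then the bonus at $t$ is pointwise at least the bonus at $t'$. **Algorithm (VO$Q$L).** In episodes $t=1,\dots,T$, put $f_{t,j}^{H+1}=0$ for $j=1,\pm2$ and, for $h=H,\dots,1$, let $\hat f_{t,1}^h$ minimize $\sum_{s<t}(\bar\sigma_s^h)^{-2}(f(z_s^h)-r_s^h-f_{t,1}^{h+1}(x_s^{h+1}))^2$ over $f\in\mathcal F^h$, let $\hat f_{t,\pm2}^h$ minimize $\sum_{s<t}(f(z_s^h)-r_s^h-f_{t,\pm2}^{h+1}(x_s^{h+1}))^2$, let $\hat g_t^h$ minimize $\sum_{s<t}\bigl(g(z_s^h)-(r_s^h+f_{t,1}^{h+1}(x_s^{h+1}))^2\bigr)^2$, let $b_{t,1}^h$ be the oracle's bonus for the weights $\bar\sigma^h_{[t-1]}$, centre $\hat f_{t,1}^h$ and radius $\beta_{t,1}$, let $b_{t,2}^h$ be the one for unit weights, centre $\hat f_{t,2}^h$ and radius $\beta_{t,2}$, and set $$f_{t,1}^h=\min(\hat f_{t,1}^h+b_{t,1}^h+\epsilon,1),\quad f_{t,2}^h=\min(\hat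 f_{t,2}^h+2b_{t,1}^h+b_{t,2}^h+3\epsilon,2),\quad f_{t,-2}^h=\max(\hat f_{t,-2}^h-b_{t,2}^h-\epsilon,0).$$ Then draw $x_t^1$ from the initial distribution and, for $h=1,\dots,H$, choose $a_t^h\in\arg\max_a f_{t,1}^h(x_t^h,a)$ if $f_{t,1}^{h'}(x_t^{h'})\ge f_{t,2}^{h'}(x_t^{h'})-u_t$ for all $h'\le h$, and $a_t^h\in\arg\max_af_{t,2}^h(x_t^h,a)$ otherwise; draw $x_t^{h+1}\sim P^h(\cdot\mid z_t^h)$ and receive $r_t^h=r^h(x_t^h,a_t^h,x_t^{h+1})$. The weights are $$\bar\sigma_t^h=\max\Bigl\{\sigma_t^h,\ \alpha,\ \sqrt2\,\iota\sqrt{f_{t,2}^h(z_t^h)-f_{t,-2}^h(z_t^h)},\ 2(\sqrt\upsilon+\iota)\sqrt{D_{\mathcal F^h}(z_t^h;z_{[t-1]}^h,\bar\sigma_{[t-1]}^h)}\Bigr\},$$ where $(\sigma_1^h)^2=4$ and, for $t\ge2$, $$(\sigma_t^h)^2=\min\Bigl(4,\ \hat g_t^h(z_t^h)-\hat f_{t,-2}^h(z_t^h)^2+D_{\mathcal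 F^h}(z_t^h;z_{[t-1]}^h,\mathbf 1)\bigl(\sqrt{\bar\beta_t^2+\lambda}+2L\sqrt{\beta_{t,2}^2+\lambda}\bigr)+2(1+L)\epsilon\Bigr)$$ (square roots of negative numbers are read as $0$). **Confidence sets.** $\mathcal F_{t,1}^h=\{f\in\mathcal F^h:\sum_{s<t}(\bar\sigma_s^h)^{-2}(f(z_s^h)-\hat f_{t,1}^h(z_s^h))^2\le\beta_{t,1}^2\}$, $\mathcal F_{t,\pm2}^h=\{f\in\mathcal F^h:\sum_{s<t}(f(z_s^h)-\hat f_{t,\pm2}^h(z_s^h))^2\le\beta_{t,2}^2\}$, $\mathcal G_t^h=\{g\in\mathcal F^h:\sum_{s<t}(g(z_s^h)-\hat g_t^h(z_s^h))^2\le\bar\beta_t^2\}$. **Proposition.** With probability at least $1-5\delta$ the following good event holds: for all $t\in[T]$ and $h\in[H]$ there are functions $\bar f_{t,1}^h,\bar f_{t,2}^h,\bar f_{t,-2}^h,\psi_t^h\in\mathcal F^h$ with $$\|\bar f_{t,j}^h-\mathcal Tf_{t,j}^{h+1}\|_\infty\le\epsilon\ (j=1,\pm2),\qquad \|\psi_t^h-\mathcal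 T_2f_{t,1}^{h+1}\|_\infty\le\epsilon,$$ and all such functions satisfy $\bar f_{t,1}^h\in\mathcal F_{t,1}^h$, $\bar f_{t,2}^h\in\mathcal F_{t,2}^h$, $\bar f_{t,-2}^h\in\mathcal F_{t,-2}^h$ and $\psi_t^h\in\mathcal G_t^h$. -/

import Mathlib

namespace VOQL

open MeasureTheory ProbabilityTheory

/-! Indexing: levels `h` and episodes `t` start at `0`.  Level `h < H` is the `(h+1)`-st step of an
episode, level `H` is the terminal level; episode `t < T` is the `(t+1)`-st episode, so that exactly
`t` episodes precede it. -/

/-- A time-inhomogeneous episodic Markov decision process with horizon `H`: transition kernels,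
rewards `r^h(x, a, x') ∈ [0,1]` and an initial distribution. -/
structure EpisodicMDP (X A : Type*) [MeasurableSpace X] [MeasurableSpace A] where
  H : ℕ
  P : ℕ → Kernel (X × A) X
  r : ℕ → X × A → X → ℝ
  init : Measure X
  markov : ∀ h, IsMarkovKernel (P h)
  init_prob : IsProbabilityMeasure init
  measurable_r : ∀ h, Measurable (fun p : (X × A) × X => r h p.1 p.2)
  r_mem : ∀ h < H, ∀ z x', r h z x' ∈ Set.Icc (0 : ℝ) 1

/-- One transition `(x, a, r, x')` of a data set, with `z = (x, a)`. -/
structure Sample (X A : Type*) where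
  z : X × A
  r : ℝ
  x' : X

/-- `f(x) = max_a f(x, a)`. -/
noncomputable def maxA {X A : Type*} (f : X × A → ℝ) (x : X) : ℝ := ⨆ a, f (x, a)

namespace EpisodicMDP

variable {X A : Type*} [MeasurableSpace X] [MeasurableSpace A] (M : EpisodicMDP X A)

/-- The Bellman operator `𝒯 V (z) = E[r^h + V(x^{h+1}) | z^h = z]`. -/
noncomputable def bellman (h : ℕ) (V : X → ℝ) (z : X × A) : ℝ :=
  ∫ x', (M.r h z x' + V x') ∂(M.P h z)

/-- The second-moment operator `𝒯₂ V (z) = E[(r^h + V(x^{h+1}))² | z^h = z]`. -/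
noncomputable def bellman₂ (h : ℕ) (V : X → ℝ) (z : X × A) : ℝ :=
  ∫ x', (M.r h z x' + V x') ^ 2 ∂(M.P h z)

/-- Starting from state `x` at level `h`, whatever actions are taken (they may depend on everything
seen so far), the total reward of the next `k` steps is almost surely at most `c`. -/
def RewardLE : ℕ → ℕ → ℝ → X → Prop
  | 0, _, c, _ => 0 ≤ c
  | k + 1, h, c, x =>
      ∀ a, ∀ᵐ x' ∂(M.P h (x, a)), RewardLE k (h + 1) (c - M.r h (x, a) x') x'

/-- Sparse rewards: under any policy the rewards collected until the end of the episode add up to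
at most `1`. -/
def SparseReward : Prop := ∀ h < M.H, ∀ x, M.RewardLE (M.H - h) h 1 x

/-- Optimal action values with `k` steps to go from level `h` on. -/
noncomputable def optQAux : ℕ → ℕ → X × A → ℝ
  | 0, _ => fun _ => 0
  | k + 1, h => M.bellman h (maxA (optQAux k (h + 1)))

/-- The optimal action value function `Q_⋆^h`. -/
noncomputable def optQ (h : ℕ) : X × A → ℝ := M.optQAux (M.H - h) h

end EpisodicMDP

/-- A bonus oracle: it is given the level `h`, the number `n` of past episodes, the weights and the
level-`h` samples of these episodes, a centre `f̂` and a radius `β`, and returns a bonus function. -/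
abbrev Oracle (X A : Type*) : Type _ :=
  ℕ → (n : ℕ) → (Fin n → ℝ) → (Fin n → Sample X A) → (X × A → ℝ) → ℝ → X × A → ℝ

/-- `g` minimises `∑ᵢ (f(zᵢ) - yᵢ)² / σᵢ²` over `f ∈ F`. -/
def IsLeastSquares {Z : Type*} (F : Finset (Z → ℝ)) {n : ℕ} (σ : Fin n → ℝ) (z : Fin n → Z)
    (y : Fin n → ℝ) (g : Z → ℝ) : Prop :=
  g ∈ F ∧ ∀ f ∈ F, ∑ i, (g (z i) - y i) ^ 2 / σ i ^ 2 ≤ ∑ i, (f (z i) - y i) ^ 2 / σ i ^ 2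

/-- The confidence set `{f ∈ F : ∑ᵢ (f(zᵢ) - f̂(zᵢ))² / σᵢ² ≤ β²}`. -/
def confSet {Z : Type*} (F : Finset (Z → ℝ)) {n : ℕ} (σ : Fin n → ℝ) (z : Fin n → Z)
    (fhat : Z → ℝ) (β : ℝ) : Set (Z → ℝ) :=
  {f | f ∈ F ∧ ∑ i, (f (z i) - fhat (z i)) ^ 2 / σ i ^ 2 ≤ β ^ 2}

/-- The quantity `D_F(z; z_{[n]}, σ_{[n]})` of the generalized Eluder dimension. -/
noncomputable def eluderD {Z : Type*} (F : Finset (Z → ℝ)) (lam : ℝ) {n : ℕ} (σ : Fin n → ℝ)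
    (zs : Fin n → Z) (z : Z) : ℝ :=
  √(⨆ p : F × F, (p.1.1 z - p.2.1 z) ^ 2 /
    (∑ i, (p.1.1 (zs i) - p.2.1 (zs i)) ^ 2 / σ i ^ 2 + lam))

/-- All inputs of the algorithm: the MDP, the number of episodes `T`, the function classes `F^h`
with range `[0, L]`, the bonus class `W`, the oracle, and the numerical parameters. -/
structure Setup (X A : Type*) [MeasurableSpace X] [MeasurableSpace A] where
  M : EpisodicMDP X A
  T : ℕ
  F : ℕ → Finset (X × A → ℝ)
  W : Finset (X × A → ℝ)
  oracle : Oracle X A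
  L : ℝ
  eps : ℝ
  epsb : ℝ
  α : ℝ
  lam : ℝ
  δ : ℝ
  u : ℕ → ℝ

/-- One realization of everything that a run of the algorithm produces: states, actions, the four
regression solutions and the weights `σ̄`, indexed by episode and level. -/
structure RunData (X A : Type*) where
  x : ℕ → ℕ → X
  a : ℕ → ℕ → A
  fhat1 : ℕ → ℕ → X × A → ℝ
  fhat2 : ℕ → ℕ → X × A → ℝ
  fhatm2 : ℕ → ℕ → X × A → ℝ
  ghat : ℕ → ℕ → X × A → ℝ
  sigBar : ℕ → ℕ → ℝ

namespace Setup

variable {X A : Type*} [MeasurableSpace X] [MeasurableSpace A] (S : Setup X A)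

/-- `𝒩 = max_h |F^h|`. -/
def N : ℕ := (Finset.range S.M.H).sup fun h => (S.F h).card

/-- `𝒩_b = |W|`. -/
def Nb : ℕ := S.W.card

/-- `δ_{t,h} = δ / ((T+1)(H+1))`. -/
noncomputable def δth : ℝ := S.δ / ((S.T + 1) * (S.M.H + 1))

/-- `(2 log(4LT/α) + 2)(log(8L/α²) + 2)`. -/
noncomputable def logFactor : ℝ :=
  (2 * Real.log (4 * S.L * S.T / S.α) + 2) * (Real.log (8 * S.L / S.α ^ 2) + 2)

/-- `υ(δ_{t,h})`. -/
noncomputable def ups : ℝ := √(Real.log ((S.N : ℝ) ^ 2 * S.logFactor / S.δth))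

/-- `ι(δ_{t,h})`. -/
noncomputable def iota : ℝ := 3 * √(Real.log ((S.N : ℝ) * S.Nb * S.logFactor / S.δth))

/-- `ι̇(δ_{t,h})`. -/
noncomputable def iotaDot : ℝ :=
  √(2 * Real.log ((S.N : ℝ) * S.Nb * (2 * Real.log (18 * S.L * S.T) + 2) *
    (Real.log (18 * S.L) + 2) / S.δth))

/-- `ι'(δ_{t,h})`. -/
noncomputable def iotaPrime : ℝ :=
  √(2 * Real.log ((S.N : ℝ) * S.Nb * (2 * Real.log (32 * S.L * S.T) + 2) *
    (Real.log (32 * S.L) + 2) / S.δth))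

/-- The radius `β_{t,1}` of the optimistic confidence sets, in the `(t+1)`-st episode. -/
noncomputable def beta1 (t : ℕ) : ℝ :=
  √(6 * √S.lam + 156) *
      √(Real.log ((S.N : ℝ) ^ 2 * (S.T + 1) * (S.M.H + 1) * S.logFactor / S.δ)) +
    √(8 * (t + 1) * S.L / S.α ^ 2 * S.eps)

/-- The radius `β_{t,2}` of the overly optimistic and overly pessimistic confidence sets. -/
noncomputable def beta2 (t : ℕ) : ℝ :=
  √(2 * (24 * S.L + 21) * S.iotaDot ^ 2 + 20 * (t + 1) * S.L * S.eps)

/-- The radius `β̄_t` of the second-moment confidence sets. -/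
noncomputable def betaBar (t : ℕ) : ℝ :=
  √(8 * (11 * S.L + 9) * S.iotaPrime ^ 2 + 32 * (t + 1) * S.L * S.eps)

/-- `ε`-completeness: the functions of `F^h` have range `[0, L]`, and `F^h` contains an
`ε`-approximation of `𝒯 V` for each `V : X → [0,2]` and one of `𝒯₂ V` for each `V : X → [0,1]`. -/
structure EpsComplete : Prop where
  range : ∀ h < S.M.H, ∀ f ∈ S.F h, ∀ z, f z ∈ Set.Icc 0 S.L
  first : ∀ h < S.M.H, ∀ V : X → ℝ, Measurable V → (∀ x, V x ∈ Set.Icc (0 : ℝ) 2) →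
    ∃ f ∈ S.F h, ∀ z, |f z - S.M.bellman h V z| ≤ S.eps
  second : ∀ h < S.M.H, ∀ V : X → ℝ, Measurable V → (∀ x, V x ∈ Set.Icc (0 : ℝ) 1) →
    ∃ f ∈ S.F h, ∀ z, |f z - S.M.bellman₂ h V z| ≤ S.eps

/-- The three defining properties of a bonus oracle, for the radii `β n` (`n` the number of past
episodes) and weights that are at least `α`. -/
def IsBonusOracle (β : ℕ → ℝ) : Prop :=
  ∃ C : ℝ, 0 < C ∧ ∀ h < S.M.H, ∀ n < S.T, ∀ σ : Fin n → ℝ, (∀ i, S.α ≤ σ i) →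
    ∀ D : Fin n → Sample X A, ∀ fhat ∈ S.F h,
      S.oracle h n σ D fhat (β n) ∈ S.W ∧
      (∀ z, 0 ≤ S.oracle h n σ D fhat (β n) z) ∧
      (∀ f ∈ confSet (S.F h) σ (fun i => (D i).z) fhat (β n), ∀ z,
        |f z - fhat z| ≤ S.oracle h n σ D fhat (β n) z) ∧
      ∀ z, S.oracle h n σ D fhat (β n) z ≤
        C * (eluderD (S.F h) S.lam σ (fun i => (D i).z) z * √(β n ^ 2 + S.lam) + S.epsb * β n)

/-- Consistency of the oracle for the radii `β n`: the bonus does not increase when weights and data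
are extended, for centres that solve the regression on the respective data with some targets `V`,
`V'`. -/
def IsConsistent (β : ℕ → ℝ) : Prop :=
  ∀ h < S.M.H, ∀ (n n' : ℕ) (hn : n ≤ n'), n' < S.T →
    ∀ σ : Fin n' → ℝ, (∀ i, S.α ≤ σ i) → ∀ D : Fin n' → Sample X A,
    ∀ (V V' : X → ℝ) (fhat fhat' : X × A → ℝ),
      IsLeastSquares (S.F h) (fun i => σ (Fin.castLE hn i)) (fun i => (D (Fin.castLE hn i)).z)
        (fun i => (D (Fin.castLE hn i)).r + V (D (Fin.castLE hn i)).x') fhat →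
      IsLeastSquares (S.F h) σ (fun i => (D i).z) (fun i => (D i).r + V' (D i).x') fhat' →
      ∀ z, S.oracle h n' σ D fhat' (β n') z ≤
        S.oracle h n (fun i => σ (Fin.castLE hn i)) (fun i => D (Fin.castLE hn i)) fhat (β n) z

/-- `min(f̂ + b₁ + ε, 1)`. -/
noncomputable def optimistic (f b₁ : X × A → ℝ) (z : X × A) : ℝ := min (f z + b₁ z + S.eps) 1

/-- `min(f̂ + 2 b₁ + b₂ + 3ε, 2)`. -/
noncomputable def overlyOptimistic (f b₁ b₂ : X × A → ℝ) (z : X × A) : ℝ :=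
  min (f z + 2 * b₁ z + b₂ z + 3 * S.eps) 2

/-- `max(f̂ - b₂ - ε, 0)`. -/
noncomputable def overlyPessimistic (f b₂ : X × A → ℝ) (z : X × A) : ℝ := max (f z - b₂ z - S.eps) 0

/-- Measurability conventions: the function classes consist of measurable functions, and maximizing
over the actions gives measurable functions of the state. -/
structure MeasurabilityConventions : Prop where
  F_meas : ∀ h < S.M.H, ∀ f ∈ S.F h, Measurable f
  W_meas : ∀ w ∈ S.W, Measurable w
  max_opt : ∀ h < S.M.H, ∀ f ∈ S.F h, ∀ b ∈ S.W, Measurable (maxA (S.optimistic f b))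
  max_over : ∀ h < S.M.H, ∀ f ∈ S.F h, ∀ b ∈ S.W, ∀ b' ∈ S.W,
    Measurable (maxA (S.overlyOptimistic f b b'))
  max_pess : ∀ h < S.M.H, ∀ f ∈ S.F h, ∀ b ∈ S.W, Measurable (maxA (S.overlyPessimistic f b))
  max_star : ∀ h < S.M.H, Measurable (maxA (S.M.optQ h))

/-! Quantities computed from one realization `R` of a run. -/

variable (R : RunData X A)

/-- The state-action pair `z_t^h`. -/
def z (t h : ℕ) : X × A := (R.x t h, R.a t h)

/-- The level-`h` data of the `t` episodes that precede episode `t`; rewards are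
`r^h(x_s^h, a_s^h, x_s^{h+1})`. -/
def data (t h : ℕ) (s : Fin t) : Sample X A :=
  ⟨z R s h, S.M.r h (z R s h) (R.x s (h + 1)), R.x s (h + 1)⟩

/-- The past state-action pairs `z_s^h`, `s < t`. -/
def zs (t h : ℕ) (s : Fin t) : X × A := z R s h

/-- The past weights `σ̄_s^h`, `s < t`. -/
def sigs (t h : ℕ) (s : Fin t) : ℝ := R.sigBar s h

/-- The bonus `b_{t,1}^h`. -/
noncomputable def b1 (t h : ℕ) : X × A → ℝ :=
  S.oracle h t (sigs R t h) (S.data R t h) (R.fhat1 t h) (S.beta1 t)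

/-- The bonus `b_{t,2}^h`. -/
noncomputable def b2 (t h : ℕ) : X × A → ℝ :=
  S.oracle h t (fun _ => 1) (S.data R t h) (R.fhat2 t h) (S.beta2 t)

/-- The optimistic function `f_{t,1}^h`; it is `0` at the terminal level. -/
noncomputable def f1 (t h : ℕ) : X × A → ℝ :=
  if h < S.M.H then S.optimistic (R.fhat1 t h) (S.b1 R t h) else fun _ => 0

/-- The overly optimistic function `f_{t,2}^h`. -/
noncomputable def f2 (t h : ℕ) : X × A → ℝ :=
  if h < S.M.H then S.overlyOptimistic (R.fhat2 t h) (S.b1 R t h) (S.b2 R t h) else fun _ => 0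

/-- The overly pessimistic function `f_{t,-2}^h`. -/
noncomputable def fm2 (t h : ℕ) : X × A → ℝ :=
  if h < S.M.H then S.overlyPessimistic (R.fhatm2 t h) (S.b2 R t h) else fun _ => 0

/-- The variance estimate `(σ_t^h)²`. -/
noncomputable def sigmaSq (t h : ℕ) : ℝ :=
  if t = 0 then 4 else
    min 4 (R.ghat t h (z R t h) - R.fhatm2 t h (z R t h) ^ 2 +
      eluderD (S.F h) S.lam (fun _ => 1) (zs R t h) (z R t h) *
        (√(S.betaBar t ^ 2 + S.lam) + 2 * S.L * √(S.beta2 t ^ 2 + S.lam)) +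
      2 * (1 + S.L) * S.eps)

/-- The value prescribed for the weight `σ̄_t^h`; it uses the weights of earlier episodes only. -/
noncomputable def sigBarRule (t h : ℕ) : ℝ :=
  max (max (√(S.sigmaSq R t h)) S.α)
    (max (√2 * S.iota * √(S.f2 R t h (z R t h) - S.fm2 R t h (z R t h)))
      (2 * (√S.ups + S.iota) *
        √(eluderD (S.F h) S.lam (sigs R t h) (zs R t h) (z R t h))))

/-- The realization `R` follows the algorithm in all episodes `t < T` and levels `h < H`. -/
structure FollowsAlgorithm : Prop where
  fhat1_ls : ∀ t < S.T, ∀ h < S.M.H,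
    IsLeastSquares (S.F h) (sigs R t h) (zs R t h)
      (fun s => (S.data R t h s).r + maxA (S.f1 R t (h + 1)) (S.data R t h s).x') (R.fhat1 t h)
  fhat2_ls : ∀ t < S.T, ∀ h < S.M.H,
    IsLeastSquares (S.F h) (fun _ => 1) (zs R t h)
      (fun s => (S.data R t h s).r + maxA (S.f2 R t (h + 1)) (S.data R t h s).x') (R.fhat2 t h)
  fhatm2_ls : ∀ t < S.T, ∀ h < S.M.H,
    IsLeastSquares (S.F h) (fun _ => 1) (zs R t h)
      (fun s => (S.data R t h s).r + maxA (S.fm2 R t (h + 1)) (S.data R t h s).x') (R.fhatm2 t h)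
  ghat_ls : ∀ t < S.T, ∀ h < S.M.H,
    IsLeastSquares (S.F h) (fun _ => 1) (zs R t h)
      (fun s => ((S.data R t h s).r + maxA (S.f1 R t (h + 1)) (S.data R t h s).x') ^ 2)
      (R.ghat t h)
  sigBar_eq : ∀ t < S.T, ∀ h < S.M.H, R.sigBar t h = S.sigBarRule R t h
  /-- As long as the optimistic values are within `u_t` of the overly optimistic ones, act greedily
  for `f_{t,1}`, afterwards act greedily for `f_{t,2}`. -/
  greedy1 : ∀ t < S.T, ∀ h < S.M.H,
    (∀ h' ≤ h, maxA (S.f2 R t h') (R.x t h') - S.u t ≤ maxA (S.f1 R t h') (R.x t h')) →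
    ∀ a, S.f1 R t h (R.x t h, a) ≤ S.f1 R t h (R.x t h, R.a t h)
  greedy2 : ∀ t < S.T, ∀ h < S.M.H,
    ¬ (∀ h' ≤ h, maxA (S.f2 R t h') (R.x t h') - S.u t ≤ maxA (S.f1 R t h') (R.x t h')) →
    ∀ a, S.f2 R t h (R.x t h, a) ≤ S.f2 R t h (R.x t h, R.a t h)

/-- The confidence set `F_{t,1}^h`. -/
def conf1 (t h : ℕ) : Set (X × A → ℝ) :=
  confSet (S.F h) (sigs R t h) (zs R t h) (R.fhat1 t h) (S.beta1 t)

/-- The confidence set `F_{t,2}^h`. -/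
def conf2 (t h : ℕ) : Set (X × A → ℝ) :=
  confSet (S.F h) (fun _ => 1) (zs R t h) (R.fhat2 t h) (S.beta2 t)

/-- The confidence set `F_{t,-2}^h`. -/
def confm2 (t h : ℕ) : Set (X × A → ℝ) :=
  confSet (S.F h) (fun _ => 1) (zs R t h) (R.fhatm2 t h) (S.beta2 t)

/-- The confidence set `G_t^h`. -/
def confG (t h : ℕ) : Set (X × A → ℝ) :=
  confSet (S.F h) (fun _ => 1) (zs R t h) (R.ghat t h) (S.betaBar t)

/-- The functions of `F^h` that approximate `g` uniformly up to `ε`. -/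
def approximants (h : ℕ) (g : X × A → ℝ) : Set (X × A → ℝ) :=
  {f | f ∈ S.F h ∧ ∀ z, |f z - g z| ≤ S.eps}

/-- The good event: for all episodes and levels, `ε`-approximants in `F^h` of `𝒯 f_{t,j}^{h+1}`,
`j = 1, 2, -2`, and of `𝒯₂ f_{t,1}^{h+1}` exist, and every choice of them lies in the corresponding
confidence set. -/
def GoodEvent : Prop :=
  ∀ t < S.T, ∀ h < S.M.H,
    ((S.approximants h (S.M.bellman h (maxA (S.f1 R t (h + 1))))).Nonempty ∧
      S.approximants h (S.M.bellman h (maxA (S.f1 R t (h + 1)))) ⊆ S.conf1 R t h) ∧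
    ((S.approximants h (S.M.bellman h (maxA (S.f2 R t (h + 1))))).Nonempty ∧
      S.approximants h (S.M.bellman h (maxA (S.f2 R t (h + 1)))) ⊆ S.conf2 R t h) ∧
    ((S.approximants h (S.M.bellman h (maxA (S.fm2 R t (h + 1))))).Nonempty ∧
      S.approximants h (S.M.bellman h (maxA (S.fm2 R t (h + 1)))) ⊆ S.confm2 R t h) ∧
    ((S.approximants h (S.M.bellman₂ h (maxA (S.f1 R t (h + 1))))).Nonempty ∧
      S.approximants h (S.M.bellman₂ h (maxA (S.f1 R t (h + 1)))) ⊆ S.confG R t h)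

/-- A random run of the algorithm in the MDP.  `𝓗 t h` is the information available immediately
before the state `x_t^h` is drawn: it contains the previous episodes, the steps of episode `t`
before level `h`, the functions computed before episode `t`, and possibly further randomization. -/
structure IsRandomRun {Ω : Type*} [mΩ : MeasurableSpace Ω] (μ : Measure Ω)
    (𝓗 : ℕ → ℕ → MeasurableSpace Ω) (R : Ω → RunData X A) : Prop where
  follows : ∀ ω, S.FollowsAlgorithm (R ω)
  le : ∀ t h, 𝓗 t h ≤ mΩ
  mono_level : ∀ t h, h < S.M.H → 𝓗 t h ≤ 𝓗 t (h + 1)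
  mono_episode : ∀ t, 𝓗 t S.M.H ≤ 𝓗 (t + 1) 0
  x_meas : ∀ t < S.T, ∀ h < S.M.H, Measurable[𝓗 t (h + 1)] fun ω => (R ω).x t h
  x_last_meas : ∀ t < S.T, Measurable[𝓗 (t + 1) 0] fun ω => (R ω).x t S.M.H
  a_meas : ∀ t < S.T, ∀ h < S.M.H, Measurable[𝓗 t (h + 1)] fun ω => (R ω).a t h
  fhat1_meas : ∀ t < S.T, ∀ h < S.M.H, ∀ f, MeasurableSet[𝓗 t 0] {ω | (R ω).fhat1 t h = f}
  fhat2_meas : ∀ t < S.T, ∀ h < S.M.H, ∀ f, MeasurableSet[𝓗 t 0] {ω | (R ω).fhat2 t h = f}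
  fhatm2_meas : ∀ t < S.T, ∀ h < S.M.H, ∀ f, MeasurableSet[𝓗 t 0] {ω | (R ω).fhatm2 t h = f}
  ghat_meas : ∀ t < S.T, ∀ h < S.M.H, ∀ f, MeasurableSet[𝓗 t 0] {ω | (R ω).ghat t h = f}
  b1_meas : ∀ t < S.T, ∀ h < S.M.H, ∀ b, MeasurableSet[𝓗 t 0] {ω | S.b1 (R ω) t h = b}
  b2_meas : ∀ t < S.T, ∀ h < S.M.H, ∀ b, MeasurableSet[𝓗 t 0] {ω | S.b2 (R ω) t h = b}
  /-- Given the past, the first state of an episode has the initial distribution. -/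
  law_init : ∀ t < S.T, ∀ E, MeasurableSet[𝓗 t 0] E → ∀ B : Set X, MeasurableSet B →
    μ (E ∩ {ω | (R ω).x t 0 ∈ B}) = μ E * S.M.init B
  /-- Given the past, the state after `z_t^h` has distribution `P^h(z_t^h)`. -/
  law_step : ∀ t < S.T, ∀ h < S.M.H, ∀ E, MeasurableSet[𝓗 t (h + 1)] E →
    ∀ B : Set X, MeasurableSet B →
    μ (E ∩ {ω | (R ω).x t (h + 1) ∈ B}) = ∫⁻ ω in E, S.M.P h (z (R ω) t h) B ∂μ

end Setup

end VOQL

/-! Every regression obeys the basic inequality of least squares. If `f` is an ε-approximate Bellman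
backup and `g` the minimiser, then Q = ∑ (f - g)²/σ² is at most twice the noise ∑ (g - f)/σ² · η,
where η is the target minus its conditional mean, plus a term proportional to ε. The value function
V in the target depends on the data, but lies in a finite class built from `F` and `W`. So it
suffices to bound the noise for each fixed triple (V, f, g) by an exponential supermartingale and to
take a union bound (`measure_not_conc_le`).

With unit weights, Hoeffding's lemma bounds the noise by Q/4 plus a constant, and the Q-term is
absorbed (`sum_sq_le_of_noiseConc`).

The weighted regression has a radius free of 𝒩_b, and a plain union bound over V would be too
expensive. Write V = V⋆ + (V - V⋆). The function V⋆ is fixed, so no union over V is needed, and its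
return has conditional variance at most σ̄² (`variance_star_le`). The remainder needs the union
bound, but its conditional variance in an earlier episode s is at most the gap f_{s,2} - f_{s,-2},
hence at most σ̄_s²/(2ι²) (`variance_diff_le`); this small factor pays for the union. Bernstein's
bound is applied on a dyadic grid of scales matching the unknown Q, the increments being controlled
by the D_F-term of σ̄. The result, Q ≤ 5υ√(2^k + λ) + 2E with Q ≤ 2^k ≤ 2Q, is solved in
`le_radius_sq_of_self_bound`.

The variance bounds presuppose f_{s,-2} ≤ Q⋆ ≤ f_{s,1} and f_{t,1} ≤ f_{s,2} for s ≤ t, and these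
order relations rest in turn on valid confidence sets. The circle is opened by induction, forward
over episodes and backward over levels (`fm2_le_optQ`, `optimism_of_conc`): validity at level h only
needs the relations at level h + 1. Consistency of the oracle enters in f_{t,1} ≤ f_{s,2}, where a
bonus of episode t must be dominated by the one of episode s. -/

namespace VOQL

open MeasureTheory ProbabilityTheory

/-! ### Exponential tail bounds for sums of adapted noise -/

/-- If `x'` has conditional law `κ (W ·)` given `W`, expectations of functions of `(W, x')` are
iterated integrals. -/
theorem lintegral_eq_of_conditional_law {Ω Ω' X : Type*} [MeasurableSpace Ω] [MeasurableSpace Ω']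
    [MeasurableSpace X] {μ : Measure Ω} [IsFiniteMeasure μ] {W : Ω → Ω'} (hW : Measurable W)
    {x' : Ω → X} (hx' : Measurable x') (κ : Kernel Ω' X) [IsMarkovKernel κ]
    (hlaw : ∀ E, MeasurableSet E → ∀ B, MeasurableSet B →
      μ (W ⁻¹' E ∩ x' ⁻¹' B) = ∫⁻ ω in W ⁻¹' E, κ (W ω) B ∂μ)
    {k : Ω' × X → ENNReal} (hk : Measurable k) :
    ∫⁻ ω, k (W ω, x' ω) ∂μ = ∫⁻ ω, ∫⁻ y, k (W ω, y) ∂(κ (W ω)) ∂μ := by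
  have hmap : μ.map (fun ω => (W ω, x' ω)) = (μ.map W) ⊗ₘ κ := by
    refine Measure.ext_prod fun {E B} hE hB => ?_
    rw [Measure.map_apply (hW.prodMk hx') (hE.prod hB), Measure.compProd_apply_prod hE hB,
      setLIntegral_map hE (κ.measurable_coe hB) hW]
    exact hlaw E hE B hB
  calc ∫⁻ ω, k (W ω, x' ω) ∂μ = ∫⁻ p, k p ∂(μ.map (fun ω => (W ω, x' ω))) :=
        (lintegral_map hk (hW.prodMk hx')).symm
    _ = ∫⁻ w, ∫⁻ y, k (w, y) ∂(κ w) ∂(μ.map W) := by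
        rw [hmap, Measure.lintegral_compProd hk]
    _ = _ := lintegral_map hk.lintegral_kernel_prod_right' hW

/-- `n` transitions `z s ↦ x' s` whose next states have, given the past `𝒢 s`, the law `κ (z s)`. -/
structure AdaptedTransitions {Ω Z X : Type*} [mΩ : MeasurableSpace Ω] [MeasurableSpace Z]
    [MeasurableSpace X] (μ : Measure Ω) (κ : Kernel Z X) (n : ℕ) (𝒢 : ℕ → MeasurableSpace Ω)
    (z : ℕ → Ω → Z) (x' : ℕ → Ω → X) : Prop where
  le : ∀ s, 𝒢 s ≤ mΩ
  mono : ∀ s, 𝒢 s ≤ 𝒢 (s + 1)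
  z_meas : ∀ s < n, Measurable[𝒢 s] (z s)
  x'_meas : ∀ s < n, Measurable[𝒢 (s + 1)] (x' s)
  law : ∀ s < n, ∀ E, MeasurableSet[𝒢 s] E → ∀ B, MeasurableSet B →
    μ (E ∩ x' s ⁻¹' B) = ∫⁻ ω in E, κ (z s ω) B ∂μ

namespace AdaptedTransitions

variable {Ω Z X : Type*} [mΩ : MeasurableSpace Ω] [MeasurableSpace Z] [MeasurableSpace X]
  {μ : Measure Ω} [IsProbabilityMeasure μ] {κ : Kernel Z X} [IsMarkovKernel κ] {n : ℕ}
  {𝒢 : ℕ → MeasurableSpace Ω} {z : ℕ → Ω → Z} {x' : ℕ → Ω → X}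

/-- The past as a whole plays the role of the conditioning variable: `W` is the identity from Ω to Ω
with the smaller σ-algebra `𝒢 s`, and the kernel is `κ` pulled back along `z s`. -/
theorem lintegral_eq (h : AdaptedTransitions μ κ n 𝒢 z x') {s : ℕ} (hs : s < n)
    {k : Ω × X → ENNReal} (hk : Measurable[(𝒢 s).prod inferInstance] k) :
    ∫⁻ ω, k (ω, x' s ω) ∂μ = ∫⁻ ω, ∫⁻ y, k (ω, y) ∂(κ (z s ω)) ∂μ := by
  have hz := h.z_meas s hs
  have hid : @Measurable Ω Ω mΩ (𝒢 s) id := fun E hE => h.le s E hE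
  let κ' : @Kernel Ω X (𝒢 s) _ := Kernel.comap κ (z s) hz
  have : @IsMarkovKernel Ω X (𝒢 s) _ κ' := Kernel.IsMarkovKernel.comap κ hz
  exact @lintegral_eq_of_conditional_law Ω Ω X mΩ (𝒢 s) _ μ _ id hid (x' s)
    ((h.x'_meas s hs).mono (h.le _) le_rfl) κ' this (fun E hE B hB => h.law s hs E hE B hB) k hk

/-- The partial products of factors with conditional mean at most `1` have mean at most `1`. -/
theorem lintegral_exp_sum_le (h : AdaptedTransitions μ κ n 𝒢 z x') {e : Z → X → ℝ}
    (he : Measurable (fun p : Z × X => e p.1 p.2)) {c v : ℕ → Ω → ℝ}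
    (hc : ∀ s < n, Measurable[𝒢 s] (c s)) (hv : ∀ s < n, Measurable[𝒢 s] (v s))
    (hmgf : ∀ s < n, ∀ ω, ∫⁻ y, ENNReal.ofReal
      (Real.exp (c s ω * e (z s ω) y - v s ω)) ∂(κ (z s ω)) ≤ 1) {m : ℕ} (hm : m ≤ n) :
    Measurable[𝒢 m] (fun ω => ∑ s ∈ Finset.range m, (c s ω * e (z s ω) (x' s ω) - v s ω)) ∧
    ∫⁻ ω, ENNReal.ofReal (Real.exp (∑ s ∈ Finset.range m,
      (c s ω * e (z s ω) (x' s ω) - v s ω))) ∂μ ≤ 1 := by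
  induction m with
  | zero => simp
  | succ m ih =>
    obtain ⟨ihm, ihl⟩ := ih (by omega)
    have hmn : m < n := by omega
    constructor
    · simp only [Finset.sum_range_succ]
      refine (ihm.mono (h.mono m) le_rfl).add ?_
      refine Measurable.sub ?_ ((hv m hmn).mono (h.mono m) le_rfl)
      refine ((hc m hmn).mono (h.mono m) le_rfl).mul ?_
      exact he.comp (((h.z_meas m hmn).mono (h.mono m) le_rfl).prodMk (h.x'_meas m hmn))
    · set G : Ω → ℝ := fun ω => ∑ s ∈ Finset.range m, (c s ω * e (z s ω) (x' s ω) - v s ω)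
      let k : Ω × X → ENNReal := fun p => ENNReal.ofReal (Real.exp (G p.1)) *
        ENNReal.ofReal (Real.exp (c m p.1 * e (z m p.1) p.2 - v m p.1))
      have hfst : @Measurable (Ω × X) Ω ((𝒢 m).prod inferInstance) (𝒢 m) Prod.fst :=
        @measurable_fst Ω X (𝒢 m) _
      have hsnd : @Measurable (Ω × X) X ((𝒢 m).prod inferInstance) _ Prod.snd :=
        @measurable_snd Ω X (𝒢 m) _
      have hk : Measurable[(𝒢 m).prod inferInstance] k := by
        have h1 := (Real.measurable_exp.comp (ihm.comp hfst)).ennreal_ofReal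
        have h2 := he.comp (((h.z_meas m hmn).comp hfst).prodMk hsnd)
        have h3 := (Real.measurable_exp.comp
          ((((hc m hmn).comp hfst).mul h2).sub ((hv m hmn).comp hfst))).ennreal_ofReal
        exact h1.mul h3
      calc ∫⁻ ω, ENNReal.ofReal (Real.exp (∑ s ∈ Finset.range (m + 1),
              (c s ω * e (z s ω) (x' s ω) - v s ω))) ∂μ
          = ∫⁻ ω, k (ω, x' m ω) ∂μ := by
            refine lintegral_congr fun ω => ?_
            rw [Finset.sum_range_succ, Real.exp_add, ENNReal.ofReal_mul (Real.exp_pos _).le]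
        _ = ∫⁻ ω, ∫⁻ y, k (ω, y) ∂(κ (z m ω)) ∂μ := h.lintegral_eq hmn hk
        _ ≤ ∫⁻ ω, ENNReal.ofReal (Real.exp (G ω)) ∂μ := by
            refine lintegral_mono fun ω => ?_
            simp only [k]
            rw [lintegral_const_mul' _ _ ENNReal.ofReal_ne_top]
            -- The factor from the past is constant in the inner integral, and the last factor has
            -- conditional mean at most 1.
            exact (mul_le_mul_right (hmgf m hmn ω) _).trans (by rw [mul_one])
        _ ≤ 1 := ihl

/-- Chernoff bound for the noise of adapted transitions. -/
theorem measure_sum_ge_le (h : AdaptedTransitions μ κ n 𝒢 z x') {e : Z → X → ℝ}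
    (he : Measurable (fun p : Z × X => e p.1 p.2)) {c v : ℕ → Ω → ℝ}
    (hc : ∀ s < n, Measurable[𝒢 s] (c s)) (hv : ∀ s < n, Measurable[𝒢 s] (v s))
    (hmgf : ∀ s < n, ∀ ω, ∫⁻ y, ENNReal.ofReal
      (Real.exp (c s ω * e (z s ω) y - v s ω)) ∂(κ (z s ω)) ≤ 1) (Y : ℝ) :
    μ {ω | ∑ s ∈ Finset.range n, v s ω + Y ≤
      ∑ s ∈ Finset.range n, c s ω * e (z s ω) (x' s ω)} ≤ ENNReal.ofReal (Real.exp (-Y)) := by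
  obtain ⟨hm, hl⟩ := h.lintegral_exp_sum_le he hc hv hmgf le_rfl
  set G : Ω → ℝ := fun ω => ∑ s ∈ Finset.range n, (c s ω * e (z s ω) (x' s ω) - v s ω) with hG
  have hm' : Measurable G := hm.mono (h.le n) le_rfl
  calc μ {ω | ∑ s ∈ Finset.range n, v s ω + Y ≤ ∑ s ∈ Finset.range n, c s ω * e (z s ω) (x' s ω)}
      ≤ μ {ω | ENNReal.ofReal (Real.exp Y) ≤ ENNReal.ofReal (Real.exp (G ω))} := by
        refine measure_mono fun ω hω => ?_
        simp only [Set.mem_ofPred_eq] at hω ⊢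
        refine ENNReal.ofReal_le_ofReal (Real.exp_le_exp.2 ?_)
        simp only [hG, Finset.sum_sub_distrib]
        linarith
    _ ≤ (∫⁻ ω, ENNReal.ofReal (Real.exp (G ω)) ∂μ) / ENNReal.ofReal (Real.exp Y) :=
        meas_ge_le_lintegral_div (Real.measurable_exp.comp hm').ennreal_ofReal.aemeasurable
          (by simp [Real.exp_pos]) ENNReal.ofReal_ne_top
    _ ≤ 1 / ENNReal.ofReal (Real.exp Y) := by gcongr
    _ = ENNReal.ofReal (Real.exp (-Y)) := by
        rw [Real.exp_neg, ENNReal.ofReal_inv_of_pos (Real.exp_pos _), one_div]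

end AdaptedTransitions

/-- Hoeffding's lemma, in the form of a bounded exponential moment. -/
theorem lintegral_exp_le_one_of_mem_Icc {X : Type*} [MeasurableSpace X] {ν : Measure X}
    [IsProbabilityMeasure ν] {g : X → ℝ} (hg : Measurable g) {w : ℝ}
    (hb : ∀ y, g y ∈ Set.Icc 0 w) (c : ℝ) :
    ∫⁻ y, ENNReal.ofReal (Real.exp (c * (g y - ∫ y, g y ∂ν) - c ^ 2 * w ^ 2 / 8)) ∂ν ≤ 1 := by
  have hs := hasSubgaussianMGF_of_mem_Icc (μ := ν) hg.aemeasurable (Filter.Eventually.of_forall hb)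
  have hm := hs.mgf_le c
  have hi := hs.integrable_exp_mul c
  -- Variables with values in [0, w] are sub-Gaussian with variance proxy (w/2)².
  have hw : (((‖w - 0‖₊ / 2) ^ 2 : NNReal) : ℝ) = w ^ 2 / 4 := by
    push_cast
    rw [sub_zero, Real.norm_eq_abs, div_pow, sq_abs]
    norm_num
  rw [hw] at hm
  rw [← ofReal_integral_eq_lintegral_ofReal]
  · rw [← ENNReal.ofReal_one]
    refine ENNReal.ofReal_le_ofReal ?_
    simp only [Real.exp_sub _ (c ^ 2 * w ^ 2 / 8)]
    rw [integral_div, div_le_one (Real.exp_pos _)]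
    refine hm.trans (Real.exp_le_exp.2 (le_of_eq (by ring)))
  · simp only [Real.exp_sub _ (c ^ 2 * w ^ 2 / 8)]
    exact hi.div_const _
  · exact Filter.Eventually.of_forall fun y => (Real.exp_pos _).le

/-- Bernstein's exponential moment bound for centred noise `e` with `|c e| ≤ 1`. -/
theorem lintegral_exp_le_one_of_abs_le {X : Type*} [MeasurableSpace X] {ν : Measure X}
    [IsProbabilityMeasure ν] {e : X → ℝ} (he : Measurable e) {b : ℝ} (hb : ∀ y, |e y| ≤ b)
    (h0 : ∫ y, e y ∂ν = 0) {c v : ℝ} (hcb : |c| * b ≤ 1) (hv : c ^ 2 * ∫ y, e y ^ 2 ∂ν ≤ v) :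
    ∫⁻ y, ENNReal.ofReal (Real.exp (c * e y - v)) ∂ν ≤ 1 := by
  have hi1 : Integrable e ν := Integrable.of_bound he.aestronglyMeasurable b
    (Filter.Eventually.of_forall hb)
  have hi2 : Integrable (fun y => e y ^ 2) ν := by
    refine Integrable.of_bound (he.pow_const 2).aestronglyMeasurable (b ^ 2)
      (Filter.Eventually.of_forall fun y => ?_)
    rw [Real.norm_eq_abs, abs_pow]
    exact pow_le_pow_left₀ (abs_nonneg _) (hb y) 2
  have hi : Integrable (fun y => 1 + c * e y + c ^ 2 * e y ^ 2) ν :=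
    ((integrable_const 1).add (hi1.const_mul c)).add (hi2.const_mul (c ^ 2))
  -- This is exp u ≤ 1 + u + u² for |u| ≤ 1; after integration the linear term vanishes and 1 + v ≤
  -- exp v finishes.
  have hle : ∀ y, Real.exp (c * e y) ≤ 1 + c * e y + c ^ 2 * e y ^ 2 := fun y => by
    have h1 : |c * e y| ≤ 1 := by
      rw [abs_mul]
      exact (mul_le_mul_of_nonneg_left (hb y) (abs_nonneg c)).trans hcb
    have := (abs_le.1 (Real.abs_exp_sub_one_sub_id_le h1)).2
    nlinarith
  calc ∫⁻ y, ENNReal.ofReal (Real.exp (c * e y - v)) ∂ν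
      ≤ ∫⁻ y, ENNReal.ofReal (Real.exp (-v)) *
          ENNReal.ofReal (1 + c * e y + c ^ 2 * e y ^ 2) ∂ν := by
        refine lintegral_mono fun y => ?_
        rw [← ENNReal.ofReal_mul (Real.exp_pos _).le]
        refine ENNReal.ofReal_le_ofReal ?_
        rw [sub_eq_neg_add, Real.exp_add]
        exact mul_le_mul_of_nonneg_left (hle y) (Real.exp_pos _).le
    _ = ENNReal.ofReal (Real.exp (-v)) * ENNReal.ofReal (1 + c ^ 2 * ∫ y, e y ^ 2 ∂ν) := by
        rw [lintegral_const_mul' _ _ ENNReal.ofReal_ne_top, ← ofReal_integral_eq_lintegral_ofReal hi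
          (Filter.Eventually.of_forall fun y => (Real.exp_pos _).le.trans (hle y))]
        congr 2
        have h1 : Integrable (fun y => 1 + c * e y) ν := (integrable_const 1).add (hi1.const_mul c)
        rw [integral_add h1 (hi2.const_mul (c ^ 2)),
          integral_add (integrable_const 1) (hi1.const_mul c), integral_const_mul,
          integral_const_mul, h0]
        simp
    _ ≤ ENNReal.ofReal (Real.exp (-v)) * ENNReal.ofReal (Real.exp v) := by
        gcongr
        linarith [Real.add_one_le_exp v]
    _ = 1 := by
        rw [← ENNReal.ofReal_mul (Real.exp_pos _).le, ← Real.exp_add]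
        simp

/-! ### Bellman operators and optimal values -/

section MaxA

variable {X A : Type*}

theorem maxA_mem_Icc [Nonempty A] {f : X × A → ℝ} {lo hi : ℝ} (hf : ∀ z, f z ∈ Set.Icc lo hi)
    (x : X) : maxA f x ∈ Set.Icc lo hi := by
  refine ⟨?_, ciSup_le fun a => (hf _).2⟩
  obtain ⟨a⟩ := ‹Nonempty A›
  exact (hf (x, a)).1.trans
    (le_ciSup (f := fun a => f (x, a)) ⟨hi, by rintro _ ⟨b, rfl⟩; exact (hf _).2⟩ a)

theorem maxA_mono {f g : X × A → ℝ} {hi : ℝ} (hfg : ∀ z, f z ≤ g z) (hg : ∀ z, g z ≤ hi) (x : X) :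
    maxA f x ≤ maxA g x :=
  ciSup_mono ⟨hi, by rintro _ ⟨b, rfl⟩; exact hg _⟩ fun a => hfg (x, a)

theorem maxA_zero (x : X) : maxA (fun _ : X × A => (0 : ℝ)) x = 0 := by
  simp [maxA]

end MaxA

namespace EpisodicMDP

variable {X A : Type*} [MeasurableSpace X] [MeasurableSpace A] (M : EpisodicMDP X A)

instance instIsMarkovKernelP (h : ℕ) : IsMarkovKernel (M.P h) := M.markov h

theorem measurable_return (h : ℕ) {V : X → ℝ} (hV : Measurable V) :
    Measurable (fun p : (X × A) × X => M.r h p.1 p.2 + V p.2) :=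
  (M.measurable_r h).add (hV.comp measurable_snd)

variable {M}

theorem return_mem_Icc {h : ℕ} (hh : h < M.H) {V : X → ℝ} {c : ℝ}
    (hV : ∀ x, V x ∈ Set.Icc (0 : ℝ) c) (z : X × A) (y : X) :
    M.r h z y + V y ∈ Set.Icc (0 : ℝ) (1 + c) :=
  ⟨add_nonneg (M.r_mem h hh z y).1 (hV y).1, add_le_add (M.r_mem h hh z y).2 (hV y).2⟩

theorem measurable_return_right (h : ℕ) {V : X → ℝ} (hV : Measurable V) (z : X × A) :
    Measurable (fun y => M.r h z y + V y) :=
  (M.measurable_return h hV).comp (measurable_const.prodMk measurable_id)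

theorem integrable_return {h : ℕ} (hh : h < M.H) {V : X → ℝ} (hVm : Measurable V) {c : ℝ}
    (hV : ∀ x, V x ∈ Set.Icc (0 : ℝ) c) (z : X × A) :
    Integrable (fun y => M.r h z y + V y) (M.P h z) :=
  Integrable.of_mem_Icc 0 (1 + c) (measurable_return_right h hVm z).aemeasurable
    (Filter.Eventually.of_forall fun y => return_mem_Icc hh hV z y)

theorem integrable_return_sq {h : ℕ} (hh : h < M.H) {V : X → ℝ} (hVm : Measurable V) {c : ℝ}
    (hV : ∀ x, V x ∈ Set.Icc (0 : ℝ) c) (z : X × A) :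
    Integrable (fun y => (M.r h z y + V y) ^ 2) (M.P h z) :=
  Integrable.of_mem_Icc 0 ((1 + c) ^ 2) ((measurable_return_right h hVm z).pow_const 2).aemeasurable
    (Filter.Eventually.of_forall fun y => ⟨sq_nonneg _,
      pow_le_pow_left₀ (return_mem_Icc hh hV z y).1 (return_mem_Icc hh hV z y).2 2⟩)

theorem bellman_mono {h : ℕ} (hh : h < M.H) {V V' : X → ℝ} (hVm : Measurable V)
    (hVm' : Measurable V') {c c' : ℝ} (hV : ∀ x, V x ∈ Set.Icc (0 : ℝ) c)
    (hV' : ∀ x, V' x ∈ Set.Icc (0 : ℝ) c') (hle : ∀ x, V x ≤ V' x) (z : X × A) :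
    M.bellman h V z ≤ M.bellman h V' z :=
  integral_mono (integrable_return hh hVm hV z) (integrable_return hh hVm' hV' z)
    fun y => add_le_add le_rfl (hle y)

theorem bellman₂_mono {h : ℕ} (hh : h < M.H) {V V' : X → ℝ} (hVm : Measurable V)
    (hVm' : Measurable V') {c c' : ℝ} (hV : ∀ x, V x ∈ Set.Icc (0 : ℝ) c)
    (hV' : ∀ x, V' x ∈ Set.Icc (0 : ℝ) c') (hle : ∀ x, V x ≤ V' x) (z : X × A) :
    M.bellman₂ h V z ≤ M.bellman₂ h V' z :=
  integral_mono (integrable_return_sq hh hVm hV z) (integrable_return_sq hh hVm' hV' z)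
    fun y => pow_le_pow_left₀ (return_mem_Icc hh hV z y).1 (add_le_add le_rfl (hle y)) 2

theorem bellman_mem_Icc {h : ℕ} (hh : h < M.H) {V : X → ℝ} (hVm : Measurable V) {c : ℝ}
    (hV : ∀ x, V x ∈ Set.Icc (0 : ℝ) c) (z : X × A) : M.bellman h V z ∈ Set.Icc 0 (1 + c) := by
  refine ⟨integral_nonneg fun y => (return_mem_Icc hh hV z y).1, ?_⟩
  refine (integral_mono (integrable_return hh hVm hV z) (integrable_const (1 + c))
    fun y => (return_mem_Icc hh hV z y).2).trans_eq ?_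
  simp

theorem bellman₂_mem_Icc {h : ℕ} (hh : h < M.H) {V : X → ℝ} (hVm : Measurable V) {c : ℝ}
    (hV : ∀ x, V x ∈ Set.Icc (0 : ℝ) c) (z : X × A) :
    M.bellman₂ h V z ∈ Set.Icc 0 ((1 + c) ^ 2) := by
  refine ⟨integral_nonneg fun y => sq_nonneg _, ?_⟩
  refine (integral_mono (integrable_return_sq hh hVm hV z) (integrable_const ((1 + c) ^ 2))
    fun y => pow_le_pow_left₀ (return_mem_Icc hh hV z y).1
      (return_mem_Icc hh hV z y).2 2).trans_eq ?_
  simp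

variable (M) in
/-- The optimal state value function `V_⋆^h`. -/
noncomputable def optV (h : ℕ) : X → ℝ := maxA (M.optQ h)

theorem optQ_eq_bellman {h : ℕ} (hh : h < M.H) : M.optQ h = M.bellman h (M.optV (h + 1)) := by
  have : M.H - h = (M.H - (h + 1)) + 1 := by omega
  rw [optQ, this]
  rfl

theorem optQ_terminal : M.optQ M.H = fun _ => 0 := by
  rw [optQ, Nat.sub_self]
  rfl

theorem optQAux_nonneg [Nonempty A] (k h : ℕ) (hk : h + k = M.H) (z : X × A) :
    0 ≤ M.optQAux k h z := by
  induction k generalizing h z with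
  | zero => exact le_rfl
  | succ k ih =>
    refine integral_nonneg fun y => add_nonneg (M.r_mem h (by omega) z y).1 ?_
    exact Real.iSup_nonneg fun a => ih (h + 1) (by omega) _

/-- The budget `c` has to vary in the induction: after one step the remaining reward is almost
surely at most `c` minus the reward just received, for every continuation. -/
theorem optQAux_le_of_rewardLE [Nonempty A] (k h : ℕ) (hk : h + k = M.H) (c : ℝ) (x : X)
    (hr : M.RewardLE k h c x) (a : A) : M.optQAux k h (x, a) ≤ c := by
  induction k generalizing h c x a with
  | zero => exact hr
  | succ k ih =>
    have hae : ∀ᵐ y ∂(M.P h (x, a)),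
        M.r h (x, a) y + maxA (M.optQAux k (h + 1)) y ≤ c := by
      filter_upwards [hr a] with y hy
      have := ciSup_le fun b => ih (h + 1) (by omega) _ y hy b
      change maxA (M.optQAux k (h + 1)) y ≤ _ at this
      linarith
    have hnn : ∀ y, 0 ≤ M.r h (x, a) y + maxA (M.optQAux k (h + 1)) y := fun y =>
      add_nonneg (M.r_mem h (by omega) (x, a) y).1
        (Real.iSup_nonneg fun b => optQAux_nonneg k (h + 1) (by omega) _)
    -- Measurability of the maximum is not needed: a nonintegrable integrand has integral 0 by
    -- convention, and the bound `c` has nonnegative integral.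
    refine (integral_mono_of_nonneg (Filter.Eventually.of_forall hnn) (integrable_const c)
      hae).trans_eq ?_
    simp

theorem optQ_mem_Icc [Nonempty A] (hs : M.SparseReward) {h : ℕ} (hh : h ≤ M.H) (z : X × A) :
    M.optQ h z ∈ Set.Icc (0 : ℝ) 1 := by
  refine ⟨optQAux_nonneg _ h (by omega) z, ?_⟩
  rcases hh.lt_or_eq with hlt | rfl
  · exact optQAux_le_of_rewardLE _ h (by omega) 1 z.1 (hs h hlt z.1) z.2
  · rw [optQ_terminal]
    exact zero_le_one

theorem optV_mem_Icc [Nonempty A] (hs : M.SparseReward) {h : ℕ} (hh : h ≤ M.H) (x : X) :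
    M.optV h x ∈ Set.Icc (0 : ℝ) 1 :=
  maxA_mem_Icc (optQ_mem_Icc hs hh) x

theorem measurable_optV (hm : ∀ h < M.H, Measurable (maxA (M.optQ h))) {h : ℕ} (hh : h ≤ M.H) :
    Measurable (M.optV h) := by
  rcases hh.lt_or_eq with hlt | rfl
  · exact hm h hlt
  · have : M.optV M.H = fun _ => 0 := by
      funext x
      rw [optV, optQ_terminal, maxA_zero]
    rw [this]
    exact measurable_const

end EpisodicMDP

namespace Setup

variable {X A : Type*} [MeasurableSpace X] [MeasurableSpace A]

/-! ### Elementary properties of a run -/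

/-- The standing assumptions on the inputs of the algorithm. -/
structure Assumptions (S : Setup X A) : Prop where
  nonempty : Nonempty A
  sparse : S.M.SparseReward
  complete : S.EpsComplete
  meas : S.MeasurabilityConventions
  one_le_L : 1 ≤ S.L
  eps_nonneg : 0 ≤ S.eps
  α_pos : 0 < S.α
  α_le_one : S.α ≤ 1
  lam_pos : 0 < S.lam
  δ_pos : 0 < S.δ
  oracle1 : S.IsBonusOracle S.beta1
  oracle2 : S.IsBonusOracle S.beta2
  consistent1 : S.IsConsistent S.beta1
  consistent2 : S.IsConsistent S.beta2

variable {S : Setup X A} {R : RunData X A}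

theorem α_le_sigBar (hR : S.FollowsAlgorithm R) {t h : ℕ} (ht : t < S.T) (hh : h < S.M.H) :
    S.α ≤ R.sigBar t h := by
  rw [hR.sigBar_eq t ht h hh]
  exact (le_max_right _ _).trans (le_max_left _ _)

theorem α_le_sigs (hR : S.FollowsAlgorithm R) {t h : ℕ} (ht : t < S.T) (hh : h < S.M.H)
    (i : Fin t) : S.α ≤ sigs R t h i :=
  α_le_sigBar hR (i.2.trans ht) hh

theorem b1_mem (hA : S.Assumptions) (hR : S.FollowsAlgorithm R) {t h : ℕ} (ht : t < S.T)
    (hh : h < S.M.H) : S.b1 R t h ∈ S.W := by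
  obtain ⟨C, -, hC⟩ := hA.oracle1
  exact (hC h hh t ht _ (α_le_sigs hR ht hh) (S.data R t h) _ (hR.fhat1_ls t ht h hh).1).1

theorem b1_nonneg (hA : S.Assumptions) (hR : S.FollowsAlgorithm R) {t h : ℕ} (ht : t < S.T)
    (hh : h < S.M.H) (z : X × A) : 0 ≤ S.b1 R t h z := by
  obtain ⟨C, -, hC⟩ := hA.oracle1
  exact (hC h hh t ht _ (α_le_sigs hR ht hh) (S.data R t h) _ (hR.fhat1_ls t ht h hh).1).2.1 z

theorem abs_sub_le_b1 (hA : S.Assumptions) (hR : S.FollowsAlgorithm R) {t h : ℕ} (ht : t < S.T)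
    (hh : h < S.M.H) {f : X × A → ℝ} (hf : f ∈ S.conf1 R t h) (z : X × A) :
    |f z - R.fhat1 t h z| ≤ S.b1 R t h z := by
  obtain ⟨C, -, hC⟩ := hA.oracle1
  exact (hC h hh t ht _ (α_le_sigs hR ht hh) (S.data R t h) _
    (hR.fhat1_ls t ht h hh).1).2.2.1 f hf z

theorem b2_mem (hA : S.Assumptions) (hR : S.FollowsAlgorithm R) {t h : ℕ} (ht : t < S.T)
    (hh : h < S.M.H) : S.b2 R t h ∈ S.W := by
  obtain ⟨C, -, hC⟩ := hA.oracle2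
  exact (hC h hh t ht (fun _ => 1) (fun _ => hA.α_le_one) (S.data R t h) _
    (hR.fhat2_ls t ht h hh).1).1

theorem b2_nonneg (hA : S.Assumptions) (hR : S.FollowsAlgorithm R) {t h : ℕ} (ht : t < S.T)
    (hh : h < S.M.H) (z : X × A) : 0 ≤ S.b2 R t h z := by
  obtain ⟨C, -, hC⟩ := hA.oracle2
  exact (hC h hh t ht (fun _ => 1) (fun _ => hA.α_le_one) (S.data R t h) _
    (hR.fhat2_ls t ht h hh).1).2.1 z

theorem abs_sub_le_b2 (hA : S.Assumptions) (hR : S.FollowsAlgorithm R) {t h : ℕ} (ht : t < S.T)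
    (hh : h < S.M.H) {f : X × A → ℝ} (hf : f ∈ S.conf2 R t h) (z : X × A) :
    |f z - R.fhat2 t h z| ≤ S.b2 R t h z := by
  obtain ⟨C, -, hC⟩ := hA.oracle2
  exact (hC h hh t ht (fun _ => 1) (fun _ => hA.α_le_one) (S.data R t h) _
    (hR.fhat2_ls t ht h hh).1).2.2.1 f hf z

/-- By consistency, the bonus centred at `f̂_{t,2}` also covers the confidence set around
`f̂_{t,-2}`. -/
theorem abs_sub_le_b2_of_mem_confm2 (hA : S.Assumptions) (hR : S.FollowsAlgorithm R) {t h : ℕ}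
    (ht : t < S.T) (hh : h < S.M.H) {f : X × A → ℝ} (hf : f ∈ S.confm2 R t h) (z : X × A) :
    |f z - R.fhatm2 t h z| ≤ S.b2 R t h z := by
  obtain ⟨C, -, hC⟩ := hA.oracle2
  refine ((hC h hh t ht (fun _ => 1) (fun _ => hA.α_le_one) (S.data R t h) _
    (hR.fhatm2_ls t ht h hh).1).2.2.1 f hf z).trans ?_
  -- Consistency with equal episode numbers compares two centres fitted on the same data to
  -- different targets.
  exact hA.consistent2 h hh t t le_rfl ht (fun _ => 1) (fun _ => hA.α_le_one) (S.data R t h) _ _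
    _ _ (hR.fhat2_ls t ht h hh) (hR.fhatm2_ls t ht h hh) z

/-- The bonuses of the optimistic regression decrease over the episodes. -/
theorem b1_antitone (hA : S.Assumptions) (hR : S.FollowsAlgorithm R) {s t h : ℕ} (hst : s ≤ t)
    (ht : t < S.T) (hh : h < S.M.H) (z : X × A) : S.b1 R t h z ≤ S.b1 R s h z :=
  hA.consistent1 h hh s t hst ht (sigs R t h) (α_le_sigs hR ht hh) (S.data R t h) _ _
    _ _ (hR.fhat1_ls s (hst.trans_lt ht) h hh) (hR.fhat1_ls t ht h hh) z

theorem f1_mem_Icc (hA : S.Assumptions) (hR : S.FollowsAlgorithm R) {t : ℕ} (ht : t < S.T)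
    (h : ℕ) (z : X × A) : S.f1 R t h z ∈ Set.Icc (0 : ℝ) 1 := by
  rw [f1]
  split_ifs with hh
  · refine ⟨le_min ?_ zero_le_one, min_le_right _ _⟩
    have := (hA.complete.range h hh _ (hR.fhat1_ls t ht h hh).1 z).1
    have := b1_nonneg hA hR ht hh z
    linarith [hA.eps_nonneg]
  · simp

theorem f2_mem_Icc (hA : S.Assumptions) (hR : S.FollowsAlgorithm R) {t : ℕ} (ht : t < S.T)
    (h : ℕ) (z : X × A) : S.f2 R t h z ∈ Set.Icc (0 : ℝ) 2 := by
  rw [f2]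
  split_ifs with hh
  · refine ⟨le_min ?_ zero_le_two, min_le_right _ _⟩
    have := (hA.complete.range h hh _ (hR.fhat2_ls t ht h hh).1 z).1
    have := b1_nonneg hA hR ht hh z
    have := b2_nonneg hA hR ht hh z
    linarith [hA.eps_nonneg]
  · simp

theorem fm2_nonneg (t h : ℕ) (z : X × A) : 0 ≤ S.fm2 R t h z := by
  rw [fm2]
  split_ifs with hh
  · exact le_max_right _ _
  · exact le_rfl

/-! ### Finite classes containing the regression targets -/

open Classical in
/-- The possible values of `max_a f_{t,1}^h`. -/
noncomputable def class1 (S : Setup X A) (h : ℕ) : Finset (X → ℝ) :=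
  if h < S.M.H then
    (S.F h ×ˢ S.W).image fun p => maxA (S.optimistic p.1 p.2)
  else {fun _ => 0}

open Classical in
/-- The possible values of `max_a f_{t,2}^h`. -/
noncomputable def class2 (S : Setup X A) (h : ℕ) : Finset (X → ℝ) :=
  if h < S.M.H then
    (S.F h ×ˢ S.W ×ˢ S.W).image fun p => maxA (S.overlyOptimistic p.1 p.2.1 p.2.2)
  else {fun _ => 0}

open Classical in
/-- The possible values of `max_a f_{t,-2}^h`. -/
noncomputable def classm2 (S : Setup X A) (h : ℕ) : Finset (X → ℝ) :=
  if h < S.M.H then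
    (S.F h ×ˢ S.W).image fun p => maxA (S.overlyPessimistic p.1 p.2)
  else {fun _ => 0}

theorem maxA_f1_mem (hA : S.Assumptions) (hR : S.FollowsAlgorithm R) {t : ℕ} (ht : t < S.T)
    (h : ℕ) : maxA (S.f1 R t h) ∈ S.class1 h := by
  classical
  rw [f1, class1]
  split_ifs with hh
  · exact Finset.mem_image.2 ⟨(_, _), Finset.mk_mem_product (hR.fhat1_ls t ht h hh).1
      (b1_mem hA hR ht hh), rfl⟩
  · exact Finset.mem_singleton.2 (funext maxA_zero)

theorem maxA_f2_mem (hA : S.Assumptions) (hR : S.FollowsAlgorithm R) {t : ℕ} (ht : t < S.T)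
    (h : ℕ) : maxA (S.f2 R t h) ∈ S.class2 h := by
  classical
  rw [f2, class2]
  split_ifs with hh
  · exact Finset.mem_image.2 ⟨(_, _, _), Finset.mk_mem_product (hR.fhat2_ls t ht h hh).1
      (Finset.mk_mem_product (b1_mem hA hR ht hh) (b2_mem hA hR ht hh)), rfl⟩
  · exact Finset.mem_singleton.2 (funext maxA_zero)

theorem maxA_fm2_mem (hA : S.Assumptions) (hR : S.FollowsAlgorithm R) {t : ℕ} (ht : t < S.T)
    (h : ℕ) : maxA (S.fm2 R t h) ∈ S.classm2 h := by
  classical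
  rw [fm2, classm2]
  split_ifs with hh
  · exact Finset.mem_image.2 ⟨(_, _), Finset.mk_mem_product (hR.fhatm2_ls t ht h hh).1
      (b2_mem hA hR ht hh), rfl⟩
  · exact Finset.mem_singleton.2 (funext maxA_zero)

theorem measurable_of_mem_class1 (hA : S.Assumptions) {h : ℕ} {V : X → ℝ} (hV : V ∈ S.class1 h) :
    Measurable V := by
  classical
  rw [class1] at hV
  split_ifs at hV with hh
  · obtain ⟨p, hp, rfl⟩ := Finset.mem_image.1 hV
    rw [Finset.mem_product] at hp
    exact hA.meas.max_opt h hh _ hp.1 _ hp.2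
  · rw [Finset.mem_singleton.1 hV]
    exact measurable_const

theorem measurable_of_mem_class2 (hA : S.Assumptions) {h : ℕ} {V : X → ℝ} (hV : V ∈ S.class2 h) :
    Measurable V := by
  classical
  rw [class2] at hV
  split_ifs at hV with hh
  · obtain ⟨p, hp, rfl⟩ := Finset.mem_image.1 hV
    rw [Finset.mem_product, Finset.mem_product] at hp
    exact hA.meas.max_over h hh _ hp.1 _ hp.2.1 _ hp.2.2
  · rw [Finset.mem_singleton.1 hV]
    exact measurable_const

theorem measurable_of_mem_classm2 (hA : S.Assumptions) {h : ℕ} {V : X → ℝ}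
    (hV : V ∈ S.classm2 h) : Measurable V := by
  classical
  rw [classm2] at hV
  split_ifs at hV with hh
  · obtain ⟨p, hp, rfl⟩ := Finset.mem_image.1 hV
    rw [Finset.mem_product] at hp
    exact hA.meas.max_pess h hh _ hp.1 _ hp.2
  · rw [Finset.mem_singleton.1 hV]
    exact measurable_const

theorem card_F_le {h : ℕ} (hh : h < S.M.H) : (S.F h).card ≤ S.N :=
  Finset.le_sup (f := fun h => (S.F h).card) (Finset.mem_range.2 hh)

theorem F_nonempty (hA : S.Assumptions) {h : ℕ} (hh : h < S.M.H) : (S.F h).Nonempty := by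
  obtain ⟨f, hf, -⟩ := hA.complete.first h hh (fun _ => 0) measurable_const
    fun _ => ⟨le_rfl, zero_le_two⟩
  exact ⟨f, hf⟩

theorem one_le_N (hA : S.Assumptions) {h : ℕ} (hh : h < S.M.H) : 1 ≤ S.N :=
  (Finset.card_pos.2 (F_nonempty hA hh)).trans_le (card_F_le hh)

theorem one_le_Nb (hA : S.Assumptions) (hR : S.FollowsAlgorithm R) {t h : ℕ} (ht : t < S.T)
    (hh : h < S.M.H) : 1 ≤ S.Nb :=
  Finset.card_pos.2 ⟨_, b1_mem hA hR ht hh⟩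

theorem card_class1_le (hN : 1 ≤ S.N) (hNb : 1 ≤ S.Nb) (h : ℕ) :
    (S.class1 h).card ≤ S.N * S.Nb := by
  classical
  rw [class1]
  split_ifs with hh
  · refine Finset.card_image_le.trans ?_
    rw [Finset.card_product]
    exact Nat.mul_le_mul (card_F_le hh) le_rfl
  · exact Nat.mul_pos hN hNb

/-- Both bonuses enter f_{t,2}, hence the square. Together with the pairs (f, g) this still stays
below (𝒩 𝒩_b)³. -/
theorem card_class2_le (hN : 1 ≤ S.N) (hNb : 1 ≤ S.Nb) (h : ℕ) :
    (S.class2 h).card ≤ S.N * S.Nb ^ 2 := by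
  classical
  rw [class2]
  split_ifs with hh
  · refine Finset.card_image_le.trans ?_
    rw [Finset.card_product, Finset.card_product, pow_two]
    exact Nat.mul_le_mul (card_F_le hh) le_rfl
  · exact Nat.mul_pos hN (pow_pos hNb 2)

theorem card_classm2_le (hN : 1 ≤ S.N) (hNb : 1 ≤ S.Nb) (h : ℕ) :
    (S.classm2 h).card ≤ S.N * S.Nb := by
  classical
  rw [classm2]
  split_ifs with hh
  · refine Finset.card_image_le.trans ?_
    rw [Finset.card_product]
    exact Nat.mul_le_mul (card_F_le hh) le_rfl
  · exact Nat.mul_pos hN hNb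

end Setup

/-! ### Measurability of the run -/

/-- A random function with finitely many values can be evaluated measurably by splitting along these
values, so no σ-algebra on the function space is needed. -/
theorem measurable_eval_of_finset {Ω Z : Type*} [MeasurableSpace Ω] [MeasurableSpace Z]
    (𝓕 : Finset (Z → ℝ)) (h𝓕 : ∀ f ∈ 𝓕, Measurable f) {φ : Ω → Z → ℝ} (hφ : ∀ ω, φ ω ∈ 𝓕)
    (hset : ∀ f, MeasurableSet {ω | φ ω = f}) {z : Ω → Z} (hz : Measurable z) :
    Measurable fun ω => φ ω (z ω) := by
  classical
  have : (fun ω => φ ω (z ω)) =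
      fun ω => ∑ f ∈ 𝓕, {ω | φ ω = f}.indicator (fun ω => f (z ω)) ω := by
    funext ω
    rw [Finset.sum_eq_single_of_mem (φ ω) (hφ ω)]
    · simp [Set.indicator]
    · intro f _ hf
      exact Set.indicator_of_notMem (fun h => hf h.symm) _
  rw [this]
  exact Finset.measurable_sum _ fun f hf => ((h𝓕 f hf).comp hz).indicator (hset f)

theorem measurable_eluderD {Ω Z : Type*} [MeasurableSpace Ω] [MeasurableSpace Z]
    {F : Finset (Z → ℝ)} (hF : ∀ f ∈ F, Measurable f) (lam : ℝ) {n : ℕ} {σ : Ω → Fin n → ℝ}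
    (hσ : ∀ i, Measurable fun ω => σ ω i) {zs : Ω → Fin n → Z}
    (hzs : ∀ i, Measurable fun ω => zs ω i) {z : Ω → Z} (hz : Measurable z) :
    Measurable fun ω => eluderD F lam (σ ω) (zs ω) (z ω) := by
  unfold eluderD
  refine Measurable.sqrt (Measurable.iSup fun p => ?_)
  have h1 := hF _ p.1.2
  have h2 := hF _ p.2.2
  refine (((h1.comp hz).sub (h2.comp hz)).pow_const 2).div (Measurable.add_const ?_ _)
  exact Finset.measurable_sum _ fun i _ =>
    (((h1.comp (hzs i)).sub (h2.comp (hzs i))).pow_const 2).div ((hσ i).pow_const 2)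

/-- Functions of `F` differ at `z` by at most `D_F(z)` times their distance on the data. -/
theorem abs_sub_le_eluderD_mul {Z : Type*} {F : Finset (Z → ℝ)} {lam : ℝ} (hlam : 0 < lam) {n : ℕ}
    (σ : Fin n → ℝ) (zs : Fin n → Z) {f g : Z → ℝ} (hf : f ∈ F) (hg : g ∈ F) (z : Z) :
    |f z - g z| ≤ eluderD F lam σ zs z *
      √(∑ i, (f (zs i) - g (zs i)) ^ 2 / σ i ^ 2 + lam) := by
  have hpos : 0 < ∑ i, (f (zs i) - g (zs i)) ^ 2 / σ i ^ 2 + lam := by positivity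
  have hle : (f z - g z) ^ 2 / (∑ i, (f (zs i) - g (zs i)) ^ 2 / σ i ^ 2 + lam) ≤
      ⨆ p : F × F, (p.1.1 z - p.2.1 z) ^ 2 /
        (∑ i, (p.1.1 (zs i) - p.2.1 (zs i)) ^ 2 / σ i ^ 2 + lam) :=
    le_ciSup (f := fun p : F × F => (p.1.1 z - p.2.1 z) ^ 2 /
        (∑ i, (p.1.1 (zs i) - p.2.1 (zs i)) ^ 2 / σ i ^ 2 + lam))
      (Set.finite_range _).bddAbove (⟨f, hf⟩, ⟨g, hg⟩)
  rw [eluderD, ← Real.sqrt_mul ((by positivity : (0 : ℝ) ≤ _).trans hle)]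
  rw [← Real.sqrt_sq_eq_abs]
  exact Real.sqrt_le_sqrt ((div_le_iff₀ hpos).1 hle)

namespace Setup

variable {X A Ω : Type*} [MeasurableSpace X] [MeasurableSpace A] [mΩ : MeasurableSpace Ω]
  {S : Setup X A} {μ : Measure Ω} {𝓗 : ℕ → ℕ → MeasurableSpace Ω} {R : Ω → RunData X A}

namespace IsRandomRun

theorem mono_of_le (hrun : S.IsRandomRun μ 𝓗 R) (t : ℕ) {h h' : ℕ} (hle : h ≤ h')
    (hh' : h' ≤ S.M.H) : 𝓗 t h ≤ 𝓗 t h' := by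
  induction h', hle using Nat.le_induction with
  | base => exact le_rfl
  | succ k hk ih => exact (ih (by omega)).trans (hrun.mono_level t k (by omega))

theorem mono_succ (hrun : S.IsRandomRun μ 𝓗 R) (t : ℕ) {h h' : ℕ} (hh : h ≤ S.M.H)
    (hh' : h' ≤ S.M.H) : 𝓗 t h ≤ 𝓗 (t + 1) h' :=
  (hrun.mono_of_le t hh le_rfl).trans
    ((hrun.mono_episode t).trans (hrun.mono_of_le (t + 1) (Nat.zero_le _) hh'))

theorem mono_of_lt (hrun : S.IsRandomRun μ 𝓗 R) {s t : ℕ} (hst : s < t) {h h' : ℕ}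
    (hh : h ≤ S.M.H) (hh' : h' ≤ S.M.H) : 𝓗 s h ≤ 𝓗 t h' := by
  induction t, hst using Nat.le_induction with
  | base => exact hrun.mono_succ s hh hh'
  | succ k hk ih => exact ih.trans (hrun.mono_succ k hh' hh')

theorem z_meas (hrun : S.IsRandomRun μ 𝓗 R) {t h : ℕ} (ht : t < S.T) (hh : h < S.M.H) :
    Measurable[𝓗 t (h + 1)] fun ω => z (R ω) t h :=
  (hrun.x_meas t ht h hh).prodMk (hrun.a_meas t ht h hh)

/-- The level-`h` transitions of the episodes form adapted transitions. -/
theorem adaptedTransitions (hrun : S.IsRandomRun μ 𝓗 R) {t h : ℕ} (ht : t ≤ S.T)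
    (hh : h < S.M.H) : AdaptedTransitions μ (S.M.P h) t (fun s => 𝓗 s (h + 1))
      (fun s ω => z (R ω) s h) (fun s ω => (R ω).x s (h + 1)) where
  le s := hrun.le s _
  mono s := hrun.mono_succ s hh hh
  z_meas s hs := hrun.z_meas (hs.trans_le ht) hh
  x'_meas s hs := by
    -- The terminal state is drawn after all levels of the episode, so it is known only from the
    -- start of the next episode on.
    rcases Nat.lt_or_ge (h + 1) S.M.H with h1 | h1
    · exact (hrun.x_meas s (hs.trans_le ht) (h + 1) h1).mono (hrun.mono_succ s h1 hh) le_rfl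
    · have h2 : h + 1 = S.M.H := by omega
      rw [h2]
      exact (hrun.x_last_meas s (hs.trans_le ht)).mono
        (hrun.mono_of_le (s + 1) (Nat.zero_le _) le_rfl) le_rfl
  law s hs E hE B hB := hrun.law_step s (hs.trans_le ht) h hh E hE B hB

/-- The Bernstein bound needs weights that are known before the next state is drawn. Induction over
episodes is required because σ̄_t depends on earlier weights through D_F. -/
theorem sigBar_meas (hrun : S.IsRandomRun μ 𝓗 R) (hA : S.Assumptions) {t h : ℕ} (ht : t < S.T)
    (hh : h < S.M.H) : Measurable[𝓗 t (h + 1)] fun ω => (R ω).sigBar t h := by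
  induction t using Nat.strong_induction_on with
  | _ t ih =>
  have hsig : ∀ i : Fin t, Measurable[𝓗 t (h + 1)] fun ω => sigs (R ω) t h i := fun i =>
    (ih i i.2 (i.2.trans ht)).mono (hrun.mono_of_lt i.2 hh hh) le_rfl
  have hzs : ∀ i : Fin t, Measurable[𝓗 t (h + 1)] fun ω => zs (R ω) t h i := fun i =>
    (hrun.z_meas (i.2.trans ht) hh).mono (hrun.mono_of_lt i.2 hh hh) le_rfl
  have hz := hrun.z_meas ht hh
  have h0 : 𝓗 t 0 ≤ 𝓗 t (h + 1) := hrun.mono_of_le t (Nat.zero_le _) hh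
  have hF := hA.meas.F_meas h hh
  have hf : ∀ φ : Ω → X × A → ℝ, (∀ ω, φ ω ∈ S.F h) →
      (∀ f, MeasurableSet[𝓗 t 0] {ω | φ ω = f}) →
      Measurable[𝓗 t (h + 1)] fun ω => φ ω (z (R ω) t h) := fun φ h1 h2 =>
    @measurable_eval_of_finset Ω _ (𝓗 t (h + 1)) _ (S.F h) hF φ h1 (fun f => h0 _ (h2 f)) _ hz
  have hb : ∀ φ : Ω → X × A → ℝ, (∀ ω, φ ω ∈ S.W) →
      (∀ f, MeasurableSet[𝓗 t 0] {ω | φ ω = f}) →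
      Measurable[𝓗 t (h + 1)] fun ω => φ ω (z (R ω) t h) := fun φ h1 h2 =>
    @measurable_eval_of_finset Ω _ (𝓗 t (h + 1)) _ S.W hA.meas.W_meas φ h1
      (fun f => h0 _ (h2 f)) _ hz
  have hfm2 := hf (fun ω => (R ω).fhatm2 t h) (fun ω => ((hrun.follows ω).fhatm2_ls t ht h hh).1)
    (hrun.fhatm2_meas t ht h hh)
  have hf2 := hf (fun ω => (R ω).fhat2 t h) (fun ω => ((hrun.follows ω).fhat2_ls t ht h hh).1)
    (hrun.fhat2_meas t ht h hh)
  have hg := hf (fun ω => (R ω).ghat t h) (fun ω => ((hrun.follows ω).ghat_ls t ht h hh).1)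
    (hrun.ghat_meas t ht h hh)
  have hb1 := hb (fun ω => S.b1 (R ω) t h) (fun ω => b1_mem hA (hrun.follows ω) ht hh)
    (hrun.b1_meas t ht h hh)
  have hb2 := hb (fun ω => S.b2 (R ω) t h) (fun ω => b2_mem hA (hrun.follows ω) ht hh)
    (hrun.b2_meas t ht h hh)
  have hD1 := @measurable_eluderD Ω _ (𝓗 t (h + 1)) _ (S.F h) hF S.lam t (fun _ _ => 1)
    (fun _ => measurable_const) _ hzs _ hz
  have hD2 := @measurable_eluderD Ω _ (𝓗 t (h + 1)) _ (S.F h) hF S.lam t _ hsig _ hzs _ hz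
  have heq : (fun ω => (R ω).sigBar t h) = fun ω => S.sigBarRule (R ω) t h :=
    funext fun ω => (hrun.follows ω).sigBar_eq t ht h hh
  rw [heq]
  unfold sigBarRule sigmaSq f2 fm2 overlyOptimistic overlyPessimistic
  simp only [if_pos hh]
  refine Measurable.max (Measurable.max ?_ measurable_const) (Measurable.max ?_ ?_)
  · split_ifs
    · exact measurable_const
    · exact Measurable.sqrt (measurable_const.min ((((hg.sub (hfm2.pow_const 2)).add
        (hD1.mul_const _)).add_const _)))
  · refine Measurable.const_mul (Measurable.sqrt (Measurable.sub ?_ ?_)) _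
    · exact (((hf2.add (hb1.const_mul 2)).add hb2).add_const _).min measurable_const
    · exact ((hfm2.sub hb2).sub_const _).max measurable_const
  · exact Measurable.const_mul hD2.sqrt _

end IsRandomRun

end Setup

/-! ### Concentration of regression noise -/

/-- The deviation of `q z` from its mean under `κ z`. -/
noncomputable def noise {Z X : Type*} [MeasurableSpace Z] [MeasurableSpace X] (κ : Kernel Z X)
    (q : Z → X → ℝ) (z : Z) (y : X) : ℝ := q z y - ∫ y', q z y' ∂(κ z)

section Noise

variable {Z X : Type*} [MeasurableSpace Z] [MeasurableSpace X] {κ : Kernel Z X} [IsMarkovKernel κ]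
  {q : Z → X → ℝ}

theorem measurable_noise (hq : Measurable fun p : Z × X => q p.1 p.2) :
    Measurable fun p : Z × X => noise κ q p.1 p.2 :=
  hq.sub ((hq.stronglyMeasurable.integral_kernel_prod_right' (κ := κ)).measurable.comp
    measurable_fst)

theorem integrable_of_mem_Icc (hq : Measurable fun p : Z × X => q p.1 p.2) {a b : ℝ}
    (hb : ∀ z y, q z y ∈ Set.Icc a b) (z : Z) : Integrable (q z) (κ z) :=
  Integrable.of_mem_Icc a b (hq.comp (measurable_const.prodMk measurable_id)).aemeasurable
    (Filter.Eventually.of_forall fun y => hb z y)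

theorem integral_noise (hq : Measurable fun p : Z × X => q p.1 p.2) {a b : ℝ}
    (hb : ∀ z y, q z y ∈ Set.Icc a b) (z : Z) : ∫ y, noise κ q z y ∂(κ z) = 0 := by
  unfold noise
  rw [integral_sub (integrable_of_mem_Icc hq hb z) (integrable_const _)]
  simp

theorem abs_noise_le (hq : Measurable fun p : Z × X => q p.1 p.2) {a b : ℝ}
    (hb : ∀ z y, q z y ∈ Set.Icc a b) (z : Z) (y : X) : |noise κ q z y| ≤ b - a := by
  have h1 : ∫ y', q z y' ∂(κ z) ≤ b := by
    refine (integral_mono (integrable_of_mem_Icc hq hb z) (integrable_const b)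
      fun y => (hb z y).2).trans_eq ?_
    simp
  have h2 : a ≤ ∫ y', q z y' ∂(κ z) := by
    refine le_of_eq_of_le ?_ (integral_mono (integrable_const a) (integrable_of_mem_Icc hq hb z)
      fun y => (hb z y).1)
    simp
  have := hb z y
  rw [noise, abs_le]
  constructor <;> linarith [this.1, this.2]

/-- The variance is the second moment minus the squared mean. -/
theorem integral_noise_sq (hq : Measurable fun p : Z × X => q p.1 p.2) {a b : ℝ}
    (hb : ∀ z y, q z y ∈ Set.Icc a b) (z : Z) :
    ∫ y, noise κ q z y ^ 2 ∂(κ z) = ∫ y, q z y ^ 2 ∂(κ z) - (∫ y, q z y ∂(κ z)) ^ 2 := by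
  have hi := integrable_of_mem_Icc (κ := κ) hq hb z
  have hi2 : Integrable (fun y => q z y ^ 2) (κ z) := by
    refine Integrable.of_bound
      ((hq.comp (measurable_const.prodMk measurable_id)).pow_const 2).aestronglyMeasurable
      ((max |a| |b|) ^ 2) (Filter.Eventually.of_forall fun y => ?_)
    rw [Real.norm_eq_abs, abs_pow]
    exact pow_le_pow_left₀ (abs_nonneg _) (abs_le_max_abs_abs (hb z y).1 (hb z y).2) 2
  set m := ∫ y, q z y ∂(κ z) with hm
  have h1 : (fun y => noise κ q z y ^ 2) = fun y => q z y ^ 2 - 2 * m * q z y + m ^ 2 := by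
    funext y
    rw [noise, ← hm]
    ring
  have h2 : Integrable (fun y => q z y ^ 2 - 2 * m * q z y) (κ z) := hi2.sub (hi.const_mul _)
  rw [h1, integral_add h2 (integrable_const _), integral_sub hi2 (hi.const_mul _),
    integral_const_mul, ← hm]
  simp
  ring

end Noise

namespace AdaptedTransitions

variable {Ω Z X : Type*} [mΩ : MeasurableSpace Ω] [MeasurableSpace Z] [MeasurableSpace X]
  {μ : Measure Ω} [IsProbabilityMeasure μ] {κ : Kernel Z X} [IsMarkovKernel κ] {n : ℕ}
  {𝒢 : ℕ → MeasurableSpace Ω} {z : ℕ → Ω → Z} {x' : ℕ → Ω → X}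

/-- Concentration of the noise of bounded targets, by Hoeffding's lemma. -/
theorem measure_noise_gt_le (h : AdaptedTransitions μ κ n 𝒢 z x') {d : Z → ℝ} (hd : Measurable d)
    {q : Z → X → ℝ} (hq : Measurable fun p : Z × X => q p.1 p.2) {w : ℝ} (hw : 0 < w)
    (hb : ∀ z y, q z y ∈ Set.Icc 0 w) (Y : ℝ) :
    μ {ω | (∑ s ∈ Finset.range n, d (z s ω) ^ 2) / 4 + w ^ 2 / 2 * Y <
      ∑ s ∈ Finset.range n, d (z s ω) * noise κ q (z s ω) (x' s ω)} ≤
      ENNReal.ofReal (Real.exp (-Y)) := by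
  have key := h.measure_sum_ge_le (measurable_noise (κ := κ) hq)
    -- With this multiplier the Hoeffding term c²w²/8 equals (2/w²) · d²/4, so dividing by 2/w²
    -- leaves exactly a quarter of the sum of squares.
    (c := fun s ω => 2 / w ^ 2 * d (z s ω))
    (v := fun s ω => (2 / w ^ 2 * d (z s ω)) ^ 2 * w ^ 2 / 8)
    (fun s hs => (hd.comp (h.z_meas s hs)).const_mul _)
    (fun s hs => ((((hd.comp (h.z_meas s hs)).const_mul _).pow_const 2).mul_const _).div_const _)
    (fun s _ ω => lintegral_exp_le_one_of_mem_Icc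
      (hq.comp (measurable_const.prodMk measurable_id)) (hb (z s ω)) _) Y
  refine (measure_mono fun ω hω => ?_).trans key
  simp only [Set.mem_ofPred_eq] at hω ⊢
  have e1 : ∑ s ∈ Finset.range n, (2 / w ^ 2 * d (z s ω)) ^ 2 * w ^ 2 / 8 =
      2 / w ^ 2 * ((∑ s ∈ Finset.range n, d (z s ω) ^ 2) / 4) := by
    rw [Finset.sum_div, Finset.mul_sum]
    refine Finset.sum_congr rfl fun s _ => ?_
    field_simp
    ring
  have e2 : ∑ s ∈ Finset.range n, 2 / w ^ 2 * d (z s ω) * noise κ q (z s ω) (x' s ω) =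
      2 / w ^ 2 * ∑ s ∈ Finset.range n, d (z s ω) * noise κ q (z s ω) (x' s ω) := by
    rw [Finset.mul_sum]
    exact Finset.sum_congr rfl fun s _ => by ring
  have e3 : Y = 2 / w ^ 2 * (w ^ 2 / 2 * Y) := by field_simp
  rw [e1, e2, e3, ← mul_add]
  exact mul_le_mul_of_nonneg_left hω.le (by positivity)

/-- Concentration of weighted noise, by Bernstein's bound: the weights control the variances up to
the factor `τ`. -/
theorem measure_weighted_noise_gt_le (h : AdaptedTransitions μ κ n 𝒢 z x') {d : Z → ℝ}
    (hd : Measurable d) {σ : ℕ → Ω → ℝ} (hσ : ∀ s < n, Measurable[𝒢 s] (σ s))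
    (hσ0 : ∀ s < n, ∀ ω, 0 < σ s ω) {e : Z → X → ℝ}
    (he : Measurable fun p : Z × X => e p.1 p.2) (hb : ∀ z y, |e z y| ≤ 2)
    (h0 : ∀ z, ∫ y, e z y ∂(κ z) = 0) {θ τ : ℝ} (hθ : 0 < θ) (hτ : 0 ≤ τ) (Y : ℝ) :
    μ {ω | (∀ s < n, 2 * θ * |d (z s ω)| ≤ σ s ω ^ 2 ∧
        ∫ y, e (z s ω) y ^ 2 ∂(κ (z s ω)) ≤ τ * σ s ω ^ 2) ∧
      θ * τ * (∑ s ∈ Finset.range n, d (z s ω) ^ 2 / σ s ω ^ 2) + Y / θ <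
      ∑ s ∈ Finset.range n, d (z s ω) / σ s ω ^ 2 * e (z s ω) (x' s ω)} ≤
      ENNReal.ofReal (Real.exp (-Y)) := by
  classical
  -- The increment and variance conditions hold only on an event. Multiplying the coefficients by
  -- the indicators of these past-measurable sets makes the moment bound hold everywhere and changes
  -- nothing on that event.
  let ok : ℕ → Set Ω := fun s => {ω | 2 * θ * |d (z s ω)| ≤ σ s ω ^ 2} ∩
    {ω | ∫ y, e (z s ω) y ^ 2 ∂(κ (z s ω)) ≤ τ * σ s ω ^ 2}
  have hok : ∀ s < n, MeasurableSet[𝒢 s] (ok s) := fun s hs => by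
    have hdz : Measurable[𝒢 s] fun ω => d (z s ω) := hd.comp (h.z_meas s hs)
    have hvar : Measurable fun z => ∫ y, e z y ^ 2 ∂(κ z) :=
      ((he.pow_const 2).stronglyMeasurable.integral_kernel_prod_right' (κ := κ)).measurable
    have hvz : Measurable[𝒢 s] fun ω => ∫ y, e (z s ω) y ^ 2 ∂(κ (z s ω)) :=
      hvar.comp (h.z_meas s hs)
    have habs : Measurable[𝒢 s] fun ω => |d (z s ω)| := measurable_abs.comp hdz
    exact (measurableSet_le (habs.const_mul (2 * θ)) ((hσ s hs).pow_const 2)).inter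
      (measurableSet_le hvz (((hσ s hs).pow_const 2).const_mul τ))
  have key := h.measure_sum_ge_le he
    (c := fun s => (ok s).indicator fun ω => θ * (d (z s ω) / σ s ω ^ 2))
    (v := fun s ω => θ ^ 2 * τ * (d (z s ω) ^ 2 / σ s ω ^ 2))
    (fun s hs => (((hd.comp (h.z_meas s hs)).div ((hσ s hs).pow_const 2)).const_mul θ).indicator
      (hok s hs))
    (fun s hs => (((hd.comp (h.z_meas s hs)).pow_const 2).div
      ((hσ s hs).pow_const 2)).const_mul _) ?_ Y
  · refine (measure_mono fun ω hω => ?_).trans key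
    obtain ⟨hω1, hω2⟩ := hω
    simp only [Set.mem_ofPred_eq]
    have e1 : ∑ s ∈ Finset.range n, θ ^ 2 * τ * (d (z s ω) ^ 2 / σ s ω ^ 2) =
        θ * (θ * τ * ∑ s ∈ Finset.range n, d (z s ω) ^ 2 / σ s ω ^ 2) := by
      rw [← Finset.mul_sum]
      ring
    have e2 : ∑ s ∈ Finset.range n, (ok s).indicator (fun ω => θ * (d (z s ω) / σ s ω ^ 2)) ω *
        e (z s ω) (x' s ω) =
        θ * ∑ s ∈ Finset.range n, d (z s ω) / σ s ω ^ 2 * e (z s ω) (x' s ω) := by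
      rw [Finset.mul_sum]
      refine Finset.sum_congr rfl fun s hs => ?_
      rw [Set.indicator_of_mem (show ω ∈ ok s from hω1 s (Finset.mem_range.1 hs))]
      ring
    have e3 : Y = θ * (Y / θ) := by field_simp
    rw [e1, e2, e3, ← mul_add]
    exact mul_le_mul_of_nonneg_left hω2.le hθ.le
  · intro s hs ω
    have hσp := hσ0 s hs ω
    refine lintegral_exp_le_one_of_abs_le (he.comp (measurable_const.prodMk measurable_id))
      (hb (z s ω)) (h0 _) ?_ ?_
    · by_cases hω : ω ∈ ok s
      · rw [Set.indicator_of_mem hω, abs_mul, abs_div, abs_of_pos hθ, abs_of_pos (pow_pos hσp 2)]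
        have h1 : 2 * θ * |d (z s ω)| ≤ σ s ω ^ 2 := hω.1
        rw [← mul_div_assoc, div_mul_eq_mul_div, div_le_one (pow_pos hσp 2)]
        linarith
      · rw [Set.indicator_of_notMem hω]
        simp
    · by_cases hω : ω ∈ ok s
      · rw [Set.indicator_of_mem hω]
        have h1 : ∫ y, e (z s ω) y ^ 2 ∂(κ (z s ω)) ≤ τ * σ s ω ^ 2 := hω.2
        calc (θ * (d (z s ω) / σ s ω ^ 2)) ^ 2 * ∫ y, e (z s ω) y ^ 2 ∂(κ (z s ω))
            ≤ (θ * (d (z s ω) / σ s ω ^ 2)) ^ 2 * (τ * σ s ω ^ 2) :=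
              mul_le_mul_of_nonneg_left h1 (sq_nonneg _)
          _ = θ ^ 2 * τ * (d (z s ω) ^ 2 / σ s ω ^ 2) := by
              field_simp
      · rw [Set.indicator_of_notMem hω]
        have : 0 ≤ θ ^ 2 * τ * (d (z s ω) ^ 2 / σ s ω ^ 2) := by positivity
        simpa using this

end AdaptedTransitions

/-- Union bound over a finite index set. -/
theorem measure_exists_mem_le {Ω ι : Type*} [MeasurableSpace Ω] {μ : Measure Ω} (I : Finset ι)
    {B : ι → Set Ω} {p : ℝ} (hB : ∀ i ∈ I, μ (B i) ≤ ENNReal.ofReal p) :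
    μ {ω | ∃ i ∈ I, ω ∈ B i} ≤ ENNReal.ofReal (I.card * p) := by
  have : {ω | ∃ i ∈ I, ω ∈ B i} = ⋃ i ∈ I, B i := by
    ext ω
    simp
  rw [this]
  refine (measure_biUnion_finset_le I B).trans ((Finset.sum_le_sum hB).trans_eq ?_)
  rw [Finset.sum_const, nsmul_eq_mul, ENNReal.ofReal_mul (Nat.cast_nonneg _),
    ENNReal.ofReal_natCast]

/-- The basic inequality of least squares. -/
theorem IsLeastSquares.sum_sq_sub_le {Z : Type*} {F : Finset (Z → ℝ)} {n : ℕ} {σ : Fin n → ℝ}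
    {z : Fin n → Z} {y : Fin n → ℝ} {g : Z → ℝ} (hg : IsLeastSquares F σ z y g) {f : Z → ℝ}
    (hf : f ∈ F) :
    ∑ i, (f (z i) - g (z i)) ^ 2 / σ i ^ 2 ≤
      2 * ∑ i, (g (z i) - f (z i)) / σ i ^ 2 * (y i - f (z i)) := by
  have h := hg.2 f hf
  have e : ∑ i, (g (z i) - y i) ^ 2 / σ i ^ 2 = ∑ i, (f (z i) - g (z i)) ^ 2 / σ i ^ 2 -
      2 * ∑ i, (g (z i) - f (z i)) / σ i ^ 2 * (y i - f (z i)) +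
      ∑ i, (f (z i) - y i) ^ 2 / σ i ^ 2 := by
    rw [Finset.mul_sum, ← Finset.sum_sub_distrib, ← Finset.sum_add_distrib]
    exact Finset.sum_congr rfl fun i _ => by ring
  linarith

namespace Setup

variable {X A Ω : Type*} [MeasurableSpace X] [MeasurableSpace A] [mΩ : MeasurableSpace Ω]

/-! ### The concentration events -/

/-- Concentration of the unweighted noise of the targets `q V`, `V ∈ 𝒱` with values in `[0, c]`,
along all differences of functions of `F^h`. -/
def NoiseConc (S : Setup X A) (R : RunData X A) (t h : ℕ) (𝒱 : Finset (X → ℝ)) (c : ℝ)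
    (q : (X → ℝ) → X × A → X → ℝ) (w Y : ℝ) : Prop :=
  ∀ V ∈ 𝒱, (∀ x, V x ∈ Set.Icc 0 c) → ∀ f ∈ S.F h, ∀ g ∈ S.F h,
    ∑ s ∈ Finset.range t,
      (f (z R s h) - g (z R s h)) * noise (S.M.P h) (q V) (z R s h) (R.x s (h + 1)) ≤
    (∑ s ∈ Finset.range t, (f (z R s h) - g (z R s h)) ^ 2) / 4 + w ^ 2 / 2 * Y

/-- Concentration of the weighted noise of the targets `q V`, `V ∈ 𝒱` with values in `[0, 1]`, at
the scales `θ k`, `k < m`. -/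
def WeightedNoiseConc (S : Setup X A) (R : RunData X A) (t h : ℕ) (𝒱 : Finset (X → ℝ))
    (q : (X → ℝ) → X × A → X → ℝ) (m : ℕ) (θ : ℕ → ℝ) (τ Y : ℝ) : Prop :=
  ∀ V ∈ 𝒱, (∀ x, V x ∈ Set.Icc (0 : ℝ) 1) → ∀ k < m, ∀ f ∈ S.F h, ∀ g ∈ S.F h,
    (∀ s < t, 2 * θ k * |f (z R s h) - g (z R s h)| ≤ R.sigBar s h ^ 2 ∧
      ∫ y, noise (S.M.P h) (q V) (z R s h) y ^ 2 ∂(S.M.P h (z R s h)) ≤ τ * R.sigBar s h ^ 2) →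
    ∑ s ∈ Finset.range t, (f (z R s h) - g (z R s h)) / R.sigBar s h ^ 2 *
      noise (S.M.P h) (q V) (z R s h) (R.x s (h + 1)) ≤
    θ k * τ * (∑ s ∈ Finset.range t, (f (z R s h) - g (z R s h)) ^ 2 / R.sigBar s h ^ 2) + Y / θ k

variable {S : Setup X A} {μ : Measure Ω} [IsProbabilityMeasure μ]
  {𝓗 : ℕ → ℕ → MeasurableSpace Ω} {R : Ω → RunData X A}

theorem measure_not_noiseConc_le (hA : S.Assumptions) (hrun : S.IsRandomRun μ 𝓗 R) {t h : ℕ}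
    (ht : t < S.T) (hh : h < S.M.H) {𝒱 : Finset (X → ℝ)} {c : ℝ}
    {q : (X → ℝ) → X × A → X → ℝ} {w : ℝ} (hw : 0 < w)
    (hq : ∀ V ∈ 𝒱, Measurable fun p : (X × A) × X => q V p.1 p.2)
    (hb : ∀ V ∈ 𝒱, (∀ x, V x ∈ Set.Icc 0 c) → ∀ z y, q V z y ∈ Set.Icc 0 w) (Y : ℝ) :
    μ {ω | ¬ S.NoiseConc (R ω) t h 𝒱 c q w Y} ≤
      ENNReal.ofReal (𝒱.card * (S.F h).card ^ 2 * Real.exp (-Y)) := by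
  classical
  -- The finite classes may contain functions outside the range, since `W` may have negative members
  -- and f_{t,-2} is not truncated from above. Only those in range enter the union bound.
  set 𝒱' := 𝒱.filter fun V => ∀ x, V x ∈ Set.Icc 0 c with h𝒱'
  let B : (X → ℝ) × (X × A → ℝ) × (X × A → ℝ) → Set Ω := fun p => {ω |
    (∑ s ∈ Finset.range t, (p.2.1 (z (R ω) s h) - p.2.2 (z (R ω) s h)) ^ 2) / 4 + w ^ 2 / 2 * Y <
    ∑ s ∈ Finset.range t, (p.2.1 (z (R ω) s h) - p.2.2 (z (R ω) s h)) *
      noise (S.M.P h) (q p.1) (z (R ω) s h) ((R ω).x s (h + 1))}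
  have hB : ∀ p ∈ 𝒱' ×ˢ S.F h ×ˢ S.F h, μ (B p) ≤ ENNReal.ofReal (Real.exp (-Y)) := by
    rintro ⟨V, f, g⟩ hp
    simp only [Finset.mem_product, h𝒱', Finset.mem_filter] at hp
    exact (hrun.adaptedTransitions ht.le hh).measure_noise_gt_le (d := fun z => f z - g z)
      ((hA.meas.F_meas h hh f hp.2.1).sub (hA.meas.F_meas h hh g hp.2.2)) (hq V hp.1.1) hw
      (hb V hp.1.1 hp.1.2) Y
  refine (measure_mono fun ω hω => ?_).trans ((measure_exists_mem_le _ hB).trans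
    (ENNReal.ofReal_le_ofReal ?_))
  · simp only [NoiseConc, Set.mem_ofPred_eq] at hω
    push Not at hω
    obtain ⟨V, hV, hV', f, hf, g, hg, hlt⟩ := hω
    exact ⟨(V, f, g), by simp only [Finset.mem_product, h𝒱', Finset.mem_filter]; tauto, hlt⟩
  · rw [Finset.card_product, Finset.card_product]
    push_cast
    have : (𝒱'.card : ℝ) ≤ 𝒱.card := Nat.cast_le.2 (Finset.card_filter_le _ _)
    rw [← pow_two]
    gcongr

theorem measure_not_weightedNoiseConc_le (hA : S.Assumptions) (hrun : S.IsRandomRun μ 𝓗 R)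
    {t h : ℕ} (ht : t < S.T) (hh : h < S.M.H) {𝒱 : Finset (X → ℝ)}
    {q : (X → ℝ) → X × A → X → ℝ} {a : ℝ}
    (hq : ∀ V ∈ 𝒱, Measurable fun p : (X × A) × X => q V p.1 p.2)
    (hb : ∀ V ∈ 𝒱, (∀ x, V x ∈ Set.Icc (0 : ℝ) 1) → ∀ z y, q V z y ∈ Set.Icc a (a + 2))
    (m : ℕ) {θ : ℕ → ℝ} (hθ : ∀ k, 0 < θ k) {τ : ℝ} (hτ : 0 ≤ τ) (Y : ℝ) :
    μ {ω | ¬ S.WeightedNoiseConc (R ω) t h 𝒱 q m θ τ Y} ≤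
      ENNReal.ofReal (𝒱.card * m * (S.F h).card ^ 2 * Real.exp (-Y)) := by
  classical
  set 𝒱' := 𝒱.filter fun V => ∀ x, V x ∈ Set.Icc (0 : ℝ) 1 with h𝒱'
  let B : (X → ℝ) × ℕ × (X × A → ℝ) × (X × A → ℝ) → Set Ω := fun p => {ω |
    (∀ s < t, 2 * θ p.2.1 * |p.2.2.1 (z (R ω) s h) - p.2.2.2 (z (R ω) s h)| ≤
        (R ω).sigBar s h ^ 2 ∧
      ∫ y, noise (S.M.P h) (q p.1) (z (R ω) s h) y ^ 2 ∂(S.M.P h (z (R ω) s h)) ≤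
        τ * (R ω).sigBar s h ^ 2) ∧
    θ p.2.1 * τ * (∑ s ∈ Finset.range t, (p.2.2.1 (z (R ω) s h) - p.2.2.2 (z (R ω) s h)) ^ 2 /
      (R ω).sigBar s h ^ 2) + Y / θ p.2.1 <
    ∑ s ∈ Finset.range t, (p.2.2.1 (z (R ω) s h) - p.2.2.2 (z (R ω) s h)) /
      (R ω).sigBar s h ^ 2 * noise (S.M.P h) (q p.1) (z (R ω) s h) ((R ω).x s (h + 1))}
  have hB : ∀ p ∈ 𝒱' ×ˢ Finset.range m ×ˢ S.F h ×ˢ S.F h,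
      μ (B p) ≤ ENNReal.ofReal (Real.exp (-Y)) := by
    rintro ⟨V, k, f, g⟩ hp
    simp only [Finset.mem_product, h𝒱', Finset.mem_filter] at hp
    have hb' := hb V hp.1.1 hp.1.2
    exact (hrun.adaptedTransitions ht.le hh).measure_weighted_noise_gt_le (d := fun z => f z - g z)
      ((hA.meas.F_meas h hh f hp.2.2.1).sub (hA.meas.F_meas h hh g hp.2.2.2))
      (σ := fun s ω => (R ω).sigBar s h) (fun s hs => hrun.sigBar_meas hA (hs.trans ht) hh)
      (fun s hs ω => hA.α_pos.trans_le (α_le_sigBar (hrun.follows ω) (hs.trans ht) hh))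
      (measurable_noise (hq V hp.1.1))
      (fun z y => (abs_noise_le (hq V hp.1.1) hb' z y).trans_eq (by ring))
      (integral_noise (hq V hp.1.1) hb') (hθ k) hτ Y
  refine (measure_mono fun ω hω => ?_).trans ((measure_exists_mem_le _ hB).trans
    (ENNReal.ofReal_le_ofReal ?_))
  · simp only [WeightedNoiseConc, Set.mem_ofPred_eq] at hω
    push Not at hω
    obtain ⟨V, hV, hV', k, hk, f, hf, g, hg, hc, hlt⟩ := hω
    exact ⟨(V, k, f, g), by
      simp only [Finset.mem_product, h𝒱', Finset.mem_filter, Finset.mem_range]; tauto, hc, hlt⟩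
  · rw [Finset.card_product, Finset.card_product, Finset.card_product, Finset.card_range]
    push_cast
    have : (𝒱'.card : ℝ) ≤ 𝒱.card := Nat.cast_le.2 (Finset.card_filter_le _ _)
    rw [← pow_two, ← mul_assoc]
    gcongr

end Setup

/-- The exponent 3 log pays for a union over V and a pair (f, g), at most n³ triples, and over `m`
scales; the excess powers of `C` and `δ` only help. -/
theorem cube_mul_exp_neg_log_le {n C m δ : ℝ} (hn : 1 ≤ n) (hC : 1 ≤ C) (hm : m ≤ C)
    (hδ : 0 < δ) (hδ1 : δ ≤ 1) : n ^ 3 * m * Real.exp (-(3 * Real.log (n * C / δ))) ≤ δ := by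
  have hn0 : 0 < n := by linarith
  have hC0 : 0 < C := by linarith
  have hu : 0 < n * C / δ := by positivity
  have e : Real.exp (-(3 * Real.log (n * C / δ))) = ((n * C / δ) ^ 3)⁻¹ := by
    rw [Real.exp_neg, show (3 : ℝ) = ((3 : ℕ) : ℝ) by norm_num, Real.exp_nat_mul, Real.exp_log hu]
  have hC3 : C ≤ C ^ 3 := le_self_pow₀ hC (by norm_num)
  have hδ3 : δ ^ 3 ≤ δ := pow_le_of_le_one hδ.le hδ1 (by norm_num)
  rw [e]
  calc n ^ 3 * m * ((n * C / δ) ^ 3)⁻¹ = m / C ^ 3 * δ ^ 3 := by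
        field_simp
    _ ≤ 1 * δ := by
        gcongr
        rw [div_le_one (by positivity)]
        linarith
    _ = δ := one_mul δ

theorem measure_not_le_of_five {Ω : Type*} [MeasurableSpace Ω] {μ : Measure Ω} {δ : ℝ}
    (hδ : 0 ≤ δ) {p₁ p₂ p₃ p₄ p₅ P : Ω → Prop} (h₁ : μ {ω | ¬ p₁ ω} ≤ ENNReal.ofReal δ)
    (h₂ : μ {ω | ¬ p₂ ω} ≤ ENNReal.ofReal δ) (h₃ : μ {ω | ¬ p₃ ω} ≤ ENNReal.ofReal δ)
    (h₄ : μ {ω | ¬ p₄ ω} ≤ ENNReal.ofReal δ) (h₅ : μ {ω | ¬ p₅ ω} ≤ ENNReal.ofReal δ)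
    (hP : ∀ ω, p₁ ω → p₂ ω → p₃ ω → p₄ ω → p₅ ω → P ω) :
    μ {ω | ¬ P ω} ≤ ENNReal.ofReal (5 * δ) := by
  have hsub : {ω | ¬ P ω} ⊆
      {ω | ¬ p₁ ω} ∪ ({ω | ¬ p₂ ω} ∪ ({ω | ¬ p₃ ω} ∪ ({ω | ¬ p₄ ω} ∪ {ω | ¬ p₅ ω}))) := by
    intro ω hω
    simp only [Set.mem_union, Set.mem_ofPred_eq] at hω ⊢
    have := hP ω
    tauto
  refine (measure_mono hsub).trans ?_
  refine (measure_union_le _ _).trans (le_trans (add_le_add h₁ ((measure_union_le _ _).trans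
    (add_le_add h₂ ((measure_union_le _ _).trans (add_le_add h₃ ((measure_union_le _ _).trans
    (add_le_add h₄ h₅))))))) ?_)
  rw [← ENNReal.ofReal_add hδ hδ, ← ENNReal.ofReal_add hδ (by positivity),
    ← ENNReal.ofReal_add hδ (by positivity), ← ENNReal.ofReal_add hδ (by positivity)]
  exact ENNReal.ofReal_le_ofReal (le_of_eq (by ring))

namespace Setup

variable {X A Ω : Type*} [MeasurableSpace X] [MeasurableSpace A] [mΩ : MeasurableSpace Ω]

/-! ### Numerical bounds for the logarithmic factors -/

section Numerics

variable {S : Setup X A}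

theorem δth_pos (hδ : 0 < S.δ) : 0 < S.δth := by
  unfold δth
  positivity

theorem δth_le (hδ : S.δ < 1 / 5) (hT : 0 < S.T) (hH : 0 < S.M.H) : S.δth ≤ 1 / 20 := by
  have h1 : (1 : ℝ) ≤ S.T := Nat.one_le_cast.2 hT
  have h2 : (1 : ℝ) ≤ S.M.H := Nat.one_le_cast.2 hH
  rw [δth, div_le_iff₀ (by positivity)]
  nlinarith

theorem one_le_log_four : 1 ≤ Real.log 4 := by
  rw [Real.le_log_iff_exp_le (by norm_num)]
  linarith [Real.exp_one_lt_d9]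

theorem two_le_log_eight : 2 ≤ Real.log 8 := by
  rw [Real.le_log_iff_exp_le (by norm_num), show (2 : ℝ) = 1 + 1 by norm_num, Real.exp_add]
  nlinarith [Real.exp_one_lt_d9, Real.exp_pos 1]

theorem four_le_ratio (hA : S.Assumptions) (hT : 0 < S.T) : 4 ≤ 4 * S.L * S.T / S.α := by
  have h1 : (1 : ℝ) ≤ S.T := Nat.one_le_cast.2 hT
  have h3 : 1 ≤ S.L * S.T := one_le_mul_of_one_le_of_one_le hA.one_le_L h1
  rw [le_div_iff₀ hA.α_pos]
  nlinarith [hA.α_le_one]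

/-- The second factor of `logFactor` is at least 4. The resulting bound leaves room for all dyadic
levels up to (4LT/α)². -/
theorem logFactor_ge (hA : S.Assumptions) (hT : 0 < S.T) :
    8 * Real.log (4 * S.L * S.T / S.α) + 8 ≤ S.logFactor := by
  have hr := four_le_ratio hA hT
  have h1 : 0 ≤ Real.log (4 * S.L * S.T / S.α) := Real.log_nonneg (by linarith)
  have h2 : 2 ≤ Real.log (8 * S.L / S.α ^ 2) := by
    refine two_le_log_eight.trans (Real.log_le_log (by norm_num) ?_)
    rw [le_div_iff₀ (pow_pos hA.α_pos 2)]
    nlinarith [hA.α_le_one, hA.one_le_L, hA.α_pos]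
  rw [logFactor]
  nlinarith

theorem sixteen_le_logFactor (hA : S.Assumptions) (hT : 0 < S.T) : 16 ≤ S.logFactor := by
  have h1 : 1 ≤ Real.log (4 * S.L * S.T / S.α) :=
    one_le_log_four.trans (Real.log_le_log (by norm_num) (four_le_ratio hA hT))
  linarith [logFactor_ge hA hT]

/-- The logarithmic factors of the unweighted radii are at least `1`. -/
theorem one_le_logProduct (hA : S.Assumptions) (hT : 0 < S.T) {c : ℝ} (hc : 1 ≤ c) :
    1 ≤ (2 * Real.log (c * S.L * S.T) + 2) * (Real.log (c * S.L) + 2) := by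
  have h1 : (1 : ℝ) ≤ S.T := Nat.one_le_cast.2 hT
  have h2 : 1 ≤ c * S.L := one_le_mul_of_one_le_of_one_le hc hA.one_le_L
  have h3 := Real.log_nonneg h2
  have h4 := Real.log_nonneg (one_le_mul_of_one_le_of_one_le h2 h1)
  nlinarith

theorem ups_arg_pos (hA : S.Assumptions) (hN : 1 ≤ S.N) (hT : 0 < S.T) :
    0 < (S.N : ℝ) ^ 2 * S.logFactor / S.δth := by
  have h1 : (1 : ℝ) ≤ S.N := Nat.one_le_cast.2 hN
  have h2 := sixteen_le_logFactor hA hT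
  have h3 := δth_pos hA.δ_pos
  positivity

theorem four_le_log (hA : S.Assumptions) (hδ : S.δ < 1 / 5) (hT : 0 < S.T) (hH : 0 < S.M.H)
    {n : ℝ} (hn : 1 ≤ n) : 4 ≤ Real.log (n * S.logFactor / S.δth) := by
  have h2 := sixteen_le_logFactor hA hT
  have h3 := δth_pos hA.δ_pos
  have h4 := δth_le hδ hT hH
  -- The argument is at least 16 · 20 = 320, which exceeds 8².
  have h5 : 4 * Real.log 8 / 2 ≤ Real.log (n * S.logFactor / S.δth) := by
    have e : 4 * Real.log 8 / 2 = Real.log (8 ^ 2) := by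
      rw [Real.log_pow]
      push_cast
      ring
    rw [e]
    refine Real.log_le_log (by norm_num) ?_
    rw [le_div_iff₀ h3]
    nlinarith
  linarith [two_le_log_eight]

theorem ups_sq (hA : S.Assumptions) (hδ : S.δ < 1 / 5) (hT : 0 < S.T) (hH : 0 < S.M.H)
    (hN : 1 ≤ S.N) : S.ups ^ 2 = Real.log ((S.N : ℝ) ^ 2 * S.logFactor / S.δth) := by
  have h1 : (1 : ℝ) ≤ S.N := Nat.one_le_cast.2 hN
  rw [ups, Real.sq_sqrt]
  linarith [four_le_log hA hδ hT hH (one_le_pow₀ h1 (n := 2))]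

theorem two_le_ups (hA : S.Assumptions) (hδ : S.δ < 1 / 5) (hT : 0 < S.T) (hH : 0 < S.M.H)
    (hN : 1 ≤ S.N) : 2 ≤ S.ups := by
  have h1 : (1 : ℝ) ≤ S.N := Nat.one_le_cast.2 hN
  refine Real.le_sqrt_of_sq_le ?_
  linarith [four_le_log hA hδ hT hH (one_le_pow₀ h1 (n := 2))]

/-- For the fixed function V⋆ the union runs only over pairs (f, g) and dyadic levels, and υ² pays
for precisely this, without 𝒩_b. -/
theorem exp_neg_ups_sq (hA : S.Assumptions) (hδ : S.δ < 1 / 5) (hT : 0 < S.T) (hH : 0 < S.M.H)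
    (hN : 1 ≤ S.N) : (S.N : ℝ) ^ 2 * S.logFactor * Real.exp (-S.ups ^ 2) = S.δth := by
  have h1 : (1 : ℝ) ≤ S.N := Nat.one_le_cast.2 hN
  have h2 := sixteen_le_logFactor hA hT
  have h3 := δth_pos hA.δ_pos
  rw [ups_sq hA hδ hT hH hN, Real.exp_neg, Real.exp_log (ups_arg_pos hA hN hT)]
  have : S.logFactor ≠ 0 := by linarith
  field_simp

theorem one_le_card_product (hN : 1 ≤ S.N) (hNb : 1 ≤ S.Nb) : (1 : ℝ) ≤ (S.N : ℝ) * S.Nb :=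
  one_le_mul_of_one_le_of_one_le (Nat.one_le_cast.2 hN) (Nat.one_le_cast.2 hNb)

theorem iota_sq (hA : S.Assumptions) (hδ : S.δ < 1 / 5) (hT : 0 < S.T) (hH : 0 < S.M.H)
    (hN : 1 ≤ S.N) (hNb : 1 ≤ S.Nb) :
    S.iota ^ 2 = 9 * Real.log ((S.N : ℝ) * S.Nb * S.logFactor / S.δth) := by
  rw [iota, mul_pow, Real.sq_sqrt]
  · norm_num
  · linarith [four_le_log hA hδ hT hH (one_le_card_product hN hNb)]

theorem iota_pos (hA : S.Assumptions) (hδ : S.δ < 1 / 5) (hT : 0 < S.T) (hH : 0 < S.M.H)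
    (hN : 1 ≤ S.N) (hNb : 1 ≤ S.Nb) : 0 < S.iota := by
  rw [iota]
  have := four_le_log hA hδ hT hH (one_le_card_product hN hNb)
  have := Real.sqrt_pos.2 (show 0 < Real.log ((S.N : ℝ) * S.Nb * S.logFactor / S.δth) by linarith)
  linarith

theorem log_div_δth_nonneg (hA : S.Assumptions) (hδ : S.δ < 1 / 5) (hT : 0 < S.T)
    (hH : 0 < S.M.H) {n : ℝ} (hn : 1 ≤ n) : 0 ≤ Real.log (n / S.δth) := by
  refine Real.log_nonneg ?_
  rw [le_div_iff₀ (δth_pos hA.δ_pos)]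
  linarith [δth_le hδ hT hH]

theorem iotaDot_sq (hA : S.Assumptions) (hδ : S.δ < 1 / 5) (hT : 0 < S.T) (hH : 0 < S.M.H)
    (hN : 1 ≤ S.N) (hNb : 1 ≤ S.Nb) :
    S.iotaDot ^ 2 = 2 * Real.log ((S.N : ℝ) * S.Nb *
      ((2 * Real.log (18 * S.L * S.T) + 2) * (Real.log (18 * S.L) + 2)) / S.δth) := by
  rw [iotaDot, ← mul_assoc ((S.N : ℝ) * S.Nb), Real.sq_sqrt]
  rw [mul_assoc ((S.N : ℝ) * S.Nb)]
  have := log_div_δth_nonneg hA hδ hT hH (one_le_mul_of_one_le_of_one_le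
    (one_le_card_product hN hNb) (one_le_logProduct hA hT (c := 18) (by norm_num)))
  linarith

theorem iotaPrime_sq (hA : S.Assumptions) (hδ : S.δ < 1 / 5) (hT : 0 < S.T) (hH : 0 < S.M.H)
    (hN : 1 ≤ S.N) (hNb : 1 ≤ S.Nb) :
    S.iotaPrime ^ 2 = 2 * Real.log ((S.N : ℝ) * S.Nb *
      ((2 * Real.log (32 * S.L * S.T) + 2) * (Real.log (32 * S.L) + 2)) / S.δth) := by
  rw [iotaPrime, ← mul_assoc ((S.N : ℝ) * S.Nb), Real.sq_sqrt]
  rw [mul_assoc ((S.N : ℝ) * S.Nb)]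
  have := log_div_δth_nonneg hA hδ hT hH (one_le_mul_of_one_le_of_one_le
    (one_le_card_product hN hNb) (one_le_logProduct hA hT (c := 32) (by norm_num)))
  linarith

end Numerics

/-! ### The concentration inequalities and their total failure probability -/

/-- The number of dyadic levels used for the weighted noise. -/
noncomputable def levels (S : Setup X A) : ℕ := ⌊S.logFactor⌋₊

/-- The scale for the noise of the optimal value function at the dyadic level `k`. -/
noncomputable def scaleStar (S : Setup X A) (k : ℕ) : ℝ := S.ups / √(2 ^ k + S.lam)

/-- The scale for the noise of `f_{t,1} - V_⋆` at the dyadic level `k`. -/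
noncomputable def scaleDiff (S : Setup X A) (k : ℕ) : ℝ := S.iota ^ 2 / √(2 ^ k + S.lam)

/-- All concentration inequalities needed in episode `t` at level `h`. -/
structure Conc (S : Setup X A) (R : RunData X A) (t h : ℕ) : Prop where
  overlyOpt : S.NoiseConc R t h (S.class2 (h + 1)) 2 (fun V z y => S.M.r h z y + V y) 3
    (3 / 2 * S.iotaDot ^ 2)
  overlyPess : S.NoiseConc R t h (S.classm2 (h + 1)) 2 (fun V z y => S.M.r h z y + V y) 3
    (3 / 2 * S.iotaDot ^ 2)
  secondMoment : S.NoiseConc R t h (S.class1 (h + 1)) 1 (fun V z y => (S.M.r h z y + V y) ^ 2) 4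
    (3 / 2 * S.iotaPrime ^ 2)
  star : S.WeightedNoiseConc R t h {S.M.optV (h + 1)} (fun V z y => S.M.r h z y + V y) S.levels
    S.scaleStar 1 (S.ups ^ 2)
  diff : S.WeightedNoiseConc R t h (S.class1 (h + 1)) (fun V _ y => V y - S.M.optV (h + 1) y)
    S.levels S.scaleDiff (1 / (2 * S.iota ^ 2)) (S.iota ^ 2 / 3)

variable {S : Setup X A} {μ : Measure Ω} [IsProbabilityMeasure μ]
  {𝓗 : ℕ → ℕ → MeasurableSpace Ω} {R : Ω → RunData X A}

theorem measure_not_conc_le (hA : S.Assumptions) (hδ : S.δ < 1 / 5)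
    (hrun : S.IsRandomRun μ 𝓗 R) {t h : ℕ} (ht : t < S.T) (hh : h < S.M.H) :
    μ {ω | ¬ S.Conc (R ω) t h} ≤ ENNReal.ofReal (5 * S.δth) := by
  have := hA.nonempty
  have hT : 0 < S.T := by omega
  have hH : 0 < S.M.H := by omega
  have hN := one_le_N hA hh
  -- A realization of the run is needed to see that `W` is nonempty: it contains the oracle's
  -- output.
  obtain ⟨ω₀⟩ : Nonempty Ω := μ.nonempty_of_neZero
  have hNb := one_le_Nb hA (hrun.follows ω₀) ht hh
  have hδ0 := δth_pos hA.δ_pos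
  have hδ1 : S.δth ≤ 1 := (δth_le hδ hT hH).trans (by norm_num)
  have hN' : (1 : ℝ) ≤ S.N := Nat.one_le_cast.2 hN
  have hNb' : (1 : ℝ) ≤ S.Nb := Nat.one_le_cast.2 hNb
  have hNN := one_le_card_product hN hNb
  have hF : ((S.F h).card : ℝ) ≤ S.N := Nat.cast_le.2 (card_F_le hh)
  have hlog := sixteen_le_logFactor hA hT
  have hlev : (S.levels : ℝ) ≤ S.logFactor := Nat.floor_le (by linarith)
  have hups := two_le_ups hA hδ hT hH hN
  have hiota := iota_pos hA hδ hT hH hN hNb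
  have hstar_meas : Measurable (S.M.optV (h + 1)) :=
    EpisodicMDP.measurable_optV hA.meas.max_star hh
  have hstar := EpisodicMDP.optV_mem_Icc hA.sparse (h := h + 1) hh
  have hpow : ∀ k : ℕ, 0 < √((2 : ℝ) ^ k + S.lam) := fun k =>
    Real.sqrt_pos.2 (by have := hA.lam_pos; positivity)
  have hc1 : ((S.class1 (h + 1)).card : ℝ) ≤ S.N * S.Nb := by
    exact_mod_cast card_class1_le hN hNb (h + 1)
  have hcm2 : ((S.classm2 (h + 1)).card : ℝ) ≤ S.N * S.Nb := by
    exact_mod_cast card_classm2_le hN hNb (h + 1)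
  have hc2 : ((S.class2 (h + 1)).card : ℝ) ≤ S.N * S.Nb ^ 2 := by
    exact_mod_cast card_class2_le hN hNb (h + 1)
  have hcube1 : (S.N : ℝ) * S.Nb * S.N ^ 2 ≤ ((S.N : ℝ) * S.Nb) ^ 3 := by
    have : (S.Nb : ℝ) ≤ S.Nb ^ 3 := le_self_pow₀ hNb' (by norm_num)
    calc (S.N : ℝ) * S.Nb * (S.N : ℝ) ^ 2 = (S.N : ℝ) ^ 3 * (S.Nb : ℝ) := by ring
      _ ≤ (S.N : ℝ) ^ 3 * (S.Nb : ℝ) ^ 3 := by gcongr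
      _ = _ := by ring
  have hcube2 : (S.N : ℝ) * S.Nb ^ 2 * S.N ^ 2 ≤ ((S.N : ℝ) * S.Nb) ^ 3 := by
    have : (S.Nb : ℝ) ^ 2 ≤ S.Nb ^ 3 := pow_le_pow_right₀ hNb' (by norm_num)
    calc (S.N : ℝ) * (S.Nb : ℝ) ^ 2 * (S.N : ℝ) ^ 2 = (S.N : ℝ) ^ 3 * (S.Nb : ℝ) ^ 2 := by ring
      _ ≤ (S.N : ℝ) ^ 3 * (S.Nb : ℝ) ^ 3 := by gcongr
      _ = _ := by ring
  have p1 := measure_not_noiseConc_le hA hrun ht hh (𝒱 := S.class2 (h + 1)) (c := 2)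
    (q := fun V z y => S.M.r h z y + V y) (w := 3) (by norm_num)
    (fun V hV => S.M.measurable_return h (measurable_of_mem_class2 hA hV))
    (fun V _ hV z y => by
      have := EpisodicMDP.return_mem_Icc hh hV z y
      norm_num at this ⊢
      exact this) (3 / 2 * S.iotaDot ^ 2)
  have p2 := measure_not_noiseConc_le hA hrun ht hh (𝒱 := S.classm2 (h + 1)) (c := 2)
    (q := fun V z y => S.M.r h z y + V y) (w := 3) (by norm_num)
    (fun V hV => S.M.measurable_return h (measurable_of_mem_classm2 hA hV))
    (fun V _ hV z y => by
      have := EpisodicMDP.return_mem_Icc hh hV z y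
      norm_num at this ⊢
      exact this) (3 / 2 * S.iotaDot ^ 2)
  have p3 := measure_not_noiseConc_le hA hrun ht hh (𝒱 := S.class1 (h + 1)) (c := 1)
    (q := fun V z y => (S.M.r h z y + V y) ^ 2) (w := 4) (by norm_num)
    (fun V hV => (S.M.measurable_return h (measurable_of_mem_class1 hA hV)).pow_const 2)
    (fun V _ hV z y => by
      have := EpisodicMDP.return_mem_Icc hh hV z y
      exact ⟨sq_nonneg _, by nlinarith [this.1, this.2]⟩) (3 / 2 * S.iotaPrime ^ 2)
  have p4 := measure_not_weightedNoiseConc_le hA hrun ht hh (𝒱 := {S.M.optV (h + 1)})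
    (q := fun V z y => S.M.r h z y + V y) (a := 0)
    (fun V hV => S.M.measurable_return h (by rwa [Finset.mem_singleton.1 hV]))
    (fun V _ hV z y => by
      have := EpisodicMDP.return_mem_Icc hh hV z y
      norm_num at this ⊢
      exact this) S.levels (θ := S.scaleStar) (fun k => div_pos (by linarith) (hpow k))
    zero_le_one (S.ups ^ 2)
  have p5 := measure_not_weightedNoiseConc_le hA hrun ht hh (𝒱 := S.class1 (h + 1))
    (q := fun V _ y => V y - S.M.optV (h + 1) y) (a := -1)
    (fun V hV => ((measurable_of_mem_class1 hA hV).sub hstar_meas).comp measurable_snd)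
    (fun V _ hV z y => by
      have h1 := hV y
      have h2 := hstar y
      constructor <;> linarith [h1.1, h1.2, h2.1, h2.2])
    S.levels (θ := S.scaleDiff) (fun k => div_pos (pow_pos hiota 2) (hpow k))
    (τ := 1 / (2 * S.iota ^ 2)) (by positivity) (S.iota ^ 2 / 3)
  -- Since ι̇² is twice a logarithm, (3/2) ι̇² is three times it, which matches the cubic number of
  -- triples; `prime` is the same for ι'.
  have dot : ∀ K : ℝ, K ≤ ((S.N : ℝ) * S.Nb) ^ 3 →
      K * Real.exp (-(3 / 2 * S.iotaDot ^ 2)) ≤ S.δth := fun K hK => by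
    refine le_trans ?_ (cube_mul_exp_neg_log_le hNN
      (one_le_logProduct hA hT (c := 18) (by norm_num))
      (one_le_logProduct hA hT (c := 18) (by norm_num)) hδ0 hδ1)
    rw [iotaDot_sq hA hδ hT hH hN hNb, mul_one, ← mul_assoc]
    norm_num
    gcongr
  have prime : ∀ K : ℝ, K ≤ ((S.N : ℝ) * S.Nb) ^ 3 →
      K * Real.exp (-(3 / 2 * S.iotaPrime ^ 2)) ≤ S.δth := fun K hK => by
    refine le_trans ?_ (cube_mul_exp_neg_log_le hNN
      (one_le_logProduct hA hT (c := 32) (by norm_num))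
      (one_le_logProduct hA hT (c := 32) (by norm_num)) hδ0 hδ1)
    rw [iotaPrime_sq hA hδ hT hH hN hNb, mul_one, ← mul_assoc]
    norm_num
    gcongr
  have q1 : μ {ω | ¬ S.NoiseConc (R ω) t h (S.class2 (h + 1)) 2
      (fun V z y => S.M.r h z y + V y) 3 (3 / 2 * S.iotaDot ^ 2)} ≤ ENNReal.ofReal S.δth := by
    refine p1.trans (ENNReal.ofReal_le_ofReal (dot _ (le_trans ?_ hcube2)))
    gcongr
  have q2 : μ {ω | ¬ S.NoiseConc (R ω) t h (S.classm2 (h + 1)) 2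
      (fun V z y => S.M.r h z y + V y) 3 (3 / 2 * S.iotaDot ^ 2)} ≤ ENNReal.ofReal S.δth := by
    refine p2.trans (ENNReal.ofReal_le_ofReal (dot _ (le_trans ?_ hcube1)))
    gcongr
  have q3 : μ {ω | ¬ S.NoiseConc (R ω) t h (S.class1 (h + 1)) 1
      (fun V z y => (S.M.r h z y + V y) ^ 2) 4 (3 / 2 * S.iotaPrime ^ 2)} ≤
      ENNReal.ofReal S.δth := by
    refine p3.trans (ENNReal.ofReal_le_ofReal (prime _ (le_trans ?_ hcube1)))
    gcongr
  have q4 := p4.trans (ENNReal.ofReal_le_ofReal (q := S.δth) (by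
    rw [← exp_neg_ups_sq hA hδ hT hH hN, Finset.card_singleton, Nat.cast_one, one_mul,
      mul_comm ((S.N : ℝ) ^ 2)]
    gcongr))
  have q5 := p5.trans (ENNReal.ofReal_le_ofReal (q := S.δth) (by
    refine le_trans ?_ (cube_mul_exp_neg_log_le hNN (by linarith : 1 ≤ S.logFactor) hlev hδ0 hδ1)
    rw [iota_sq hA hδ hT hH hN hNb]
    -- The factor 3 in the definition of ι makes ι²/3 three times the logarithm, so the cubic union
    -- bound applies once more.
    have e : 9 * Real.log ((S.N : ℝ) * S.Nb * S.logFactor / S.δth) / 3 =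
      3 * Real.log ((S.N : ℝ) * S.Nb * S.logFactor / S.δth) := by ring
    rw [e]
    refine mul_le_mul_of_nonneg_right ?_ (Real.exp_pos _).le
    calc ((S.class1 (h + 1)).card : ℝ) * S.levels * ((S.F h).card : ℝ) ^ 2
        ≤ ((S.N : ℝ) * S.Nb) * S.levels * (S.N : ℝ) ^ 2 := by gcongr
      _ = (S.N : ℝ) * S.Nb * (S.N : ℝ) ^ 2 * S.levels := by ring
      _ ≤ _ := by gcongr))
  exact measure_not_le_of_five hδ0.le q1 q2 q3 q4 q5 fun ω => Conc.mk

/-- The concentration inequalities hold in all episodes and levels with probability `1 - 5δ`. -/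
theorem measure_not_forall_conc_le (hA : S.Assumptions) (hδ : S.δ < 1 / 5)
    (hrun : S.IsRandomRun μ 𝓗 R) :
    μ {ω | ¬ ∀ t < S.T, ∀ h < S.M.H, S.Conc (R ω) t h} ≤ ENNReal.ofReal (5 * S.δ) := by
  have hB : ∀ p ∈ Finset.range S.T ×ˢ Finset.range S.M.H,
      μ {ω | ¬ S.Conc (R ω) p.1 p.2} ≤ ENNReal.ofReal (5 * S.δth) := fun p hp => by
    rw [Finset.mem_product, Finset.mem_range, Finset.mem_range] at hp
    exact measure_not_conc_le hA hδ hrun hp.1 hp.2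
  refine (measure_mono fun ω hω => ?_).trans ((measure_exists_mem_le _ hB).trans
    (ENNReal.ofReal_le_ofReal ?_))
  · simp only [Set.mem_ofPred_eq] at hω
    push Not at hω
    obtain ⟨t, ht, h, hh, hc⟩ := hω
    exact ⟨(t, h), by simp [ht, hh], hc⟩
  · rw [Finset.card_product, Finset.card_range, Finset.card_range, δth]
    push_cast
    have h1 : (0 : ℝ) ≤ S.T := Nat.cast_nonneg _
    have h2 : (0 : ℝ) ≤ S.M.H := Nat.cast_nonneg _
    rw [← mul_div_assoc, ← mul_div_assoc, div_le_iff₀ (by positivity)]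
    nlinarith [mul_nonneg h1 h2, hA.δ_pos, mul_nonneg h1 hA.δ_pos.le, mul_nonneg h2 hA.δ_pos.le]

end Setup

/-! ### Confidence sets of the unweighted regressions -/

/-- A least squares solution is close to every approximate regression function, up to noise. -/
theorem IsLeastSquares.sum_sq_le_noise {Z X : Type*} [MeasurableSpace Z] [MeasurableSpace X]
    {κ : Kernel Z X} {F : Finset (Z → ℝ)} {L ε a : ℝ} (hL : 0 ≤ L) (ha : 0 < a)
    (hF : ∀ f ∈ F, ∀ z, f z ∈ Set.Icc 0 L) {t : ℕ} {σ : ℕ → ℝ} (hσ : ∀ s < t, a ≤ σ s)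
    {z : ℕ → Z} {x' : ℕ → X} {q : Z → X → ℝ} {g f : Z → ℝ}
    (hg : IsLeastSquares F (fun i : Fin t => σ i) (fun i => z i) (fun i => q (z i) (x' i)) g)
    (hf : f ∈ F) (hfq : ∀ z, |f z - ∫ y, q z y ∂(κ z)| ≤ ε) :
    ∑ s ∈ Finset.range t, (f (z s) - g (z s)) ^ 2 / σ s ^ 2 ≤
      2 * ∑ s ∈ Finset.range t, (g (z s) - f (z s)) / σ s ^ 2 * noise κ q (z s) (x' s) +
        2 * (t * L * ε / a ^ 2) := by
  have h := hg.sum_sq_sub_le hf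
  rw [← Finset.sum_range (fun s => (f (z s) - g (z s)) ^ 2 / σ s ^ 2),
    ← Finset.sum_range (fun s => (g (z s) - f (z s)) / σ s ^ 2 * (q (z s) (x' s) - f (z s)))] at h
  refine h.trans ?_
  rw [← mul_add]
  refine mul_le_mul_of_nonneg_left ?_ zero_le_two
  -- Replacing `f` by the true conditional mean costs at most Lε/a² per sample, because |g - f| ≤ L.
  have hb : ∀ s ∈ Finset.range t,
      (g (z s) - f (z s)) / σ s ^ 2 * (q (z s) (x' s) - f (z s)) ≤
        (g (z s) - f (z s)) / σ s ^ 2 * noise κ q (z s) (x' s) + L * ε / a ^ 2 := fun s hs => by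
    have hσs := hσ s (Finset.mem_range.1 hs)
    have h1 := hF g hg.1 (z s)
    have h2 := hF f hf (z s)
    have h3 := hfq (z s)
    have hd : |g (z s) - f (z s)| ≤ L :=
      abs_le.2 ⟨by linarith [h1.1, h2.2], by linarith [h1.2, h2.1]⟩
    have hε : 0 ≤ ε := (abs_nonneg _).trans h3
    have e : (g (z s) - f (z s)) / σ s ^ 2 * (q (z s) (x' s) - f (z s)) -
        (g (z s) - f (z s)) / σ s ^ 2 * noise κ q (z s) (x' s) =
        (g (z s) - f (z s)) * -(f (z s) - ∫ y, q (z s) y ∂(κ (z s))) / σ s ^ 2 := by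
      rw [noise]
      ring
    have hle : (g (z s) - f (z s)) * -(f (z s) - ∫ y, q (z s) y ∂(κ (z s))) ≤ L * ε := by
      refine (le_abs_self _).trans ?_
      rw [abs_mul, abs_neg]
      exact mul_le_mul hd h3 (abs_nonneg _) hL
    have : (g (z s) - f (z s)) * -(f (z s) - ∫ y, q (z s) y ∂(κ (z s))) / σ s ^ 2 ≤
        L * ε / a ^ 2 := by
      have := mul_nonneg hL hε
      gcongr
    linarith
  refine (Finset.sum_le_sum hb).trans_eq ?_
  rw [Finset.sum_add_distrib, Finset.sum_const, Finset.card_range, nsmul_eq_mul]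
  ring

theorem mem_Icc_two_of_one {X : Type*} {V : X → ℝ} (hV : ∀ x, V x ∈ Set.Icc (0 : ℝ) 1) (x : X) :
    V x ∈ Set.Icc (0 : ℝ) 2 := ⟨(hV x).1, (hV x).2.trans one_le_two⟩

namespace Setup

variable {X A : Type*} [MeasurableSpace X] [MeasurableSpace A] {S : Setup X A} {R : RunData X A}

/-- The basic inequality doubles the Q/4 of the noise bound to Q/2. This is absorbed on the left, at
the price of doubling the remaining terms. -/
theorem sum_sq_le_of_noiseConc (hA : S.Assumptions) {t h : ℕ} (hh : h < S.M.H)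
    {𝒱 : Finset (X → ℝ)} {c : ℝ} {q : (X → ℝ) → X × A → X → ℝ} {w Y : ℝ}
    (hconc : S.NoiseConc R t h 𝒱 c q w Y) {V : X → ℝ} (hV : V ∈ 𝒱)
    (hVb : ∀ x, V x ∈ Set.Icc 0 c) {g f : X × A → ℝ}
    (hg : IsLeastSquares (S.F h) (fun _ => 1) (zs R t h)
      (fun s : Fin t => q V (z R s h) (R.x s (h + 1))) g)
    (hf : f ∈ S.approximants h fun z => ∫ y, q V z y ∂(S.M.P h z)) :
    ∑ i, (f (zs R t h i) - g (zs R t h i)) ^ 2 / 1 ^ 2 ≤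
      2 * w ^ 2 * Y + 4 * (t * S.L * S.eps) := by
  have h1 := IsLeastSquares.sum_sq_le_noise (κ := S.M.P h) (L := S.L) (ε := S.eps) (a := 1)
    (zero_le_one.trans hA.one_le_L) one_pos (hA.complete.range h hh) (t := t) (σ := fun _ => 1)
    (fun _ _ => le_rfl) (z := fun s => z R s h) (x' := fun s => R.x s (h + 1)) (q := q V) hg hf.1
    hf.2
  have h2 := hconc V hV hVb g hg.1 f hf.1
  have e : ∑ i, (f (zs R t h i) - g (zs R t h i)) ^ 2 / 1 ^ 2 =
      ∑ s ∈ Finset.range t, (g (z R s h) - f (z R s h)) ^ 2 := by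
    rw [Finset.sum_range]
    refine Finset.sum_congr rfl fun i _ => ?_
    simp only [zs]
    ring
  have e1 : ∑ s ∈ Finset.range t, (f (z R s h) - g (z R s h)) ^ 2 / (1 : ℝ) ^ 2 =
      ∑ s ∈ Finset.range t, (g (z R s h) - f (z R s h)) ^ 2 :=
    Finset.sum_congr rfl fun s _ => by ring
  simp only [one_pow, div_one] at h1 e1
  rw [e1] at h1
  rw [e]
  linarith

theorem beta2_sq (hA : S.Assumptions) (t : ℕ) :
    S.beta2 t ^ 2 = 2 * (24 * S.L + 21) * S.iotaDot ^ 2 + 20 * (t + 1) * S.L * S.eps := by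
  have := hA.one_le_L
  have := hA.eps_nonneg
  rw [beta2, Real.sq_sqrt (by positivity)]

theorem betaBar_sq (hA : S.Assumptions) (t : ℕ) :
    S.betaBar t ^ 2 = 8 * (11 * S.L + 9) * S.iotaPrime ^ 2 + 32 * (t + 1) * S.L * S.eps := by
  have := hA.one_le_L
  have := hA.eps_nonneg
  rw [betaBar, Real.sq_sqrt (by positivity)]

/-- There is ample room: 27 ι̇² against at least 90 ι̇², as L ≥ 1. -/
theorem le_beta2_sq (hA : S.Assumptions) (t : ℕ) :
    2 * 3 ^ 2 * (3 / 2 * S.iotaDot ^ 2) + 4 * (t * S.L * S.eps) ≤ S.beta2 t ^ 2 := by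
  have h1 := hA.one_le_L
  have h2 : 0 ≤ S.L * S.eps := mul_nonneg (by linarith) hA.eps_nonneg
  have h3 : 0 ≤ (t : ℝ) * (S.L * S.eps) := mul_nonneg (Nat.cast_nonneg _) h2
  rw [beta2_sq hA]
  nlinarith [mul_nonneg (sub_nonneg.2 h1) (sq_nonneg S.iotaDot), sq_nonneg S.iotaDot]

theorem le_betaBar_sq (hA : S.Assumptions) (t : ℕ) :
    2 * 4 ^ 2 * (3 / 2 * S.iotaPrime ^ 2) + 4 * (t * S.L * S.eps) ≤ S.betaBar t ^ 2 := by
  have h1 := hA.one_le_L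
  have h2 : 0 ≤ S.L * S.eps := mul_nonneg (by linarith) hA.eps_nonneg
  have h3 : 0 ≤ (t : ℝ) * (S.L * S.eps) := mul_nonneg (Nat.cast_nonneg _) h2
  rw [betaBar_sq hA]
  nlinarith [mul_nonneg (sub_nonneg.2 h1) (sq_nonneg S.iotaPrime), sq_nonneg S.iotaPrime]

theorem maxA_f1_mem_Icc (hA : S.Assumptions) (hR : S.FollowsAlgorithm R) {t : ℕ} (ht : t < S.T)
    (h : ℕ) (x : X) : maxA (S.f1 R t h) x ∈ Set.Icc (0 : ℝ) 1 :=
  have := hA.nonempty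
  maxA_mem_Icc (f1_mem_Icc hA hR ht h) x

theorem maxA_f2_mem_Icc (hA : S.Assumptions) (hR : S.FollowsAlgorithm R) {t : ℕ} (ht : t < S.T)
    (h : ℕ) (x : X) : maxA (S.f2 R t h) x ∈ Set.Icc (0 : ℝ) 2 :=
  have := hA.nonempty
  maxA_mem_Icc (f2_mem_Icc hA hR ht h) x

theorem measurable_maxA_f1 (hA : S.Assumptions) (hR : S.FollowsAlgorithm R) {t : ℕ} (ht : t < S.T)
    (h : ℕ) : Measurable (maxA (S.f1 R t h)) :=
  measurable_of_mem_class1 hA (maxA_f1_mem hA hR ht h)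

theorem measurable_maxA_f2 (hA : S.Assumptions) (hR : S.FollowsAlgorithm R) {t : ℕ} (ht : t < S.T)
    (h : ℕ) : Measurable (maxA (S.f2 R t h)) :=
  measurable_of_mem_class2 hA (maxA_f2_mem hA hR ht h)

theorem measurable_maxA_fm2 (hA : S.Assumptions) (hR : S.FollowsAlgorithm R) {t : ℕ}
    (ht : t < S.T) (h : ℕ) : Measurable (maxA (S.fm2 R t h)) :=
  measurable_of_mem_classm2 hA (maxA_fm2_mem hA hR ht h)

theorem approximants_subset_conf2 (hA : S.Assumptions) (hR : S.FollowsAlgorithm R) {t h : ℕ}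
    (ht : t < S.T) (hh : h < S.M.H) (hconc : S.Conc R t h) :
    S.approximants h (S.M.bellman h (maxA (S.f2 R t (h + 1)))) ⊆ S.conf2 R t h := fun _ hf =>
  ⟨hf.1, (sum_sq_le_of_noiseConc hA hh hconc.overlyOpt (maxA_f2_mem hA hR ht _)
    (maxA_f2_mem_Icc hA hR ht _) (hR.fhat2_ls t ht h hh) hf).trans (le_beta2_sq hA t)⟩

theorem approximants_subset_confG (hA : S.Assumptions) (hR : S.FollowsAlgorithm R) {t h : ℕ}
    (ht : t < S.T) (hh : h < S.M.H) (hconc : S.Conc R t h) :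
    S.approximants h (S.M.bellman₂ h (maxA (S.f1 R t (h + 1)))) ⊆ S.confG R t h := fun _ hf =>
  ⟨hf.1, (sum_sq_le_of_noiseConc hA hh hconc.secondMoment (maxA_f1_mem hA hR ht _)
    (maxA_f1_mem_Icc hA hR ht _) (hR.ghat_ls t ht h hh) hf).trans (le_betaBar_sq hA t)⟩

/-- The range of f_{t,-2} is a hypothesis because the algorithm truncates it only from below. The
upper bound comes from pessimism at level h + 1. -/
theorem approximants_subset_confm2 (hA : S.Assumptions) (hR : S.FollowsAlgorithm R) {t h : ℕ}
    (ht : t < S.T) (hh : h < S.M.H) (hconc : S.Conc R t h)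
    (hb : ∀ x, maxA (S.fm2 R t (h + 1)) x ∈ Set.Icc (0 : ℝ) 2) :
    S.approximants h (S.M.bellman h (maxA (S.fm2 R t (h + 1)))) ⊆ S.confm2 R t h := fun _ hf =>
  ⟨hf.1, (sum_sq_le_of_noiseConc hA hh hconc.overlyPess (maxA_fm2_mem hA hR ht _) hb
    (hR.fhatm2_ls t ht h hh) hf).trans (le_beta2_sq hA t)⟩

/-! ### Optimism and pessimism -/

theorem approximants_nonempty (hA : S.Assumptions) {h : ℕ} (hh : h < S.M.H) {V : X → ℝ}
    (hm : Measurable V) (hV : ∀ x, V x ∈ Set.Icc (0 : ℝ) 2) :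
    (S.approximants h (S.M.bellman h V)).Nonempty := by
  obtain ⟨f, hf⟩ := hA.complete.first h hh V hm hV
  exact ⟨f, hf⟩

/-- The pessimistic function lies below its Bellman backup. -/
theorem fm2_le_bellman (hA : S.Assumptions) (hR : S.FollowsAlgorithm R) {t h : ℕ}
    (ht : t < S.T) (hh : h < S.M.H) (hconc : S.Conc R t h)
    (hb : ∀ x, maxA (S.fm2 R t (h + 1)) x ∈ Set.Icc (0 : ℝ) 2) (z : X × A) :
    S.fm2 R t h z ≤ S.M.bellman h (maxA (S.fm2 R t (h + 1))) z := by
  have hm := measurable_maxA_fm2 hA hR ht (h + 1)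
  obtain ⟨f, hf⟩ := approximants_nonempty hA hh hm hb
  have h1 := abs_le.1 (abs_sub_le_b2_of_mem_confm2 hA hR ht hh
    (approximants_subset_confm2 hA hR ht hh hconc hb hf) z)
  have h2 := abs_le.1 (hf.2 z)
  rw [fm2, if_pos hh]
  refine max_le ?_ (EpisodicMDP.bellman_mem_Icc hh hm hb z).1
  linarith [h1.1, h1.2, h2.1, h2.2]

/-- Going down the levels, f_{t,-2} ≤ Q⋆ ≤ 1 supplies the range bound that makes the next confidence
set valid, which in turn gives pessimism one level lower. -/
theorem fm2_le_optQ (hA : S.Assumptions) (hR : S.FollowsAlgorithm R) {t : ℕ} (ht : t < S.T)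
    (hconc : ∀ h < S.M.H, S.Conc R t h) {h : ℕ} (hh : h ≤ S.M.H) (z : X × A) :
    S.fm2 R t h z ≤ S.M.optQ h z := by
  have := hA.nonempty
  induction hh using Nat.decreasingInduction generalizing z with
  | self => simp [fm2, EpisodicMDP.optQ_terminal]
  | of_succ h hh ih =>
    have hb : ∀ x, maxA (S.fm2 R t (h + 1)) x ∈ Set.Icc (0 : ℝ) 1 := maxA_mem_Icc fun z =>
      ⟨fm2_nonneg t _ z, (ih z).trans (EpisodicMDP.optQ_mem_Icc hA.sparse hh z).2⟩
    rw [EpisodicMDP.optQ_eq_bellman hh]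
    refine (fm2_le_bellman hA hR ht hh (hconc h hh) (mem_Icc_two_of_one hb) z).trans ?_
    exact EpisodicMDP.bellman_mono hh (measurable_maxA_fm2 hA hR ht _)
      (EpisodicMDP.measurable_optV hA.meas.max_star hh) hb
      (EpisodicMDP.optV_mem_Icc hA.sparse hh)
      (maxA_mono ih fun z => (EpisodicMDP.optQ_mem_Icc hA.sparse hh z).2) z

theorem maxA_fm2_mem_Icc (hA : S.Assumptions) (hR : S.FollowsAlgorithm R) {t : ℕ} (ht : t < S.T)
    (hconc : ∀ h < S.M.H, S.Conc R t h) {h : ℕ} (hh : h ≤ S.M.H) (x : X) :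
    maxA (S.fm2 R t h) x ∈ Set.Icc (0 : ℝ) 1 := by
  have := hA.nonempty
  exact maxA_mem_Icc (fun z => ⟨fm2_nonneg t _ z, (fm2_le_optQ hA hR ht hconc hh z).trans
    (EpisodicMDP.optQ_mem_Icc hA.sparse hh z).2⟩) x

/-- The overly optimistic function exceeds the Bellman backup plus two optimistic bonuses, unless it
is truncated. -/
theorem le_f2 (hA : S.Assumptions) (hR : S.FollowsAlgorithm R) {t h : ℕ} (ht : t < S.T)
    (hh : h < S.M.H) (hconc : S.Conc R t h) (z : X × A) :
    min (S.M.bellman h (maxA (S.f2 R t (h + 1))) z + 2 * S.b1 R t h z + 2 * S.eps) 2 ≤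
      S.f2 R t h z := by
  obtain ⟨f, hf⟩ := approximants_nonempty hA hh (measurable_maxA_f2 hA hR ht (h + 1))
    (maxA_f2_mem_Icc hA hR ht (h + 1))
  have h1 := abs_le.1 (abs_sub_le_b2 hA hR ht hh
    (approximants_subset_conf2 hA hR ht hh hconc hf) z)
  have h2 := abs_le.1 (hf.2 z)
  have e : S.f2 R t h z =
      min (R.fhat2 t h z + 2 * S.b1 R t h z + S.b2 R t h z + 3 * S.eps) 2 := by
    rw [f2, if_pos hh, overlyOptimistic]
  rw [e]
  refine min_le_min ?_ le_rfl
  linarith [h1.1, h1.2, h2.1, h2.2]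

/-- One step of optimism. -/
theorem optQ_le_f1_of_succ (hA : S.Assumptions) (hR : S.FollowsAlgorithm R) {t h : ℕ}
    (ht : t < S.T) (hh : h < S.M.H)
    (hsub : S.approximants h (S.M.bellman h (maxA (S.f1 R t (h + 1)))) ⊆ S.conf1 R t h)
    (hopt : ∀ z, S.M.optQ (h + 1) z ≤ S.f1 R t (h + 1) z) (z : X × A) :
    S.M.optQ h z ≤ S.f1 R t h z := by
  have := hA.nonempty
  have hm := measurable_maxA_f1 hA hR ht (h + 1)
  have hb := maxA_f1_mem_Icc hA hR ht (h + 1)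
  obtain ⟨f, hf⟩ := approximants_nonempty hA hh hm (mem_Icc_two_of_one hb)
  have h1 := abs_le.1 (abs_sub_le_b1 hA hR ht hh (hsub hf) z)
  have h2 := abs_le.1 (hf.2 z)
  have h3 : S.M.optQ h z ≤ S.M.bellman h (maxA (S.f1 R t (h + 1))) z := by
    rw [EpisodicMDP.optQ_eq_bellman hh]
    exact EpisodicMDP.bellman_mono hh (EpisodicMDP.measurable_optV hA.meas.max_star hh) hm
      (EpisodicMDP.optV_mem_Icc hA.sparse hh) hb
      (maxA_mono hopt fun z => (f1_mem_Icc hA hR ht _ z).2) z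
  rw [f1, if_pos hh]
  -- Truncation at 1 preserves optimism because sparse rewards force Q⋆ ≤ 1.
  refine le_min ?_ (EpisodicMDP.optQ_mem_Icc hA.sparse hh.le z).2
  linarith [h1.1, h1.2, h2.1, h2.2]

/-- One step of the comparison of later optimistic with earlier overly optimistic functions. -/
theorem f1_le_f2_of_succ (hA : S.Assumptions) (hR : S.FollowsAlgorithm R) {s t h : ℕ}
    (hst : s ≤ t) (ht : t < S.T) (hh : h < S.M.H) (hconc : S.Conc R s h)
    (hsub : S.approximants h (S.M.bellman h (maxA (S.f1 R t (h + 1)))) ⊆ S.conf1 R t h)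
    (hle : ∀ z, S.f1 R t (h + 1) z ≤ S.f2 R s (h + 1) z) (z : X × A) :
    S.f1 R t h z ≤ S.f2 R s h z := by
  have hs := hst.trans_lt ht
  have hm := measurable_maxA_f1 hA hR ht (h + 1)
  have hb := maxA_f1_mem_Icc hA hR ht (h + 1)
  obtain ⟨f, hf⟩ := approximants_nonempty hA hh hm (mem_Icc_two_of_one hb)
  have h1 := abs_le.1 (abs_sub_le_b1 hA hR ht hh (hsub hf) z)
  have h2 := abs_le.1 (hf.2 z)
  have h3 : S.M.bellman h (maxA (S.f1 R t (h + 1))) z ≤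
      S.M.bellman h (maxA (S.f2 R s (h + 1))) z :=
    EpisodicMDP.bellman_mono hh hm (measurable_maxA_f2 hA hR hs _) hb
      (maxA_f2_mem_Icc hA hR hs _) (maxA_mono hle fun z => (f2_mem_Icc hA hR hs _ z).2) z
  -- Before truncation f_{t,1} exceeds its backup by at most 2b_{t,1} + 2ε. The surplus 2b_{s,1} +
  -- 2ε of f_{s,2} covers this since bonuses decrease.
  have h4 := b1_antitone hA hR hst ht hh z
  refine le_trans ?_ (le_f2 hA hR hs hh hconc z)
  rw [f1, if_pos hh]
  refine min_le_min ?_ one_le_two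
  linarith [h1.1, h1.2, h2.1, h2.2]

/-! ### The weights control the conditional variances -/

theorem sqrt_sigmaSq_le (hR : S.FollowsAlgorithm R) {s h : ℕ} (hs : s < S.T) (hh : h < S.M.H) :
    √(S.sigmaSq R s h) ≤ R.sigBar s h := by
  rw [hR.sigBar_eq s hs h hh]
  exact (le_max_left _ _).trans (le_max_left _ _)

theorem gap_le_sigBar_sq (hA : S.Assumptions) (hR : S.FollowsAlgorithm R) {s h : ℕ}
    (hs : s < S.T) (hh : h < S.M.H) :
    2 * S.iota ^ 2 * (S.f2 R s h (z R s h) - S.fm2 R s h (z R s h)) ≤ R.sigBar s h ^ 2 := by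
  have hσ := hA.α_pos.trans_le (α_le_sigBar hR hs hh)
  rcases le_total (S.f2 R s h (z R s h) - S.fm2 R s h (z R s h)) 0 with h0 | h0
  · exact (mul_nonpos_of_nonneg_of_nonpos (by positivity) h0).trans (sq_nonneg _)
  · have h1 : √2 * S.iota * √(S.f2 R s h (z R s h) - S.fm2 R s h (z R s h)) ≤ R.sigBar s h := by
      rw [hR.sigBar_eq s hs h hh]
      exact (le_max_left _ _).trans (le_max_right _ _)
    have hi : 0 ≤ S.iota := by
      rw [iota]
      positivity
    have h2 := pow_le_pow_left₀ (by positivity) h1 2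
    rwa [mul_pow, mul_pow, Real.sq_sqrt h0, Real.sq_sqrt zero_le_two] at h2

/-- This part of the weight keeps the increments small enough for Bernstein at both scales, one with
numerator υ and one with ι²; it uses (√υ + ι)² ≥ υ + ι². -/
theorem eluderD_le_sigBar_sq (hR : S.FollowsAlgorithm R) {s h : ℕ}
    (hs : s < S.T) (hh : h < S.M.H) :
    4 * (S.ups + S.iota ^ 2) * eluderD (S.F h) S.lam (sigs R s h) (zs R s h) (z R s h) ≤
      R.sigBar s h ^ 2 := by
  set D := eluderD (S.F h) S.lam (sigs R s h) (zs R s h) (z R s h) with hD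
  have hD0 : 0 ≤ D := Real.sqrt_nonneg _
  have hu0 : 0 ≤ S.ups := Real.sqrt_nonneg _
  have hi : 0 ≤ S.iota := by
    rw [iota]
    positivity
  have h1 : 2 * (√S.ups + S.iota) * √D ≤ R.sigBar s h := by
    rw [hR.sigBar_eq s hs h hh]
    exact (le_max_right _ _).trans (le_max_right _ _)
  have h2 := pow_le_pow_left₀ (by positivity) h1 2
  rw [mul_pow, mul_pow, Real.sq_sqrt hD0] at h2
  refine le_trans (mul_le_mul_of_nonneg_right ?_ hD0) h2
  nlinarith [Real.sq_sqrt hu0, mul_nonneg (Real.sqrt_nonneg S.ups) hi]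

/-- The confidence sets bound the pointwise error of the unweighted regressions. -/
theorem abs_sub_le_of_mem_confSet (hA : S.Assumptions) {t h : ℕ} {g : X × A → ℝ}
    (hg : g ∈ S.F h) {β : ℝ} {f : X × A → ℝ}
    (hf : f ∈ confSet (S.F h) (fun _ => 1) (zs R t h) g β) (z : X × A) :
    |f z - g z| ≤ eluderD (S.F h) S.lam (fun _ => 1) (zs R t h) z * √(β ^ 2 + S.lam) :=
  (abs_sub_le_eluderD_mul hA.lam_pos (fun _ => 1) (zs R t h) hf.1 hg z).trans
    (mul_le_mul_of_nonneg_left (Real.sqrt_le_sqrt (by linarith [hf.2])) (Real.sqrt_nonneg _))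

/-- The conditional variance of the return of the optimal value function is at most `σ̄²`. -/
theorem variance_star_le (hA : S.Assumptions) (hR : S.FollowsAlgorithm R) {s h : ℕ}
    (hs : s < S.T) (hh : h < S.M.H) (hconc : ∀ h < S.M.H, S.Conc R s h)
    (hopt : ∀ z, S.M.optQ (h + 1) z ≤ S.f1 R s (h + 1) z) :
    ∫ y, noise (S.M.P h) (fun z y => S.M.r h z y + S.M.optV (h + 1) y) (z R s h) y ^ 2
      ∂(S.M.P h (z R s h)) ≤ R.sigBar s h ^ 2 := by
  have := hA.nonempty
  have hVm : Measurable (S.M.optV (h + 1)) := EpisodicMDP.measurable_optV hA.meas.max_star hh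
  have hVb := EpisodicMDP.optV_mem_Icc hA.sparse (h := h + 1) hh
  have hsig : √(S.sigmaSq R s h) ^ 2 ≤ R.sigBar s h ^ 2 :=
    pow_le_pow_left₀ (Real.sqrt_nonneg _) (sqrt_sigmaSq_le hR hs hh) 2
  set w := z R s h with hw
  have hvar := integral_noise_sq (κ := S.M.P h) (S.M.measurable_return h hVm)
    (EpisodicMDP.return_mem_Icc hh hVb) w
  have hvar' : ∫ y, noise (S.M.P h) (fun z y => S.M.r h z y + S.M.optV (h + 1) y) w y ^ 2
      ∂(S.M.P h w) = S.M.bellman₂ h (S.M.optV (h + 1)) w -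
        S.M.bellman h (S.M.optV (h + 1)) w ^ 2 := hvar
  have hnn : 0 ≤ ∫ y, noise (S.M.P h) (fun z y => S.M.r h z y + S.M.optV (h + 1) y) w y ^ 2
      ∂(S.M.P h w) := integral_nonneg fun y => sq_nonneg _
  rw [hvar'] at hnn ⊢
  -- A variance is nonnegative, so this bound also shows that `sigmaSq` is nonnegative and its
  -- square root is a genuine one.
  suffices hle : S.M.bellman₂ h (S.M.optV (h + 1)) w - S.M.bellman h (S.M.optV (h + 1)) w ^ 2 ≤
      S.sigmaSq R s h by
    rw [Real.sq_sqrt (hnn.trans hle)] at hsig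
    exact hle.trans hsig
  have h4 : S.M.bellman₂ h (S.M.optV (h + 1)) w - S.M.bellman h (S.M.optV (h + 1)) w ^ 2 ≤ 4 := by
    have h1 := (EpisodicMDP.bellman₂_mem_Icc hh hVm hVb w).2
    nlinarith [sq_nonneg (S.M.bellman h (S.M.optV (h + 1)) w)]
  rw [sigmaSq]
  split_ifs with hs0
  · exact h4
  refine le_min h4 ?_
  have hm1 := measurable_maxA_f1 hA hR hs (h + 1)
  have hb1 := maxA_f1_mem_Icc hA hR hs (h + 1)
  have hmm := measurable_maxA_fm2 hA hR hs (h + 1)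
  have hbm := maxA_fm2_mem_Icc hA hR hs hconc (h := h + 1) hh
  -- The second moment is bounded above by optimism and the squared mean below by pessimism; both
  -- bounds are then replaced by their regression estimates.
  have hT2 : S.M.bellman₂ h (S.M.optV (h + 1)) w ≤
      S.M.bellman₂ h (maxA (S.f1 R s (h + 1))) w :=
    EpisodicMDP.bellman₂_mono hh hVm hm1 hVb hb1
      (maxA_mono hopt fun z => (f1_mem_Icc hA hR hs _ z).2) w
  have hT : S.M.bellman h (maxA (S.fm2 R s (h + 1))) w ≤ S.M.bellman h (S.M.optV (h + 1)) w :=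
    EpisodicMDP.bellman_mono hh hmm hVm hbm hVb
      (maxA_mono (fm2_le_optQ hA hR hs hconc hh)
        fun z => (EpisodicMDP.optQ_mem_Icc hA.sparse hh z).2) w
  obtain ⟨ψ, hψF, hψ⟩ := hA.complete.second h hh _ hm1 hb1
  obtain ⟨f, hf⟩ := approximants_nonempty hA hh hmm (mem_Icc_two_of_one hbm)
  have hG := abs_le.1 (abs_sub_le_of_mem_confSet hA (hR.ghat_ls s hs h hh).1
    (approximants_subset_confG hA hR hs hh (hconc h hh) ⟨hψF, hψ⟩) w)
  have hF := abs_le.1 (abs_sub_le_of_mem_confSet hA (hR.fhatm2_ls s hs h hh).1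
    (approximants_subset_confm2 hA hR hs hh (hconc h hh) (mem_Icc_two_of_one hbm) hf) w)
  have hψw := abs_le.1 (hψ w)
  have hfw := abs_le.1 (hf.2 w)
  have hT0 := (EpisodicMDP.bellman_mem_Icc hh hmm hbm w).1
  have hstar1 : S.M.bellman h (S.M.optV (h + 1)) w ≤ 1 := by
    rw [← EpisodicMDP.optQ_eq_bellman hh]
    exact (EpisodicMDP.optQ_mem_Icc hA.sparse hh.le w).2
  have hfhat := hA.complete.range h hh _ (hR.fhatm2_ls s hs h hh).1 w
  set D := eluderD (S.F h) S.lam (fun _ => 1) (zs R s h) w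
  have hD0 : 0 ≤ D := Real.sqrt_nonneg _
  set p := √(S.betaBar s ^ 2 + S.lam)
  set q := √(S.beta2 s ^ 2 + S.lam)
  set b := S.M.bellman h (maxA (S.fm2 R s (h + 1))) w
  set v := S.M.bellman h (S.M.optV (h + 1)) w
  set g := R.fhatm2 s h w
  have hL := hA.one_le_L
  have heps := hA.eps_nonneg
  have hE : 0 ≤ D * q + S.eps := add_nonneg (mul_nonneg hD0 (Real.sqrt_nonneg _)) heps
  have hgb : g - b ≤ D * q + S.eps := by linarith [hF.1, hfw.2]
  -- The sum g + b is at most 2L because b ≤ 1 ≤ L; this is the origin of the factor 2L in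
  -- `sigmaSq`.
  have hsq : g ^ 2 - b ^ 2 ≤ 2 * S.L * (D * q + S.eps) := by
    have e : g ^ 2 - b ^ 2 = (g - b) * (g + b) := by ring
    rw [e]
    have hsum0 : 0 ≤ g + b := add_nonneg hfhat.1 hT0
    have hsum : g + b ≤ 2 * S.L := by linarith [hfhat.2]
    calc (g - b) * (g + b) ≤ (D * q + S.eps) * (g + b) := mul_le_mul_of_nonneg_right hgb hsum0
      _ ≤ (D * q + S.eps) * (2 * S.L) := mul_le_mul_of_nonneg_left hsum hE
      _ = _ := by ring
  have hbv : b ^ 2 ≤ v ^ 2 := pow_le_pow_left₀ hT0 hT 2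
  nlinarith [hG.2, hψw.1]

/-- The conditional variance of the error of a later optimistic value function is small. -/
theorem variance_diff_le (hA : S.Assumptions) (hR : S.FollowsAlgorithm R) (hι : 0 < S.iota)
    {s t h : ℕ} (hst : s ≤ t) (ht : t < S.T) (hh : h < S.M.H)
    (hconc : ∀ h < S.M.H, S.Conc R s h)
    (hopt : ∀ z, S.M.optQ (h + 1) z ≤ S.f1 R t (h + 1) z)
    (hle : ∀ z, S.f1 R t (h + 1) z ≤ S.f2 R s (h + 1) z) :
    ∫ y, noise (S.M.P h) (fun _ y => maxA (S.f1 R t (h + 1)) y - S.M.optV (h + 1) y) (z R s h) y ^ 2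
      ∂(S.M.P h (z R s h)) ≤ 1 / (2 * S.iota ^ 2) * R.sigBar s h ^ 2 := by
  have := hA.nonempty
  have hs := hst.trans_lt ht
  have hVm : Measurable (S.M.optV (h + 1)) := EpisodicMDP.measurable_optV hA.meas.max_star hh
  have hVb := EpisodicMDP.optV_mem_Icc hA.sparse (h := h + 1) hh
  have hm1 := measurable_maxA_f1 hA hR ht (h + 1)
  have hb1 := maxA_f1_mem_Icc hA hR ht (h + 1)
  have hm2 := measurable_maxA_f2 hA hR hs (h + 1)
  have hb2 := maxA_f2_mem_Icc hA hR hs (h + 1)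
  have hmm := measurable_maxA_fm2 hA hR hs (h + 1)
  have hbm := maxA_fm2_mem_Icc hA hR hs hconc (h := h + 1) hh
  set V := maxA (S.f1 R t (h + 1))
  set V' := S.M.optV (h + 1) with hV'
  have hVV' : ∀ y, V' y ≤ V y := maxA_mono hopt fun z => (f1_mem_Icc hA hR ht _ z).2
  have hgap := gap_le_sigBar_sq hA hR hs hh
  set w := z R s h
  have hqm : Measurable fun p : (X × A) × X => V p.2 - V' p.2 :=
    (hm1.sub hVm).comp measurable_snd
  have hqb : ∀ (_ : X × A) (y : X), V y - V' y ∈ Set.Icc (0 : ℝ) 1 := fun _ y =>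
    ⟨sub_nonneg.2 (hVV' y), by linarith [(hb1 y).2, (hVb y).1]⟩
  have hqi : Integrable (fun y => V y - V' y) (S.M.P h w) :=
    integrable_of_mem_Icc (κ := S.M.P h) (q := fun _ y => V y - V' y) hqm hqb w
  -- For a variable with values in [0, 1] the variance is at most the second moment, hence at most
  -- the mean.
  have hvar : ∫ y, noise (S.M.P h) (fun _ y => V y - V' y) w y ^ 2 ∂(S.M.P h w) ≤
      ∫ y, (V y - V' y) ∂(S.M.P h w) := by
    rw [integral_noise_sq (κ := S.M.P h) (q := fun _ y => V y - V' y) hqm hqb w]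
    have h1 : ∫ y, (V y - V' y) ^ 2 ∂(S.M.P h w) ≤ ∫ y, (V y - V' y) ∂(S.M.P h w) := by
      refine integral_mono_of_nonneg (Filter.Eventually.of_forall fun y => sq_nonneg _) hqi
        (Filter.Eventually.of_forall fun y => ?_)
      have := hqb w y
      exact pow_le_of_le_one this.1 this.2 two_ne_zero
    linarith [sq_nonneg (∫ y, (V y - V' y) ∂(S.M.P h w))]
  have hone : ∫ y, (V y - V' y) ∂(S.M.P h w) ≤ 1 := by
    refine (integral_mono hqi (integrable_const 1) fun y => (hqb w y).2).trans_eq ?_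
    simp
  have hdiff : ∫ y, (V y - V' y) ∂(S.M.P h w) = S.M.bellman h V w - S.M.bellman h V' w := by
    rw [EpisodicMDP.bellman, EpisodicMDP.bellman,
      ← integral_sub (EpisodicMDP.integrable_return hh hm1 hb1 w)
        (EpisodicMDP.integrable_return hh hVm hVb w)]
    exact integral_congr_ae (Filter.Eventually.of_forall fun y => by ring)
  have hup : S.M.bellman h V w ≤ S.M.bellman h (maxA (S.f2 R s (h + 1))) w :=
    EpisodicMDP.bellman_mono hh hm1 hm2 hb1 hb2
      (maxA_mono hle fun z => (f2_mem_Icc hA hR hs _ z).2) w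
  have hlow : S.M.bellman h (maxA (S.fm2 R s (h + 1))) w ≤ S.M.bellman h V' w :=
    EpisodicMDP.bellman_mono hh hmm hVm hbm hVb
      (maxA_mono (fm2_le_optQ hA hR hs hconc hh)
        fun z => (EpisodicMDP.optQ_mem_Icc hA.sparse hh z).2) w
  have hf2 := le_f2 hA hR hs hh (hconc h hh) w
  have hfm2 := fm2_le_bellman hA hR hs hh (hconc h hh) (mem_Icc_two_of_one hbm) w
  have hfm2' := (fm2_le_optQ hA hR hs hconc hh.le w).trans
    (EpisodicMDP.optQ_mem_Icc hA.sparse hh.le w).2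
  have hb0 := b1_nonneg hA hR hs hh w
  -- If f_{s,2} is truncated at 2, the gap is still at least 2 - 1 = 1, which bounds the mean.
  have hmain : ∫ y, (V y - V' y) ∂(S.M.P h w) ≤ S.f2 R s h w - S.fm2 R s h w := by
    rcases min_le_iff.1 hf2 with h1 | h1
    · linarith [hA.eps_nonneg]
    · linarith
  rw [one_div, inv_mul_eq_div, le_div_iff₀ (by positivity)]
  calc _ ≤ (S.f2 R s h w - S.fm2 R s h w) * (2 * S.iota ^ 2) :=
        mul_le_mul_of_nonneg_right (hvar.trans hmain) (by positivity)
    _ ≤ _ := by linarith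

end Setup

/-! ### The confidence set of the weighted regression -/

/-- Solving the self-bounding inequality of the weighted regression. -/
theorem le_radius_sq_of_self_bound {Q υ lam E E' : ℝ} (hυ : 2 ≤ υ) (hlam : 0 < lam)
    (hE0 : 0 ≤ E) (hE : E ≤ E')
    (hB : 1 ≤ Q → ∃ B, Q ≤ B ∧ B ≤ 2 * Q ∧ Q ≤ 5 * υ * √(B + lam) + 2 * E) :
    Q ≤ (√(6 * √lam + 156) * υ + √(8 * E')) ^ 2 := by
  by_contra! hcon
  set l := √lam with hl
  have hl0 : 0 ≤ l := Real.sqrt_nonneg _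
  have hl2 : l ^ 2 = lam := Real.sq_sqrt hlam.le
  have hK : √(6 * l + 156) ^ 2 = 6 * l + 156 := Real.sq_sqrt (by positivity)
  have hE2 : √(8 * E') ^ 2 = 8 * E' := Real.sq_sqrt (by linarith)
  have hQ : (6 * l + 156) * υ ^ 2 + 8 * E' < Q := by
    have : 0 ≤ √(6 * l + 156) * υ * √(8 * E') := by positivity
    nlinarith
  have hu : 4 ≤ υ ^ 2 := by nlinarith
  have hQu : (6 * l + 156) * υ ^ 2 < Q := by linarith
  have hQ1 : 24 * l + 624 ≤ Q := by nlinarith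
  obtain ⟨B, hQB, hBQ, hself⟩ := hB (by linarith)
  -- The assumption for contradiction gives 8E ≤ Q, so 2E takes up at most a quarter of Q.
  have h1 : 3 / 4 * Q ≤ 5 * υ * √(B + lam) := by nlinarith [mul_nonneg hl0 (sq_nonneg υ)]
  have h2 : (3 / 4 * Q) ^ 2 ≤ (5 * υ * √(B + lam)) ^ 2 :=
    pow_le_pow_left₀ (by linarith) h1 2
  rw [mul_pow (5 * υ), Real.sq_sqrt (by linarith)] at h2
  have h3 : (5 * υ) ^ 2 * (B + lam) ≤ 25 * υ ^ 2 * (2 * Q + l ^ 2) := by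
    rw [mul_pow, hl2]
    nlinarith
  have h4 : 9 / 16 * ((6 * l + 156) * υ ^ 2) * Q ≤ (3 / 4 * Q) ^ 2 := by
    have : 0 ≤ Q * (Q - (6 * l + 156) * υ ^ 2) := mul_nonneg (by linarith) (by linarith)
    nlinarith
  have h5 : υ ^ 2 * ((27 / 8 * l + 37) * Q) ≤ υ ^ 2 * (25 * l ^ 2) := by nlinarith
  have h6 : (27 / 8 * l + 37) * Q ≤ 25 * l ^ 2 := le_of_mul_le_mul_left h5 (by linarith)
  -- Inserting Q ≥ 24 l + 624 makes the left side at least 81 l² plus a positive constant, which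
  -- exceeds 25 l².
  nlinarith [mul_le_mul_of_nonneg_left hQ1 (by linarith : 0 ≤ 27 / 8 * l + 37)]

namespace Setup

variable {X A : Type*} [MeasurableSpace X] [MeasurableSpace A] {S : Setup X A} {R : RunData X A}

theorem beta1_eq (hA : S.Assumptions) (t : ℕ) :
    S.beta1 t = √(6 * √S.lam + 156) * S.ups + √(8 * ((t + 1) * S.L * S.eps / S.α ^ 2)) := by
  have hδ := hA.δ_pos
  have e1 : (S.N : ℝ) ^ 2 * (S.T + 1) * (S.M.H + 1) * S.logFactor / S.δ =
      (S.N : ℝ) ^ 2 * S.logFactor / S.δth := by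
    rw [δth]
    field_simp
  have e2 : 8 * ((t : ℝ) + 1) * S.L / S.α ^ 2 * S.eps =
      8 * ((t + 1) * S.L * S.eps / S.α ^ 2) := by ring
  rw [beta1, ups, e1, e2]

/-- The dyadic levels cover all possible values of the weighted empirical distance. -/
theorem exists_level (hA : S.Assumptions) (hT : 0 < S.T) {Q : ℝ} (hQ1 : 1 ≤ Q)
    (hQ : Q ≤ S.T * (S.L ^ 2 / S.α ^ 2)) :
    ∃ k < S.levels, Q ≤ 2 ^ k ∧ (2 : ℝ) ^ k ≤ 2 * Q := by
  obtain ⟨n, hn1, hn2⟩ := exists_nat_pow_near hQ1 (one_lt_two : (1 : ℝ) < 2)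
  refine ⟨n + 1, ?_, hn2.le, by rw [pow_succ]; linarith⟩
  have hr := four_le_ratio hA hT
  set ρ := 4 * S.L * S.T / S.α with hρ
  have hT' : (1 : ℝ) ≤ S.T := Nat.one_le_cast.2 hT
  have hα := hA.α_pos
  have hQρ : Q ≤ ρ ^ 2 := by
    refine hQ.trans ?_
    have e : ρ ^ 2 = (16 * (S.T : ℝ) ^ 2) * (S.L ^ 2 / S.α ^ 2) := by
      rw [hρ]
      ring
    rw [e]
    exact mul_le_mul_of_nonneg_right (by nlinarith) (by positivity)
  have hlog : (n : ℝ) * Real.log 2 ≤ 2 * Real.log ρ := by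
    have := Real.log_le_log (by positivity) (hn1.trans hQρ)
    rw [Real.log_pow, Real.log_pow] at this
    exact_mod_cast this
  have hlog2 := Real.log_two_gt_d9
  have hn0 : (0 : ℝ) ≤ n := Nat.cast_nonneg n
  have hρ0 : 0 ≤ Real.log ρ := Real.log_nonneg (by linarith)
  have hge := logFactor_ge hA hT
  -- The levels are indexed from 0, so using level n + 1 requires n + 2 of them; n ≤ 2 log ρ / log 2
  -- leaves enough room.
  have : n + 2 ≤ S.levels := by
    refine Nat.le_floor ?_
    push_cast
    nlinarith
  omega

/-- The current V is compared with all earlier episodes because the weight σ̄_s, fixed in episode s,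
must control the variance of a function that is computed only in episode t. -/
theorem approximants_subset_conf1 (hA : S.Assumptions) (hδ : S.δ < 1 / 5)
    (hR : S.FollowsAlgorithm R) {t h : ℕ} (ht : t < S.T) (hh : h < S.M.H)
    (hconc : ∀ s ≤ t, ∀ h < S.M.H, S.Conc R s h)
    (hopt : ∀ s ≤ t, ∀ z, S.M.optQ (h + 1) z ≤ S.f1 R s (h + 1) z)
    (hle : ∀ s ≤ t, ∀ z, S.f1 R t (h + 1) z ≤ S.f2 R s (h + 1) z) :
    S.approximants h (S.M.bellman h (maxA (S.f1 R t (h + 1)))) ⊆ S.conf1 R t h := by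
  intro f hf
  have := hA.nonempty
  have hT : 0 < S.T := by omega
  have hH : 0 < S.M.H := by omega
  have hN := one_le_N hA hh
  have hNb := one_le_Nb hA hR ht hh
  have hυ := two_le_ups hA hδ hT hH hN
  have hι := iota_pos hA hδ hT hH hN hNb
  have hα := hA.α_pos
  have hL := hA.one_le_L
  have heps := hA.eps_nonneg
  have hVm : Measurable (S.M.optV (h + 1)) := EpisodicMDP.measurable_optV hA.meas.max_star hh
  have hVb := EpisodicMDP.optV_mem_Icc hA.sparse (h := h + 1) hh
  have hm1 := measurable_maxA_f1 hA hR ht (h + 1)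
  have hb1 := maxA_f1_mem_Icc hA hR ht (h + 1)
  have hgF := (hR.fhat1_ls t ht h hh).1
  have hσ : ∀ s < t, S.α ≤ R.sigBar s h := fun s hs => α_le_sigBar hR (hs.trans ht) hh
  set g := R.fhat1 t h with hg
  set V := maxA (S.f1 R t (h + 1)) with hV
  set V' := S.M.optV (h + 1) with hV'
  have hbasic := IsLeastSquares.sum_sq_le_noise (κ := S.M.P h) (L := S.L) (ε := S.eps)
    (a := S.α) (by linarith) hα (hA.complete.range h hh) (t := t) (σ := fun s => R.sigBar s h) hσ
    (z := fun s => z R s h) (x' := fun s => R.x s (h + 1))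
    (q := fun z y => S.M.r h z y + V y) (hR.fhat1_ls t ht h hh) hf.1 hf.2
  set Q := ∑ s ∈ Finset.range t, (f (z R s h) - g (z R s h)) ^ 2 / R.sigBar s h ^ 2 with hQ
  have hsum : ∑ i, (f (zs R t h i) - g (zs R t h i)) ^ 2 / sigs R t h i ^ 2 = Q := by
    rw [hQ, Finset.sum_range]
    rfl
  have hQ' : ∑ s ∈ Finset.range t, (g (z R s h) - f (z R s h)) ^ 2 / R.sigBar s h ^ 2 = Q :=
    Finset.sum_congr rfl fun s _ => by ring
  refine ⟨hf.1, ?_⟩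
  change ∑ i, (f (zs R t h i) - g (zs R t h i)) ^ 2 / sigs R t h i ^ 2 ≤ S.beta1 t ^ 2
  rw [hsum, beta1_eq hA]
  refine le_radius_sq_of_self_bound (E := t * S.L * S.eps / S.α ^ 2) hυ hA.lam_pos
    (by positivity) (by gcongr; linarith) fun hQ1 => ?_
  have hQT : Q ≤ S.T * (S.L ^ 2 / S.α ^ 2) := by
    have h1 : ∀ s ∈ Finset.range t,
        (f (z R s h) - g (z R s h)) ^ 2 / R.sigBar s h ^ 2 ≤ S.L ^ 2 / S.α ^ 2 := fun s hs => by
      have hσs := hσ s (Finset.mem_range.1 hs)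
      have h2 := hA.complete.range h hh f hf.1 (z R s h)
      have h3 := hA.complete.range h hh g hgF (z R s h)
      have h4 : (f (z R s h) - g (z R s h)) ^ 2 ≤ S.L ^ 2 :=
        sq_le_sq' (by linarith [h2.1, h3.2]) (by linarith [h2.2, h3.1])
      gcongr
    refine (Finset.sum_le_sum h1).trans ?_
    rw [Finset.sum_const, Finset.card_range, nsmul_eq_mul]
    have : (t : ℝ) ≤ S.T := Nat.cast_le.2 ht.le
    gcongr
  obtain ⟨k, hk, hQk, hkQ⟩ := exists_level hA hT hQ1 hQT
  refine ⟨2 ^ k, hQk, hkQ, ?_⟩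
  set ρ := √((2 : ℝ) ^ k + S.lam) with hρ
  have hρ0 : 0 < ρ := Real.sqrt_pos.2 (by have := hA.lam_pos; positivity)
  have hρ2 : ρ ^ 2 = 2 ^ k + S.lam := Real.sq_sqrt (by have := hA.lam_pos; positivity)
  -- The distance of f and g on the data before s is part of Q, which is at most 2^k; therefore D_F
  -- at z_s times ρ bounds the increment.
  have hincr : ∀ s < t, 4 * (S.ups + S.iota ^ 2) * |g (z R s h) - f (z R s h)| ≤
      ρ * R.sigBar s h ^ 2 := fun s hs => by
    have h1 := abs_sub_le_eluderD_mul hA.lam_pos (sigs R s h) (zs R s h) hgF hf.1 (z R s h)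
    have h2 := eluderD_le_sigBar_sq hR (hs.trans ht) hh
    set D := eluderD (S.F h) S.lam (sigs R s h) (zs R s h) (z R s h)
    have hD0 : 0 ≤ D := Real.sqrt_nonneg _
    have h3 : ∑ i, (g (zs R s h i) - f (zs R s h i)) ^ 2 / sigs R s h i ^ 2 ≤ Q := by
      rw [← hQ']
      refine le_trans (le_of_eq ?_) (Finset.sum_le_sum_of_subset_of_nonneg
        (Finset.range_subset_range.2 hs.le) fun i _ _ => by positivity)
      rw [Finset.sum_range]
      rfl
    have h4 : |g (z R s h) - f (z R s h)| ≤ D * ρ :=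
      h1.trans (mul_le_mul_of_nonneg_left (Real.sqrt_le_sqrt (by linarith)) hD0)
    calc 4 * (S.ups + S.iota ^ 2) * |g (z R s h) - f (z R s h)|
        ≤ 4 * (S.ups + S.iota ^ 2) * (D * ρ) := by gcongr
      _ = ρ * (4 * (S.ups + S.iota ^ 2) * D) := by ring
      _ ≤ ρ * R.sigBar s h ^ 2 := by gcongr
  have hscale : ∀ c, 0 ≤ c → c ≤ S.ups + S.iota ^ 2 → ∀ s < t,
      2 * (c / ρ) * |g (z R s h) - f (z R s h)| ≤ R.sigBar s h ^ 2 := fun c hc0 hc s hs => by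
    have h1 := hincr s hs
    have h2 := abs_nonneg (g (z R s h) - f (z R s h))
    have e : 2 * (c / ρ) * |g (z R s h) - f (z R s h)| =
        2 * c * |g (z R s h) - f (z R s h)| / ρ := by ring
    rw [e, div_le_iff₀ hρ0]
    nlinarith [mul_le_mul_of_nonneg_right hc h2, mul_nonneg hc0 h2]
  have hstar := (hconc t le_rfl h hh).star V' (Finset.mem_singleton_self _) hVb k hk g hgF f hf.1
    fun s hs => ⟨hscale S.ups (by linarith) (by nlinarith) s hs, by
      rw [one_mul]
      exact variance_star_le hA hR (hs.trans ht) hh (hconc s hs.le) (hopt s hs.le)⟩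
  have hdiff := (hconc t le_rfl h hh).diff V (maxA_f1_mem hA hR ht _) hb1 k hk g hgF f hf.1
    fun s hs => ⟨hscale (S.iota ^ 2) (sq_nonneg _) (by linarith) s hs,
      variance_diff_le hA hR hι hs.le ht hh (hconc s hs.le) (hopt t le_rfl) (hle s hs.le)⟩
  rw [hQ'] at hstar hdiff
  have hnoise : ∀ s, noise (S.M.P h) (fun z y => S.M.r h z y + V y) (z R s h) (R.x s (h + 1)) =
      noise (S.M.P h) (fun z y => S.M.r h z y + V' y) (z R s h) (R.x s (h + 1)) +
      noise (S.M.P h) (fun _ y => V y - V' y) (z R s h) (R.x s (h + 1)) := fun s => by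
    have e : ∫ y, (V y - V' y) ∂(S.M.P h (z R s h)) =
        ∫ y, (S.M.r h (z R s h) y + V y) ∂(S.M.P h (z R s h)) -
        ∫ y, (S.M.r h (z R s h) y + V' y) ∂(S.M.P h (z R s h)) := by
      rw [← integral_sub (EpisodicMDP.integrable_return hh hm1 hb1 _)
        (EpisodicMDP.integrable_return hh hVm hVb _)]
      exact integral_congr_ae (Filter.Eventually.of_forall fun y => by ring)
    rw [noise, noise, noise, e]
    ring
  simp only [hnoise, mul_add, Finset.sum_add_distrib] at hbasic
  have hQρ : Q ≤ ρ ^ 2 := by linarith [hA.lam_pos]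
  -- The scale υ/ρ balances the two Bernstein terms: each is at most υρ because Q ≤ ρ².
  have hstar' : S.scaleStar k * 1 * Q + S.ups ^ 2 / S.scaleStar k ≤ 2 * S.ups * ρ := by
    have e : S.scaleStar k = S.ups / ρ := rfl
    have e2 : S.ups ^ 2 / (S.ups / ρ) = S.ups * ρ := by
      field_simp
    have e3 : S.ups / ρ * 1 * Q ≤ S.ups * ρ := by
      rw [mul_one, div_mul_eq_mul_div, div_le_iff₀ hρ0, mul_assoc, ← pow_two]
      exact mul_le_mul_of_nonneg_left hQρ (by linarith)
    rw [e, e2]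
    linarith
  -- The small variance factor cancels ι², leaving ρ/2 + ρ/3, free of 𝒩_b.
  have hdiff' : S.scaleDiff k * (1 / (2 * S.iota ^ 2)) * Q + S.iota ^ 2 / 3 / S.scaleDiff k ≤
      ρ := by
    have e : S.scaleDiff k = S.iota ^ 2 / ρ := rfl
    have e2 : S.iota ^ 2 / 3 / (S.iota ^ 2 / ρ) = ρ / 3 := by
      field_simp
    have e3 : S.iota ^ 2 / ρ * (1 / (2 * S.iota ^ 2)) * Q ≤ ρ / 2 := by
      have e4 : S.iota ^ 2 / ρ * (1 / (2 * S.iota ^ 2)) * Q = Q / (2 * ρ) := by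
        field_simp
      rw [e4, div_le_iff₀ (by positivity)]
      linarith
    rw [e, e2]
    linarith
  -- The noise is at most 2υρ + ρ ≤ (5/2)υρ since υ ≥ 2, and the basic inequality doubles it.
  nlinarith

/-- The concentration inequalities imply optimism, the comparison of optimistic with earlier overly
optimistic functions, and the validity of the weighted confidence sets. -/
theorem optimism_of_conc (hA : S.Assumptions) (hδ : S.δ < 1 / 5) (hR : S.FollowsAlgorithm R)
    (hconc : ∀ t < S.T, ∀ h < S.M.H, S.Conc R t h) {t : ℕ} (ht : t < S.T) {h : ℕ}
    (hh : h ≤ S.M.H) :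
    (∀ z, S.M.optQ h z ≤ S.f1 R t h z) ∧ (∀ s ≤ t, ∀ z, S.f1 R t h z ≤ S.f2 R s h z) ∧
    (h < S.M.H →
      S.approximants h (S.M.bellman h (maxA (S.f1 R t (h + 1)))) ⊆ S.conf1 R t h) := by
  induction t using Nat.strong_induction_on generalizing h with
  | _ t iht =>
  induction hh using Nat.decreasingInduction with
  | self => simp [f1, f2, EpisodicMDP.optQ_terminal]
  | of_succ h hh ih =>
    have hopt : ∀ s ≤ t, ∀ z, S.M.optQ (h + 1) z ≤ S.f1 R s (h + 1) z := fun s hs => by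
      rcases hs.lt_or_eq with hlt | rfl
      · exact (iht s hlt (hlt.trans ht) hh).1
      · exact ih.1
    have hsub := approximants_subset_conf1 hA hδ hR ht hh
      (fun s hs => hconc s (hs.trans_lt ht)) hopt ih.2.1
    exact ⟨optQ_le_f1_of_succ hA hR ht hh hsub ih.1, fun s hs =>
      f1_le_f2_of_succ hA hR hs ht hh (hconc s (hs.trans_lt ht) h hh) hsub (ih.2.1 s hs),
      fun _ => hsub⟩

theorem goodEvent_of_conc (hA : S.Assumptions) (hδ : S.δ < 1 / 5) (hR : S.FollowsAlgorithm R)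
    (hconc : ∀ t < S.T, ∀ h < S.M.H, S.Conc R t h) : S.GoodEvent R := by
  intro t ht h hh
  have hm1 := measurable_maxA_f1 hA hR ht (h + 1)
  have hb1 := maxA_f1_mem_Icc hA hR ht (h + 1)
  have hbm := mem_Icc_two_of_one (maxA_fm2_mem_Icc hA hR ht (hconc t ht) (h := h + 1) hh)
  refine ⟨⟨approximants_nonempty hA hh hm1 (mem_Icc_two_of_one hb1),
      (optimism_of_conc hA hδ hR hconc ht hh.le).2.2 hh⟩,
    ⟨approximants_nonempty hA hh (measurable_maxA_f2 hA hR ht _) (maxA_f2_mem_Icc hA hR ht _),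
      approximants_subset_conf2 hA hR ht hh (hconc t ht h hh)⟩,
    ⟨approximants_nonempty hA hh (measurable_maxA_fm2 hA hR ht _) hbm,
      approximants_subset_confm2 hA hR ht hh (hconc t ht h hh) hbm⟩,
    ⟨?_, approximants_subset_confG hA hR ht hh (hconc t ht h hh)⟩⟩
  obtain ⟨f, hf⟩ := hA.complete.second h hh _ hm1 hb1
  exact ⟨f, hf⟩

end Setup

end VOQL

theorem mainTheorem5 {X A Ω : Type*} [MeasurableSpace X] [MeasurableSpace A] [MeasurableSpace Ω]
    (μ : MeasureTheory.Measure Ω) [MeasureTheory.IsProbabilityMeasure μ]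
    (S : VOQL.Setup X A)
    (hsparse : S.M.SparseReward) (hcomplete : S.EpsComplete)
    (hmeas : S.MeasurabilityConventions)
    (hL : 1 ≤ S.L) (heps : 0 ≤ S.eps) (heps1 : S.eps ≤ 1) (hepsb : 0 ≤ S.epsb)
    (hα : 0 < S.α) (hα1 : S.α ≤ 1) (hlam : 0 < S.lam) (hδ : 0 < S.δ)
    (horacle1 : S.IsBonusOracle S.beta1) (horacle2 : S.IsBonusOracle S.beta2)
    (hconsistent1 : S.IsConsistent S.beta1) (hconsistent2 : S.IsConsistent S.beta2)
    (𝓗 : ℕ → ℕ → MeasurableSpace Ω) (R : Ω → VOQL.RunData X A)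
    (hrun : S.IsRandomRun μ 𝓗 R) :
    μ {ω | ¬ S.GoodEvent (R ω)} ≤ ENNReal.ofReal (5 * S.δ) := by
  -- For δ ≥ 1/5 the claimed bound is at least 1. Otherwise δ is small enough for the lower bounds
  -- on the logarithms.
  rcases lt_or_ge S.δ (1 / 5) with hδ5 | hδ5
  · obtain ⟨ω₀⟩ : Nonempty Ω := μ.nonempty_of_neZero
    have hA : S.Assumptions :=
      { nonempty := ⟨(R ω₀).a 0 0⟩
        sparse := hsparse
        complete := hcomplete
        meas := hmeas
        one_le_L := hL
        eps_nonneg := heps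
        α_pos := hα
        α_le_one := hα1
        lam_pos := hlam
        δ_pos := hδ
        oracle1 := horacle1
        oracle2 := horacle2
        consistent1 := hconsistent1
        consistent2 := hconsistent2 }
    have hsub : {ω | ¬ S.GoodEvent (R ω)} ⊆
        {ω | ¬ ∀ t < S.T, ∀ h < S.M.H, S.Conc (R ω) t h} := fun ω hω hc =>
      hω (VOQL.Setup.goodEvent_of_conc hA hδ5 (hrun.follows ω) hc)
    exact (MeasureTheory.measure_mono hsub).trans
      (VOQL.Setup.measure_not_forall_conc_le hA hδ5 hrun)
  · refine MeasureTheory.prob_le_one.trans ?_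
    rw [ENNReal.one_le_ofReal]
    linarith
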